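/- Let $n\ge 3$, $m>0$, $\Lambda<0$, $\tilde\kappa\in\{-1,0,1\}$, and let $r_0>0$ be the radius of the event horizon, i.e. $h(r_0)=0$ for $h(r)=m r^{-(n-2)}+\frac{2}{n(n-1)}\Lambda r^2-\tilde\kappa$. Let $(M,\sigma)$ be a compact connected smooth Riemannian manifold of dimension $n-1$ and constant sectional curvature $\tilde\kappa$ (e.g. $M=S^{n-1}$ if $\tilde\kappa=1$), and let $\mathcal S_0=\mathbb R\times M$ carry the metric $d\tau^2+r_0^2\sigma$, with Laplacian $\Delta$ and scalar curvature $R$. The wave equation for $u=u(t,p)$, $t>0$, $p\in\mathcal S_0$, is $$\tfrac1{32}\tfrac{n^2}{n-1}\ddot u-(n-1)t^{2-\frac4n}\Delta u-\tfrac n2 t^{2-\frac4n}Ru+nt^2\Lambda u=0.$$ Let $(\varphi_j,\tilde\mu_j)_{j\ge0}$ be the (smooth, complex valued) eigenfunctions of $-\Delta_M$ with their eigenvalues in ascending order, repeated according to multiplicity, such that the $\varphi_j$ belonging to an eigenvalue form a basis of its eigenspace. Let $$B(w,\psi)=\int_0^\infty\Big\{\tfrac1{32}\tfrac{n^2}{n-1}\bar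 w'\psi'+n|\Lambda|t^2\bar w\psi\Big\}dt,\qquad K(w,\psi)=\int_0^\infty t^{2-\frac4n}\bar w\psi\,dt,$$ let $\mathcal H$ be the completion of $C_c^\infty((0,\infty),\mathbb C)$ in the norm $B(w,w)^{1/2}$, and let $\lambda_0<\lambda_1<\cdots$ be all the eigenvalues, with eigenfunctions $0\ne w_i\in\mathcal H$ (continuous representatives), of the temporal problem $B(w_i,\psi)=\lambda_iK(w_i,\psi)$ for all $\psi\in\mathcal H$. Set $$\hat\mu_j=(n-1)r_0^{-2}\tilde\mu_j-\tfrac n2(n-1)(n-2)r_0^{-2}\tilde\kappa .$$ For $\omega>0$ let $\zeta_\omega(\tau)$ be the positive multiple of $\sin(r_0^{-1}\omega\tau)$ with unit $L^2$ norm on $(0,\pi r_0/\omega)$, and let $\zeta_0\equiv1$. Then there is an $\alpha$ with $\frac23\le\alpha<1$ such that the following holds. For every $j$ there is a smallest index $i_0=i_0(j)$ with $\lambda_{i_0}\ge\hat\mu_j$, and for every $i\ge i_0$ there is $\omega_{ij}\ge0$ with $$\lambda_i=(n-1)r_0^{-2}\omega_{ij}^2+\hat\mu_j .$$ The smooth function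 $\zeta_{ij}=\zeta_{\omega_{ij}}$ satisfies $-\ddot\zeta_{ij}=r_0^{-2}\omega_{ij}^2\zeta_{ij}$, and the function $u_{ij}(t,(\tau,x))=w_i(t)\zeta_{ij}(\tau)\varphi_j(x)$ * solves the wave equation; * has bounded energies: the temporal energies $B(u_{ij}(\cdot,p),u_{ij}(\cdot,p))$ are bounded uniformly in $p\in\mathcal S_0$, and for every bounded open interval $J$ the spatial energies $\int_{J\times M}\{(n-1)|Du_{ij}(t,\cdot)|^2+\frac n2|R||u_{ij}(t,\cdot)|^2\}$ (with respect to the Riemannian volume of $\mathcal S_0$) are bounded uniformly in $t>0$; * tends to $0$ uniformly on $\mathcal S_0$ as $t\to0$ and as $t\to\infty$; * belongs to $C^\infty((0,\infty)\times\mathcal S_0)\cap C^{2,\alpha}([0,\infty)\times\mathcal S_0)$, where $C^{2,\alpha}$ means: $u_{ij}$ extends to $t\ge 0$ so that in charts $(t,\tau,y)$, with $y$ local coordinates of $M$, the extension is $C^2$ up to $t=0$, with derivatives up to order two bounded and with $\alpha$-Hölder continuous second derivatives, uniformly for $t\ge0$, $\tau\in\mathbb R$ and $y$ in compact subsets of the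 coordinate domain. Also $w_i(t)\to0$ as $t\to0$ and as $t\to\infty$, for every $i$. Moreover, $\omega_{ij}>0$ for all $i>i_0(j)$; if $\lambda_{i_0}=\hat\mu_j$, then $\zeta_{i_0j}\equiv1$; and if $\tilde\kappa\ne-1$, then $\hat\mu_0\le0$, $\varphi_0$ is a non-zero constant, and $\omega_{i0}>0$ for all $i\ge0$. -/

import Mathlib

open Set Filter Topology MeasureTheory
open scoped Manifold ContDiff NNReal ENNReal

namespace QuantumBlackHole

noncomputable section

/-! ### Riemannian geometry in local coordinates

`E` is the model vector space with a fixed basis `b`; `∂ᵢ` is the derivative in direction `b i`. -/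

section Coordinates

variable {E : Type*} [NormedAddCommGroup E] [NormedSpace ℝ E]
  {ι : Type*} [Fintype ι] [DecidableEq ι]

/-- The Christoffel symbols `Γ^k_{ij} = ½ ∑ₗ g^{kl} (∂ᵢ g_{jl} + ∂ⱼ g_{il} - ∂ₗ g_{ij})` of a matrix
of metric coefficients `G y = (g_{ij}(y))`. -/
def christoffel (b : Module.Basis ι ℝ E) (G : E → Matrix ι ι ℝ) (k i j : ι) (y : E) : ℝ :=
  (1 / 2 : ℝ) * ∑ l, (G y)⁻¹ k l *
    (fderiv ℝ (fun z => G z j l) y (b i) + fderiv ℝ (fun z => G z i l) y (b j)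
      - fderiv ℝ (fun z => G z i j) y (b l))

/-- The curvature tensor `R^l_{kij}`, where `R(∂ᵢ, ∂ⱼ) ∂ₖ = ∑ₗ R^l_{kij} ∂ₗ`:
`R^l_{kij} = ∂ᵢ Γ^l_{jk} - ∂ⱼ Γ^l_{ik} + ∑ₘ (Γ^l_{im} Γ^m_{jk} - Γ^l_{jm} Γ^m_{ik})`. -/
def riemannTensor (b : Module.Basis ι ℝ E) (G : E → Matrix ι ι ℝ) (l k i j : ι) (y : E) : ℝ :=
  fderiv ℝ (christoffel b G l j k) y (b i) - fderiv ℝ (christoffel b G l i k) y (b j)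
    + ∑ m, (christoffel b G l i m y * christoffel b G m j k y
      - christoffel b G l j m y * christoffel b G m i k y)

/-- The scalar curvature `∑_{k,j} g^{kj} R_{kj}` with the Ricci tensor `R_{kj} = ∑ᵢ R^i_{kij}`. -/
def coordScalarCurvature (b : Module.Basis ι ℝ E) (G : E → Matrix ι ι ℝ) (y : E) : ℝ :=
  ∑ k, ∑ j, (G y)⁻¹ k j * ∑ i, riemannTensor b G i k i j y

/-- The Laplacian `∑_{i,j} g^{ij} (∂ᵢ ∂ⱼ F - ∑ₖ Γ^k_{ij} ∂ₖ F)`, the trace of the covariant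
Hessian, of a complex valued function. -/
def coordLaplacian (b : Module.Basis ι ℝ E) (G : E → Matrix ι ι ℝ) (F : E → ℂ) (y : E) : ℂ :=
  ∑ i, ∑ j, (((G y)⁻¹ i j : ℝ) : ℂ) *
    (fderiv ℝ (fun z => fderiv ℝ F z (b j)) y (b i)
      - ∑ k, ((christoffel b G k i j y : ℝ) : ℂ) * fderiv ℝ F y (b k))

end Coordinates

/-! ### Manifolds (without boundary) with a metric tensor -/

section Manifold

variable {E : Type*} [NormedAddCommGroup E] [NormedSpace ℝ E]
  {H : Type*} [TopologicalSpace H] (I : ModelWithCorners ℝ E H)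
  {ι : Type*} [Fintype ι] [DecidableEq ι] (b : Module.Basis ι ℝ E)
  {M : Type*} [TopologicalSpace M] [ChartedSpace H M]

/-- A field of bilinear forms on the tangent spaces. -/
abbrev MetricField (M : Type*) [TopologicalSpace M] [ChartedSpace H M] : Type _ :=
  ∀ p : M, TangentSpace I p →L[ℝ] TangentSpace I p →L[ℝ] ℝ

/-- The coefficients `g(∂ᵢ, ∂ⱼ)` of a metric in the chart at `p₀`, as a function of the
coordinates; `∂ᵢ` is the image of `b i` under the differential of the inverse of the chart. -/
def chartMetric (g : MetricField I M) (p₀ : M) (y : E) : Matrix ι ι ℝ :=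
  Matrix.of fun i j =>
    g ((extChartAt I p₀).symm y)
      (mfderiv 𝓘(ℝ, E) I (extChartAt I p₀).symm y (b i))
      (mfderiv 𝓘(ℝ, E) I (extChartAt I p₀).symm y (b j))

/-- The Laplace-Beltrami operator in the chart at `p₀`. -/
def chartLaplacian (g : MetricField I M) (p₀ : M) (f : M → ℂ) (y : E) : ℂ :=
  coordLaplacian b (chartMetric I b g p₀) (fun z => f ((extChartAt I p₀).symm z)) y

/-- The scalar curvature in the chart at `p₀`. -/
def chartScalarCurvature (g : MetricField I M) (p₀ : M) (y : E) : ℝ :=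
  coordScalarCurvature b (chartMetric I b g p₀) y

/-- The scalar curvature as a function on the manifold. -/
def scalarCurvature (g : MetricField I M) (p : M) : ℝ :=
  chartScalarCurvature I b g p (extChartAt I p p)

/-- Constant sectional curvature `κ`: in all the charts,
`∑ₘ g_{lm} R^m_{kij} = κ (g_{li} g_{kj} - g_{lj} g_{ki})`. -/
def HasConstantCurvature (g : MetricField I M) (κ : ℝ) : Prop :=
  ∀ p₀ : M, ∀ y ∈ (extChartAt I p₀).target, ∀ l k i j : ι,
    ∑ m, chartMetric I b g p₀ y l m * riemannTensor b (chartMetric I b g p₀) m k i j y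
      = κ * (chartMetric I b g p₀ y l i * chartMetric I b g p₀ y k j
        - chartMetric I b g p₀ y l j * chartMetric I b g p₀ y k i)

/-- `φ` is a (smooth, non-zero) eigenfunction of `-Δ_g` with eigenvalue `μ`; the equation is
required in all the charts. -/
def IsLaplaceEigenpair (g : MetricField I M) (φ : M → ℂ) (μ : ℝ) : Prop :=
  ContMDiff I 𝓘(ℝ, ℂ) ∞ φ ∧ φ ≠ 0 ∧
    ∀ p₀ : M, ∀ y ∈ (extChartAt I p₀).target,
      -chartLaplacian I b g p₀ φ y = (μ : ℂ) * φ ((extChartAt I p₀).symm y)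

/-- `(φ j, μ j)` enumerates the eigenfunctions of `-Δ_g`: the eigenvalues are listed in ascending
order and repeated according to their multiplicities, and the `φ j` that belong to an
eigenvalue form a basis of its eigenspace. -/
structure IsLaplaceSpectrum (g : MetricField I M) (φ : ℕ → M → ℂ) (μ : ℕ → ℝ) : Prop where
  eigenpair : ∀ j, IsLaplaceEigenpair I b g (φ j) (μ j)
  monotone : Monotone μ
  linearIndependent : LinearIndependent ℂ φ
  complete : ∀ (ψ : M → ℂ) (ν : ℝ), IsLaplaceEigenpair I b g ψ ν →
    ψ ∈ Submodule.span ℂ (φ '' {j | μ j = ν})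

/-- The differential of a complex valued function at `p`, on the tangent space (which is `E`). -/
def manifoldDifferential (f : M → ℂ) (p : M) : E →L[ℝ] ℂ :=
  mfderiv I 𝓘(ℝ, ℂ) f p

/-- The squared norm `|Df|²_g = ∑_{i,j} g^{ij} Re (∂ᵢf · conj ∂ⱼf)` of the differential at `p`,
computed in the basis `b` of the tangent space (it does not depend on the basis). -/
def gradNormSq (g : MetricField I M) (f : M → ℂ) (p : M) : ℝ :=
  ∑ i, ∑ j, (Matrix.of fun k l : ι => g p (b k : E) (b l : E))⁻¹ i j *
    (manifoldDifferential I f p (b i) * (starRingEnd ℂ) (manifoldDifferential I f p (b j))).re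

variable (M) in
/-- A smooth partition of unity subordinate to the domains of the charts. -/
def chartPartition [FiniteDimensional ℝ E] [IsManifold I ∞ M] [T2Space M] [SigmaCompactSpace M] :
    SmoothPartitionOfUnity M I M univ :=
  (SmoothPartitionOfUnity.exists_isSubordinate_chartAt_source I M).choose

/-- The Riemannian volume: the sum over the charts of `ρ √det(g_{ij}) dy`, transported to the
manifold, where the `ρ` form a partition of unity subordinate to the charts; `dy` is the
Lebesgue measure in the coordinates given by the basis `b`. -/
def riemannianVolume [FiniteDimensional ℝ E] [MeasurableSpace E] [BorelSpace E]
    [IsManifold I ∞ M] [T2Space M] [SigmaCompactSpace M] [MeasurableSpace M]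
    (g : MetricField I M) : Measure M :=
  Measure.sum fun p₀ : M =>
    Measure.map (extChartAt I p₀).symm
      ((b.addHaar.restrict (extChartAt I p₀).target).withDensity fun y =>
        ENNReal.ofReal (chartPartition I M p₀ ((extChartAt I p₀).symm y)
          * √(chartMetric I b g p₀ y).det))

end Manifold

/-! ### The black hole and its Cauchy hypersurface -/

/-- `h(r) = m r^{-(n-2)} + 2/(n(n-1)) Λ r² - κ`, whose positive zero is the radius of the event
horizon of the AdS black hole with mass `m`. -/
def horizonFunction (n : ℕ) (m Λ κ r : ℝ) : ℝ :=
  m * (r ^ (n - 2))⁻¹ + 2 / ((n : ℝ) * ((n : ℝ) - 1)) * Λ * r ^ 2 - κ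

section Hypersurface

variable (d : ℕ) {M : Type*} [TopologicalSpace M] [ChartedSpace (EuclideanSpace ℝ (Fin d)) M]

/-- The standard basis of `ℝ^d`. -/
abbrev stdBasis : Module.Basis (Fin d) ℝ (EuclideanSpace ℝ (Fin d)) :=
  (EuclideanSpace.basisFun (Fin d) ℝ).toBasis

/-- The standard basis of `ℝ × ℝ^d`. -/
abbrev prodBasis : Module.Basis (Unit ⊕ Fin d) ℝ (ℝ × EuclideanSpace ℝ (Fin d)) :=
  (Module.Basis.singleton Unit ℝ).prod (stdBasis d)

/-- The model of the product manifold `ℝ × M`. -/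
abbrev prodModel : ModelWithCorners ℝ (ℝ × EuclideanSpace ℝ (Fin d))
    (ModelProd ℝ (EuclideanSpace ℝ (Fin d))) :=
  𝓘(ℝ, ℝ).prod (𝓡 d)

/-- The metric `dτ² + r² σ` on `ℝ × M`. -/
def cylinderMetric (r : ℝ) (σ : MetricField (𝓡 d) M) : MetricField (prodModel d) (ℝ × M) :=
  fun p =>
    (((ContinuousLinearMap.mul ℝ ℝ).bilinearComp
        (ContinuousLinearMap.fst ℝ ℝ (EuclideanSpace ℝ (Fin d)))
        (ContinuousLinearMap.fst ℝ ℝ (EuclideanSpace ℝ (Fin d))) +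
      r ^ 2 • ContinuousLinearMap.bilinearComp
        (σ p.2 : EuclideanSpace ℝ (Fin d) →L[ℝ] EuclideanSpace ℝ (Fin d) →L[ℝ] ℝ)
        (ContinuousLinearMap.snd ℝ ℝ (EuclideanSpace ℝ (Fin d)))
        (ContinuousLinearMap.snd ℝ ℝ (EuclideanSpace ℝ (Fin d)))) :
      (ℝ × EuclideanSpace ℝ (Fin d)) →L[ℝ] (ℝ × EuclideanSpace ℝ (Fin d)) →L[ℝ] ℝ)

end Hypersurface

/-! ### The temporal eigenvalue problem -/

section Temporal

variable (n : ℕ) (Λ : ℝ)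

/-- The coefficient `(1/32) n²/(n-1)`. -/
def waveCoeff : ℝ := 1 / 32 * ((n : ℝ) ^ 2 / ((n : ℝ) - 1))

/-- The energy density `(1/32) n²/(n-1) |w'|² + n |Λ| t² |w|²` at time `t`, where `x` stands for
`w(t)` and `dx` for `w'(t)`. -/
def temporalDensity (t : ℝ) (x dx : ℂ) : ℝ :=
  waveCoeff n * ‖dx‖ ^ 2 + (n : ℝ) * |Λ| * t ^ 2 * ‖x‖ ^ 2

/-- The energy `B(w, w)`. -/
def temporalEnergy (w : ℝ → ℂ) : ℝ≥0∞ :=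
  ∫⁻ t in Ioi (0 : ℝ), ENNReal.ofReal (temporalDensity n Λ t (w t) (deriv w t))

/-- The Hermitian form
`B(w, ψ) = ∫₀^∞ ((1/32) n²/(n-1) conj w' ψ' + n |Λ| t² conj w ψ) dt`; the (weak) derivatives `dw`
of `w` and `dψ` of `ψ` are passed as separate arguments. -/
def formB (w dw ψ dψ : ℝ → ℂ) : ℂ :=
  ∫ t in Ioi (0 : ℝ), ((waveCoeff n : ℝ) : ℂ) * ((starRingEnd ℂ) (dw t) * dψ t)
    + (((n : ℝ) * |Λ| * t ^ 2 : ℝ) : ℂ) * ((starRingEnd ℂ) (w t) * ψ t)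

/-- The Hermitian form `K(w, ψ) = ∫₀^∞ t^{2-4/n} conj w ψ dt`. -/
def formK (w ψ : ℝ → ℂ) : ℂ :=
  ∫ t in Ioi (0 : ℝ), ((t ^ (2 - 4 / (n : ℝ)) : ℝ) : ℂ) * ((starRingEnd ℂ) (w t) * ψ t)

/-- `w`, with weak derivative `dw`, is an element of the completion of `C_c^∞((0,∞), ℂ)` in the
norm `B(w, w)^{1/2}`: a limit of test functions in that norm. -/
def MemTemporalSpace (w dw : ℝ → ℂ) : Prop :=
  AEStronglyMeasurable w (volume.restrict (Ioi (0 : ℝ))) ∧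
  AEStronglyMeasurable dw (volume.restrict (Ioi (0 : ℝ))) ∧
  ∃ η : ℕ → ℝ → ℂ,
    (∀ k, ContDiff ℝ ∞ (η k) ∧ HasCompactSupport (η k) ∧ tsupport (η k) ⊆ Ioi (0 : ℝ)) ∧
    Tendsto (fun k => ∫⁻ t in Ioi (0 : ℝ),
      ENNReal.ofReal (temporalDensity n Λ t (w t - η k t) (dw t - deriv (η k) t))) atTop (𝓝 0)

/-- `w` is an eigenfunction of the temporal eigenvalue problem `B(w, ψ) = lam K(w, ψ)` for all
`ψ` in the completion; `w` stands for its continuous representative on `(0, ∞)`. The values of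
`w` on `(-∞, 0]` are irrelevant. -/
def IsTemporalEigenpair (w : ℝ → ℂ) (lam : ℝ) : Prop :=
  ContinuousOn w (Ioi (0 : ℝ)) ∧ (∃ t > 0, w t ≠ 0) ∧
  ∃ dw : ℝ → ℂ, MemTemporalSpace n Λ w dw ∧
    ∀ ψ dψ : ℝ → ℂ, MemTemporalSpace n Λ ψ dψ →
      formB n Λ w dw ψ dψ = (lam : ℂ) * formK n w ψ

/-- `(w i, lam i)` are the temporal eigenfunctions with their eigenvalues in ascending order; every
eigenvalue occurs. -/
structure IsTemporalSpectrum (w : ℕ → ℝ → ℂ) (lam : ℕ → ℝ) : Prop where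
  eigenpair : ∀ i, IsTemporalEigenpair n Λ (w i) (lam i)
  strictMono : StrictMono lam
  complete : ∀ (v : ℝ → ℂ) (ν : ℝ), IsTemporalEigenpair n Λ v ν → ∃ i, lam i = ν

end Temporal

/-! ### The wave equation in the quantum spacetime -/

section Wave

variable (n : ℕ) (Λ : ℝ)
  {M : Type*} [TopologicalSpace M] [ChartedSpace (EuclideanSpace ℝ (Fin (n - 1))) M]
  (g : MetricField (prodModel (n - 1)) (ℝ × M))

/-- The wave equation
`(1/32) n²/(n-1) ∂ₜ²u - (n-1) t^{2-4/n} Δu - (n/2) t^{2-4/n} R u + n t² Λ u = 0`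
for `t > 0` on the hypersurface `ℝ × M` with metric `g` (in all the charts). -/
def SolvesWaveEquation (u : ℝ → ℝ × M → ℂ) : Prop :=
  ∀ t > 0, ∀ p₀ : ℝ × M, ∀ y ∈ (extChartAt (prodModel (n - 1)) p₀).target,
    ((waveCoeff n : ℝ) : ℂ) *
        iteratedDeriv 2 (fun s => u s ((extChartAt (prodModel (n - 1)) p₀).symm y)) t
      - ((((n : ℝ) - 1) * t ^ (2 - 4 / (n : ℝ)) : ℝ) : ℂ) *
        chartLaplacian (prodModel (n - 1)) (prodBasis (n - 1)) g p₀ (u t) y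
      - (((n : ℝ) / 2 * t ^ (2 - 4 / (n : ℝ)) *
          chartScalarCurvature (prodModel (n - 1)) (prodBasis (n - 1)) g p₀ y : ℝ) : ℂ) *
        u t ((extChartAt (prodModel (n - 1)) p₀).symm y)
      + (((n : ℝ) * t ^ 2 * Λ : ℝ) : ℂ) * u t ((extChartAt (prodModel (n - 1)) p₀).symm y) = 0

/-- The spatial energy `∫_Ω ((n-1) |Dv|² + (n/2) |R| |v|²)` (with the absolute value of the
curvature term). -/
def spatialEnergy [IsManifold (𝓡 (n - 1)) ∞ M] [T2Space M] [SigmaCompactSpace M]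
    [MeasurableSpace M] (Ω : Set (ℝ × M)) (v : ℝ × M → ℂ) : ℝ≥0∞ :=
  ∫⁻ p in Ω, ENNReal.ofReal
      (((n : ℝ) - 1) * gradNormSq (prodModel (n - 1)) (prodBasis (n - 1)) g v p
        + (n : ℝ) / 2 * |scalarCurvature (prodModel (n - 1)) (prodBasis (n - 1)) g p| * ‖v p‖ ^ 2)
    ∂(riemannianVolume (prodModel (n - 1)) (prodBasis (n - 1)) g)

/-- Bounded energies: the temporal energies of `u(·, p)` are bounded uniformly in `p`, and the
spatial energies of `u(t, ·)` over `J × M` are bounded uniformly in `t`, for every bounded open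
interval `J`. -/
def HasBoundedEnergies [IsManifold (𝓡 (n - 1)) ∞ M] [T2Space M] [SigmaCompactSpace M]
    [MeasurableSpace M] (u : ℝ → ℝ × M → ℂ) : Prop :=
  (∃ C : ℝ≥0, ∀ p, temporalEnergy n Λ (fun t => u t p) ≤ C) ∧
  ∀ a c : ℝ, ∃ C : ℝ≥0, ∀ t > 0, spatialEnergy n g (Ioo a c ×ˢ univ) (u t) ≤ C

end Wave

section Regularity

variable (d : ℕ) {M : Type*} [TopologicalSpace M] [ChartedSpace (EuclideanSpace ℝ (Fin d)) M]

/-- `u ∈ C^∞((0,∞) × (ℝ × M))`. -/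
def IsSmoothInterior (u : ℝ → ℝ × M → ℂ) : Prop :=
  ContMDiffOn (𝓘(ℝ, ℝ).prod (prodModel d)) 𝓘(ℝ, ℂ) ∞
    (fun z : ℝ × (ℝ × M) => u z.1 z.2) (Ioi 0 ×ˢ univ)

/-- `u ∈ C^{2,α}([0,∞) × (ℝ × M))`: `u` extends from `t > 0` to `t ≥ 0` such that, in the charts
`(t, τ, y)`, the extension is of class `C²` up to `t = 0`, with derivatives up to order two bounded
and with second derivatives Hölder continuous with exponent `α`, uniformly for `t ≥ 0`, `τ ∈ ℝ`
and `y` in a compact subset of the coordinate domain. -/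
def IsC2HolderUpToZero (α : ℝ≥0) (u : ℝ → ℝ × M → ℂ) : Prop :=
  ∃ U : ℝ → ℝ × M → ℂ, (∀ t > 0, U t = u t) ∧
    ∀ x₀ : M,
      let e := extChartAt (𝓡 d) x₀
      let F : ℝ × (ℝ × EuclideanSpace ℝ (Fin d)) → ℂ := fun z => U z.1 (z.2.1, e.symm z.2.2)
      let D : Set (ℝ × (ℝ × EuclideanSpace ℝ (Fin d))) := Ici 0 ×ˢ (univ ×ˢ e.target)
      ContDiffOn ℝ 2 F D ∧
      ∀ S ⊆ e.target, IsCompact S →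
        (∃ C : ℝ, ∀ k ≤ 2, ∀ z ∈ Ici (0 : ℝ) ×ˢ ((univ : Set ℝ) ×ˢ S),
          ‖iteratedFDerivWithin ℝ k F D z‖ ≤ C) ∧
        ∃ C : ℝ≥0, HolderOnWith C α (iteratedFDerivWithin ℝ 2 F D)
          (Ici (0 : ℝ) ×ˢ ((univ : Set ℝ) ×ˢ S))

end Regularity

/-! ### The product solutions -/

/-- The oscillator with frequency `freq`: `1` if `freq = 0`, and otherwise the multiple of
`sin (r⁻¹ freq τ)` with unit `L²` norm on the interval `(0, π/(r⁻¹ freq))`. -/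
def oscillator (r freq τ : ℝ) : ℝ :=
  if freq = 0 then 1 else √(2 * (r⁻¹ * freq) / Real.pi) * Real.sin (r⁻¹ * freq * τ)

/-- `μ̂ = (n-1) r⁻² μ - (n/2)(n-1)(n-2) r⁻² κ`. -/
def muHat (n : ℕ) (r κ μ : ℝ) : ℝ :=
  ((n : ℝ) - 1) * (r ^ 2)⁻¹ * μ - (n : ℝ) / 2 * ((n : ℝ) - 1) * ((n : ℝ) - 2) * (r ^ 2)⁻¹ * κ

/-- The function `u(t, (τ, x)) = w(t) ζ(τ) φ(x)`. -/
def productFunction {M : Type*} (w : ℝ → ℂ) (ζ : ℝ → ℝ) (φ : M → ℂ) (t : ℝ) (p : ℝ × M) : ℂ :=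
  w t * (ζ p.1 : ℂ) * φ p.2

end

end QuantumBlackHole

/-!
The solutions are products, and the theorem says that the three factors fit together. On the
cylinder `dτ² + r₀² σ` the Laplacian of `ζ(τ) φ(x)` is `ζ'' φ + r₀⁻² ζ Δφ` (`coordLaplacian_warped`)
and the scalar curvature is the constant `(n - 1) (n - 2) κ / r₀²` (`scalarCurvature_cylinder`). So
if `w` solves the temporal equation with eigenvalue `λ`, every term of the wave equation for
`u = w ζ φ` is a multiple of `u`, and the equation reduces to `λ = (n - 1) r₀⁻² ω² + μ̂`
(`solvesWaveEquation_productFunction`). This can be solved for `ω ≥ 0` exactly if `λ ≥ μ̂`.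

**Temporal eigenfunctions.** By the lemma of du Bois-Reymond a weak eigenfunction is a classical
solution of `w'' = p w`, and as an element of the energy space it is the primitive of its derivative
that vanishes at `t = 0` (`IsTemporalEigenpair.exists_isTemporalSolution`). The potential `p` tends
to infinity, so `|w|²` satisfies `f'' ≥ 16 f` eventually; finite energy excludes the growing
solutions, and `w` decays exponentially with its derivatives (`le_exp_of_second_deriv`,
`IsTemporalSolution.exists_norm_le_exp`). At `t = 0` the potential is only Hölder continuous, of
exponent `min (2 - 4 / n) 1`, but `w` vanishes there to first order, which makes `p w` continuously
differentiable and `w` of class `C³` up to `t = 0` with bounded derivatives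
(`IsTemporalSolution.continuous_thirdDeriv`, `IsTemporalSolution.exists_norm_iteratedDeriv_le`).
Hence the second derivatives of `u` are locally Lipschitz, and `u` is of class `C^{2,α}` for all
`α ≤ 1` (`isC2HolderUpToZero_productFunction`).

**Existence of `i₀`.** The eigenvalues are positive and unbounded. The existence of a complete
system of eigenfunctions is not needed for this: eigenfunctions of different eigenvalues are
orthogonal, and point evaluations are bounded on the energy space, so a Bessel inequality holds at
each point `x` (`sum_sq_div_energy_le`). Integrating it shows that infinitely many normalized
eigenfunctions cannot all have a fixed amount of mass in a bounded interval, as they would if the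
eigenvalues were bounded (`exists_le_eigenvalue`).

**Energies.** The temporal energy is the one of `w`, scaled. For the spatial energies, the gradient
of `φ` is bounded on the compact manifold `M` (`exists_norm_mfderiv_le`), the scalar curvature is
constant, and `J × M` has finite Riemannian volume (`riemannianVolume_lt_top`).

**The case `κ ≠ -1`.** The maximum principle shows that the eigenvalues of `-Δ` on `M` are
non-negative (`IsLaplaceEigenpair.eigenvalue_nonneg`), so the lowest one is `0`, the eigenvalue of
the constants. The strong maximum principle of Hopf (`eventually_eq_of_realLaplacian_eq_zero`) shows
that `φ₀` is constant. Then `μ̂₀` is a non-positive multiple of `κ`, while all `λ_i` are positive,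
whence `ω_{i0} > 0`.
-/

namespace QuantumBlackHole

noncomputable section

/-! ### Two lemmas on the half-line: convex growth and the lemma of du Bois-Reymond -/

/-- If `f'' ≥ 16 f` on `[T, ∞)`, then `(f' + 4 f) exp (-4 t)` is non-decreasing. A positive value of
`f' + 4 f` would therefore force `f` to grow like `exp (4 t)`; as `f` grows at most quadratically,
`f' ≤ -4 f`, so `f` decays exponentially. -/
theorem le_exp_of_second_deriv {f f' f'' : ℝ → ℝ} {T A : ℝ}
    (hf : ∀ t, HasDerivAt f (f' t) t) (hf' : ∀ t, HasDerivAt f' (f'' t) t)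
    (hle : ∀ t ≥ T, 16 * f t ≤ f'' t) (hA : ∀ t ≥ T, f t ≤ A * (1 + t) ^ 2) :
    ∀ t ≥ T, f t ≤ f T * Real.exp (-4 * (t - T)) := by
  have hexp : ∀ k t : ℝ, HasDerivAt (fun s => Real.exp (k * s)) (Real.exp (k * t) * k) t := by
    intro k t
    simpa using ((hasDerivAt_id t).const_mul k).exp
  have hh : ∀ t, HasDerivAt (fun s => f' s + 4 * f s) (f'' t + 4 * f' t) t :=
    fun t => (hf' t).add ((hf t).const_mul 4)
  have mono1 : MonotoneOn (fun t => (f' t + 4 * f t) * Real.exp (-4 * t)) (Ici T) := by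
    refine monotoneOn_of_hasDerivWithinAt_nonneg (convex_Ici T)
      (fun t _ => ((hh t).mul (hexp (-4) t)).continuousAt.continuousWithinAt)
      (fun t _ => ((hh t).mul (hexp (-4) t)).hasDerivWithinAt) ?_
    intro t ht
    rw [interior_Ici] at ht
    have h1 := hle t (le_of_lt ht)
    have h2 := Real.exp_pos (-4 * t)
    nlinarith
  have hneg : ∀ t ≥ T, f' t + 4 * f t ≤ 0 := by
    by_contra! hcon
    obtain ⟨s, hs, hpos⟩ := hcon
    set k := (f' s + 4 * f s) * Real.exp (-4 * s) with hk
    have hk0 : 0 < k := by positivity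
    have mono2 : MonotoneOn (fun t => f t * Real.exp (4 * t) - k / 8 * Real.exp (8 * t))
        (Ici s) := by
      have hd : ∀ t, HasDerivAt (fun t => f t * Real.exp (4 * t) - k / 8 * Real.exp (8 * t))
        (f' t * Real.exp (4 * t) + f t * (Real.exp (4 * t) * 4)
          - k / 8 * (Real.exp (8 * t) * 8)) t :=
        fun t => ((hf t).mul (hexp 4 t)).sub ((hexp 8 t).const_mul _)
      refine monotoneOn_of_hasDerivWithinAt_nonneg (convex_Ici s)
        (fun t _ => (hd t).continuousAt.continuousWithinAt)
        (fun t _ => (hd t).hasDerivWithinAt) ?_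
      intro t ht
      rw [interior_Ici] at ht
      have h1 := mono1 (show s ∈ Ici T from hs) (show t ∈ Ici T from hs.le.trans (le_of_lt ht))
        (le_of_lt ht)
      have h2 : Real.exp (8 * t) = Real.exp (4 * t) * Real.exp (4 * t) := by
        rw [← Real.exp_add]; ring_nf
      have h3 : Real.exp (-4 * t) * Real.exp (4 * t) = 1 := by
        rw [← Real.exp_add]; simp
      have h4 : k * Real.exp (8 * t) ≤ (f' t + 4 * f t) * Real.exp (4 * t) := by
        calc k * Real.exp (8 * t) ≤ (f' t + 4 * f t) * Real.exp (-4 * t) * Real.exp (8 * t) := by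
              gcongr
          _ = _ := by rw [h2, mul_assoc, ← mul_assoc (Real.exp (-4 * t)), h3, one_mul]
      linarith
    -- `f` is at least a positive multiple of `exp (4 t)`, which contradicts the polynomial bound
    have hlow : ∀ t ≥ s, k / 8 * Real.exp (4 * t) + (f s * Real.exp (4 * s)
        - k / 8 * Real.exp (8 * s)) * Real.exp (-4 * t) ≤ A * (1 + t) ^ 2 := by
      intro t ht
      have h1 := mono2 (show s ∈ Ici s from le_refl s) (show t ∈ Ici s from ht) ht
      have h3 : Real.exp (4 * t) * Real.exp (-4 * t) = 1 := by
        rw [← Real.exp_add]; simp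
      have h2 : Real.exp (8 * t) * Real.exp (-4 * t) = Real.exp (4 * t) := by
        rw [← Real.exp_add]; ring_nf
      have h5 := mul_le_mul_of_nonneg_right h1 (Real.exp_pos (-4 * t)).le
      have h6 : (f t * Real.exp (4 * t) - k / 8 * Real.exp (8 * t)) * Real.exp (-4 * t)
          = f t - k / 8 * Real.exp (4 * t) := by
        rw [sub_mul, mul_assoc, h3, mul_assoc, h2, mul_one]
      have h7 := hA t (hs.le.trans ht)
      simp only at h5
      linarith
    -- multiplied by `exp (-4 t)`, the two sides of `hlow` tend to `k / 8 > 0` and to `0`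
    have lim : Tendsto (fun t : ℝ => (A * (1 + t) ^ 2 - (f s * Real.exp (4 * s)
        - k / 8 * Real.exp (8 * s)) * Real.exp (-4 * t)) * Real.exp (-4 * t)) atTop (𝓝 0) := by
      have e1 : Tendsto (fun t : ℝ => Real.exp (-4 * t)) atTop (𝓝 0) :=
        Real.tendsto_exp_atBot.comp (tendsto_id.const_mul_atTop_of_neg (by norm_num))
      have e2 : Tendsto (fun t : ℝ => (1 + t) ^ 2 * Real.exp (-4 * t)) atTop (𝓝 0) := by
        have := (Real.tendsto_pow_mul_exp_neg_atTop_nhds_zero 2).comp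
          (tendsto_atTop_add_const_left atTop (1 : ℝ) tendsto_id)
        have h := (this.const_mul (Real.exp 1)).mul
          (Real.tendsto_exp_atBot.comp (tendsto_id.const_mul_atTop_of_neg (r := (-3 : ℝ))
            (by norm_num)))
        simp only [mul_zero, Function.comp_def, id] at h
        refine h.congr fun t => ?_
        rw [mul_comm (Real.exp 1), mul_assoc, mul_assoc, ← Real.exp_add, ← Real.exp_add]
        ring_nf
      have := (e2.const_mul A).sub ((e1.mul e1).const_mul (f s * Real.exp (4 * s)
        - k / 8 * Real.exp (8 * s)))
      simp only [mul_zero, sub_zero] at this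
      refine this.congr fun t => by ring
    have := ge_of_tendsto (b := k / 8) lim ?_
    · linarith
    · filter_upwards [eventually_ge_atTop s] with t ht
      have h1 := hlow t ht
      have h3 : Real.exp (4 * t) * Real.exp (-4 * t) = 1 := by
        rw [← Real.exp_add]; simp
      have h2 : k / 8 * Real.exp (4 * t) ≤ A * (1 + t) ^ 2 - (f s * Real.exp (4 * s)
        - k / 8 * Real.exp (8 * s)) * Real.exp (-4 * t) := by linarith
      have h4 := mul_le_mul_of_nonneg_right h2 (Real.exp_pos (-4 * t)).le
      rwa [mul_assoc, h3, mul_one] at h4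
  have anti : AntitoneOn (fun t => f t * Real.exp (4 * t)) (Ici T) := by
    refine antitoneOn_of_hasDerivWithinAt_nonpos (convex_Ici T)
      (fun t _ => ((hf t).mul (hexp 4 t)).continuousAt.continuousWithinAt)
      (fun t _ => ((hf t).mul (hexp 4 t)).hasDerivWithinAt) ?_
    intro t ht
    rw [interior_Ici] at ht
    have h1 := hneg t (le_of_lt ht)
    have h2 := Real.exp_pos (4 * t)
    nlinarith
  intro t ht
  have h1 := anti (show T ∈ Ici T from le_refl T) (show t ∈ Ici T from ht) ht
  have h3 : Real.exp (4 * t) * Real.exp (-4 * t) = 1 := by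
    rw [← Real.exp_add]; simp
  have h5 := mul_le_mul_of_nonneg_right h1 (Real.exp_pos (-4 * t)).le
  simp only at h5
  rw [mul_assoc, h3, mul_one, mul_assoc, ← Real.exp_add] at h5
  rwa [show -4 * (t - T) = 4 * T + -4 * t by ring]

/-- The fundamental lemma of du Bois-Reymond on the half-line. -/
theorem ae_eq_const_of_integral_deriv_smul_eq_zero {f : ℝ → ℂ}
    (hf : LocallyIntegrableOn f (Ioi 0))
    (h : ∀ ψ : ℝ → ℝ, ContDiff ℝ ∞ ψ → HasCompactSupport ψ → tsupport ψ ⊆ Ioi 0 →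
      ∫ t, deriv ψ t • f t = 0) :
    ∃ C : ℂ, ∀ᵐ t, t ∈ Ioi (0 : ℝ) → f t = C := by
  -- the constant is the mean of `f` against a fixed test function `ρ` of integral `1`
  let bump : ContDiffBump (2 : ℝ) := ⟨1 / 2, 1, by norm_num, by norm_num⟩
  let ρ : ℝ → ℝ := bump.normed volume
  have hρs : ContDiff ℝ ∞ ρ := bump.contDiff_normed
  have hρc : HasCompactSupport ρ := bump.hasCompactSupport_normed
  have hρt : tsupport ρ ⊆ Ioi 0 := by
    simp only [ρ, bump.tsupport_normed_eq]
    intro x hx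
    rw [Metric.mem_closedBall, Real.dist_eq, abs_le] at hx
    simp only [bump] at hx
    rw [mem_Ioi]
    linarith [hx.1]
  have hρi : ∫ t, ρ t = 1 := bump.integral_normed
  have hint : ∀ χ : ℝ → ℝ, ContDiff ℝ ∞ χ → HasCompactSupport χ → tsupport χ ⊆ Ioi 0 →
      Integrable (fun t => χ t • f t) := by
    intro χ h1 h2 h3
    have hK : IntegrableOn f (tsupport χ) := hf.integrableOn_compact_subset h3 h2.isCompact
    have : IntegrableOn (fun t => χ t • f t) (tsupport χ) :=
      hK.continuousOn_smul h1.continuous.continuousOn h2.isCompact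
    rwa [integrableOn_iff_integrable_of_support_subset] at this
    exact (Function.support_smul_subset_left χ f).trans (subset_tsupport χ)
  refine ⟨∫ t, ρ t • f t, ?_⟩
  set C := ∫ t, ρ t • f t with hC
  have key : ∀ᵐ t, t ∈ Ioi (0 : ℝ) → f t - C = 0 := by
    refine isOpen_Ioi.ae_eq_zero_of_integral_contDiff_smul_eq_zero
      (hf.sub ((locallyIntegrable_const C).locallyIntegrableOn _)) ?_
    intro χ χs χc χt
    set m := ∫ t, χ t with hm
    -- `θ` has integral zero, so its primitive `ψ` is again a test function
    let θ : ℝ → ℝ := fun t => χ t - m * ρ t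
    have θs : ContDiff ℝ ∞ θ := χs.sub (contDiff_const.mul hρs)
    have θi : ∫ t, θ t = 0 := by
      rw [integral_sub (χs.continuous.integrable_of_hasCompactSupport χc)
        ((hρs.continuous.integrable_of_hasCompactSupport hρc).const_mul m),
        integral_const_mul, hρi]
      simp [hm]
    obtain ⟨a, b, ha, hab, hsub⟩ : ∃ a b : ℝ, 0 < a ∧ a ≤ b ∧ ∀ t, t ∉ Ioo a b → θ t = 0 := by
      have hcomp : IsCompact (tsupport χ ∪ tsupport ρ ∪ {1}) :=
        (χc.isCompact.union hρc.isCompact).union isCompact_singleton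
      have hne : (tsupport χ ∪ tsupport ρ ∪ {1}).Nonempty := ⟨1, by simp⟩
      have hpos : 0 < sInf (tsupport χ ∪ tsupport ρ ∪ {1}) := by
        rcases hcomp.sInf_mem hne with (h1 | h1) | h1
        · exact χt h1
        · exact hρt h1
        · rw [mem_singleton_iff] at h1
          rw [h1]; norm_num
      have hle := csInf_le_csSup hne hcomp.bddBelow hcomp.bddAbove
      refine ⟨sInf (tsupport χ ∪ tsupport ρ ∪ {1}) / 2, sSup (tsupport χ ∪ tsupport ρ ∪ {1}) + 1,
        by linarith, by linarith, ?_⟩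
      intro t ht
      have h1 : t ∉ tsupport χ ∪ tsupport ρ ∪ {1} := fun h2 =>
        ht ⟨by linarith [csInf_le hcomp.bddBelow h2], by linarith [le_csSup hcomp.bddAbove h2]⟩
      simp only [mem_union, not_or] at h1
      simp [θ, image_eq_zero_of_notMem_tsupport h1.1.1, image_eq_zero_of_notMem_tsupport h1.1.2]
    let ψ : ℝ → ℝ := fun t => ∫ s in (a)..t, θ s
    have ψd (t) : HasDerivAt ψ (θ t) t :=
      intervalIntegral.integral_hasDerivAt_right (θs.continuous.intervalIntegrable _ _)
        (θs.continuous.stronglyMeasurableAtFilter _ _) θs.continuous.continuousAt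
    have ψd' : deriv ψ = θ := funext fun t => (ψd t).deriv
    have ψs : ContDiff ℝ ∞ ψ := by
      rw [contDiff_infty_iff_deriv]
      exact ⟨fun t => (ψd t).differentiableAt, ψd' ▸ θs⟩
    have ψ0 : ∀ t, t ∉ Icc a b → ψ t = 0 := by
      intro t ht
      rw [mem_Icc, not_and_or, not_le, not_le] at ht
      rcases ht with ht | ht
      · refine intervalIntegral.integral_zero_ae (Eventually.of_forall fun s hs => hsub s ?_)
        rw [uIoc_of_ge ht.le] at hs
        exact fun h => absurd h.1 (not_lt.mpr hs.2)
      · simp only [ψ]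
        rw [intervalIntegral.integral_of_le (hab.trans ht.le),
          setIntegral_eq_integral_of_forall_compl_eq_zero, θi]
        intro s hs
        exact hsub s fun h => hs ⟨h.1, h.2.le.trans ht.le⟩
    have ψsupp : tsupport ψ ⊆ Icc a b :=
      closure_minimal (fun t ht => by_contra fun h => ht (ψ0 t h)) isClosed_Icc
    have h0 := h ψ ψs (isCompact_Icc.of_isClosed_subset (isClosed_tsupport _) ψsupp)
      (ψsupp.trans fun t ht => lt_of_lt_of_le ha ht.1)
    rw [ψd'] at h0
    have e1 : ∀ t, θ t • f t = χ t • f t - m • (ρ t • f t) := fun t => by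
      simp only [θ, sub_smul, mul_smul]
    simp only [e1] at h0
    have hρm : Integrable (fun t => m • (ρ t • f t)) := (hint ρ hρs hρc hρt).smul m
    rw [integral_sub (hint χ χs χc χt) hρm, integral_smul, ← hC] at h0
    have e2 : ∀ t, χ t • (f t - C) = χ t • f t - χ t • C := fun t => smul_sub _ _ _
    simp only [e2]
    rw [integral_sub (hint χ χs χc χt)
      ((χs.continuous.integrable_of_hasCompactSupport χc).smul_const C), integral_smul_const]
    exact h0
  filter_upwards [key] with t ht h0
  exact sub_eq_zero.mp (ht h0)

/-! ### The completion of the test functions in the energy norm -/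

/-- A square integrable function on the half-line is integrable on `(0, T)`, and its integral is
controlled by the arithmetic-geometric inequality `2 |g| ≤ s + |g|² / s`. -/
theorem intervalIntegrable_and_norm_integral_le {g : ℝ → ℂ}
    (hg : AEStronglyMeasurable g (volume.restrict (Ioi (0 : ℝ)))) {e : ℝ}
    (he : ∫⁻ t in Ioi (0 : ℝ), ENNReal.ofReal (‖g t‖ ^ 2) ≤ ENNReal.ofReal e) (he0 : 0 ≤ e)
    {s T : ℝ} (hs : 0 < s) (hT : 0 ≤ T) :
    IntervalIntegrable g volume 0 T ∧ ‖∫ t in (0 : ℝ)..T, g t‖ ≤ s * T / 2 + e / (2 * s) := by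
  have hsq : IntegrableOn (fun t => ‖g t‖ ^ 2) (Ioi 0) := by
    refine ⟨hg.norm.pow 2, ?_⟩
    rw [hasFiniteIntegral_iff_ofReal (Eventually.of_forall fun t => by positivity)]
    exact he.trans_lt ENNReal.ofReal_lt_top
  have hsqle : ∫ t in Ioi (0 : ℝ), ‖g t‖ ^ 2 ≤ e := by
    rw [integral_eq_lintegral_of_nonneg_ae (Eventually.of_forall fun t => by positivity)
      hsq.aestronglyMeasurable]
    exact ENNReal.toReal_le_of_le_ofReal he0 he
  have hsub : Ioc 0 T ⊆ Ioi (0 : ℝ) := fun t ht => ht.1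
  have hsq' := hsq.mono_set hsub
  have hc : IntegrableOn (fun _ : ℝ => s / 2) (Ioc 0 T) := by simp
  have hmaj : IntegrableOn (fun t => s / 2 + ‖g t‖ ^ 2 / (2 * s)) (Ioc 0 T) :=
    hc.add (hsq'.div_const (2 * s))
  have hle : ∀ t, ‖g t‖ ≤ s / 2 + ‖g t‖ ^ 2 / (2 * s) := by
    intro t
    rw [div_add_div _ _ (by norm_num) (by positivity), le_div_iff₀ (by positivity)]
    nlinarith [sq_nonneg (‖g t‖ - s)]
  have hgi : IntegrableOn g (Ioc 0 T) :=
    hmaj.mono' (hg.mono_measure (Measure.restrict_mono hsub le_rfl)) (Eventually.of_forall hle)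
  refine ⟨(intervalIntegrable_iff_integrableOn_Ioc_of_le hT).mpr hgi, ?_⟩
  rw [intervalIntegral.integral_of_le hT]
  calc ‖∫ t in Ioc 0 T, g t‖ ≤ ∫ t in Ioc 0 T, ‖g t‖ := norm_integral_le_integral_norm _
    _ ≤ ∫ t in Ioc 0 T, (s / 2 + ‖g t‖ ^ 2 / (2 * s)) := integral_mono hgi.norm hmaj hle
    _ = s * T / 2 + (∫ t in Ioc 0 T, ‖g t‖ ^ 2) / (2 * s) := by
        rw [integral_add hc (hsq'.div_const (2 * s)), integral_div (2 * s) (fun t => ‖g t‖ ^ 2)]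
        congr 1
        simp [hT]
        ring
    _ ≤ s * T / 2 + e / (2 * s) := by
        gcongr
        exact (setIntegral_mono_set hsq (Eventually.of_forall fun t => by positivity)
          (Eventually.of_forall hsub)).trans hsqle

section Temporal

variable {n : ℕ} {Λ : ℝ}

theorem waveCoeff_pos (hn : 3 ≤ n) : 0 < waveCoeff n := by
  have : (3 : ℝ) ≤ n := by exact_mod_cast hn
  unfold waveCoeff
  have : (0 : ℝ) < n - 1 := by linarith
  positivity

theorem temporalDensity_nonneg (hn : 3 ≤ n) (t : ℝ) (x y : ℂ) : 0 ≤ temporalDensity n Λ t x y := by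
  have := waveCoeff_pos hn
  unfold temporalDensity
  positivity

theorem norm_add_sq_le (x y : ℂ) : ‖x + y‖ ^ 2 ≤ 2 * ‖x‖ ^ 2 + 2 * ‖y‖ ^ 2 := by
  have := norm_add_le x y
  nlinarith [norm_nonneg (x + y), sq_nonneg (‖x‖ - ‖y‖), norm_nonneg x, norm_nonneg y]

theorem temporalDensity_le (hn : 3 ≤ n) (t : ℝ) (x y dx dy : ℂ) :
    temporalDensity n Λ t x dx
      ≤ 2 * temporalDensity n Λ t (x - y) (dx - dy) + 2 * temporalDensity n Λ t y dy := by
  have hc := waveCoeff_pos hn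
  have h1 := norm_add_sq_le (x - y) y
  have h2 := norm_add_sq_le (dx - dy) dy
  rw [sub_add_cancel] at h1 h2
  unfold temporalDensity
  have h3 := mul_le_mul_of_nonneg_left h2 hc.le
  have h4 := mul_le_mul_of_nonneg_left h1 (show 0 ≤ n * |Λ| * t ^ 2 by positivity)
  linarith

theorem aemeasurable_temporalDensity {w dw : ℝ → ℂ} {ν : Measure ℝ}
    (hw : AEStronglyMeasurable w ν) (hdw : AEStronglyMeasurable dw ν) :
    AEMeasurable (fun t => ENNReal.ofReal (temporalDensity n Λ t (w t) (dw t))) ν := by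
  have h1 := hw.aemeasurable
  have h2 := hdw.aemeasurable
  unfold temporalDensity
  fun_prop

theorem MemTemporalSpace.lintegral_lt_top (hn : 3 ≤ n) {w dw : ℝ → ℂ}
    (h : MemTemporalSpace n Λ w dw) :
    ∫⁻ t in Ioi (0 : ℝ), ENNReal.ofReal (temporalDensity n Λ t (w t) (dw t)) < ⊤ := by
  obtain ⟨hwm, hdwm, η, hη, hlim⟩ := h
  obtain ⟨k, hk⟩ := (hlim.eventually_lt_const ENNReal.zero_lt_top).exists
  obtain ⟨h1, h2, -⟩ := hη k
  have hd : Continuous (deriv (η k)) := h1.continuous_deriv (by simp)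
  have hfin : ∫⁻ t in Ioi (0 : ℝ),
      ENNReal.ofReal (temporalDensity n Λ t (η k t) (deriv (η k) t)) < ⊤ := by
    have hi : Integrable (fun t => temporalDensity n Λ t (η k t) (deriv (η k) t)) := by
      refine Continuous.integrable_of_hasCompactSupport ?_ ?_
      · have := h1.continuous
        unfold temporalDensity
        fun_prop
      · refine HasCompactSupport.add ?_ ?_
        · exact (h2.deriv.comp_left (g := fun z => waveCoeff n * ‖z‖ ^ 2) (by simp))
        · exact (h2.comp_left (g := fun z => ‖z‖ ^ 2) (by simp)).mul_left
    exact (setLIntegral_le_lintegral _ _).trans_lt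
      ((hasFiniteIntegral_iff_ofReal (Eventually.of_forall fun t =>
        temporalDensity_nonneg hn t _ _)).mp hi.2)
  calc ∫⁻ t in Ioi (0 : ℝ), ENNReal.ofReal (temporalDensity n Λ t (w t) (dw t))
      ≤ ∫⁻ t in Ioi (0 : ℝ), (2 * ENNReal.ofReal (temporalDensity n Λ t (w t - η k t)
          (dw t - deriv (η k) t))
        + 2 * ENNReal.ofReal (temporalDensity n Λ t (η k t) (deriv (η k) t))) := by
        refine lintegral_mono fun t => ?_
        have h2 : (2 : ℝ≥0∞) = ENNReal.ofReal 2 := by simp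
        rw [h2, ← ENNReal.ofReal_mul (by norm_num), ← ENNReal.ofReal_mul (by norm_num),
          ← ENNReal.ofReal_add (mul_nonneg (by norm_num) (temporalDensity_nonneg hn _ _ _))
            (mul_nonneg (by norm_num) (temporalDensity_nonneg hn _ _ _))]
        exact ENNReal.ofReal_le_ofReal (temporalDensity_le hn _ _ _ _ _)
    _ = 2 * (∫⁻ t in Ioi (0 : ℝ), ENNReal.ofReal (temporalDensity n Λ t (w t - η k t)
          (dw t - deriv (η k) t)))
        + 2 * ∫⁻ t in Ioi (0 : ℝ),
          ENNReal.ofReal (temporalDensity n Λ t (η k t) (deriv (η k) t)) := by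
        have hm := aemeasurable_temporalDensity (n := n) (Λ := Λ)
          (ν := volume.restrict (Ioi (0 : ℝ))) (hwm.sub h1.continuous.aestronglyMeasurable)
          (hdwm.sub hd.aestronglyMeasurable)
        simp only [Pi.sub_apply] at hm
        rw [lintegral_add_left' (hm.const_mul 2), lintegral_const_mul'' _ hm,
          lintegral_const_mul' _ _ (by simp)]
    _ < ⊤ := ENNReal.add_lt_top.mpr
        ⟨ENNReal.mul_lt_top (by simp) hk, ENNReal.mul_lt_top (by simp) hfin⟩

theorem lintegral_sq_le_of_temporalDensity (hn : 3 ≤ n) (w dw : ℝ → ℂ) :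
    ∫⁻ t in Ioi (0 : ℝ), ENNReal.ofReal (‖dw t‖ ^ 2)
      ≤ ENNReal.ofReal (waveCoeff n)⁻¹ *
        ∫⁻ t in Ioi (0 : ℝ), ENNReal.ofReal (temporalDensity n Λ t (w t) (dw t)) := by
  have hc := waveCoeff_pos hn
  rw [← lintegral_const_mul' _ _ ENNReal.ofReal_ne_top]
  refine lintegral_mono fun t => ?_
  rw [← ENNReal.ofReal_mul (by positivity)]
  refine ENNReal.ofReal_le_ofReal ?_
  rw [← div_eq_inv_mul, le_div_iff₀ hc]
  have : 0 ≤ n * |Λ| * t ^ 2 * ‖w t‖ ^ 2 := by positivity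
  unfold temporalDensity
  linarith

/-- The weak derivative of an element of the completion is square integrable. -/
theorem MemTemporalSpace.exists_lintegral_sq_le (hn : 3 ≤ n) {w dw : ℝ → ℂ}
    (h : MemTemporalSpace n Λ w dw) :
    ∃ e : ℝ, 0 ≤ e ∧ ∫⁻ t in Ioi (0 : ℝ), ENNReal.ofReal (‖dw t‖ ^ 2) ≤ ENNReal.ofReal e := by
  have h1 := (lintegral_sq_le_of_temporalDensity (Λ := Λ) hn w dw).trans_lt
    (ENNReal.mul_lt_top ENNReal.ofReal_lt_top (h.lintegral_lt_top hn))
  exact ⟨_, ENNReal.toReal_nonneg, (ENNReal.ofReal_toReal h1.ne).ge⟩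

/-- An element of the completion is, almost everywhere, the primitive of its weak derivative that
vanishes at `0`: the approximating test functions are the primitives of their derivatives. -/
theorem MemTemporalSpace.ae_eq_integral (hn : 3 ≤ n) (hΛ : Λ < 0) {w dw : ℝ → ℂ}
    (h : MemTemporalSpace n Λ w dw) :
    ∀ᵐ t ∂(volume.restrict (Ioi (0 : ℝ))), w t = ∫ s in (0 : ℝ)..t, dw s := by
  have hc := waveCoeff_pos hn
  obtain ⟨e, he0, he⟩ := h.exists_lintegral_sq_le hn
  obtain ⟨hwm, hdwm, η, hη, hlim⟩ := h
  have hηd : ∀ k, Continuous (deriv (η k)) := fun k => (hη k).1.continuous_deriv (by simp)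
  -- the test functions converge pointwise to the primitive of `dw`
  have hpt : ∀ t > 0, Tendsto (fun k => η k t) atTop (𝓝 (∫ s in (0 : ℝ)..t, dw s)) := by
    intro t ht
    rw [Metric.tendsto_nhds]
    intro ε hε
    -- with this `s`, energy below `c ε s` bounds the primitive at `t` by `ε / 4 + ε / 2`
    set s := ε / (2 * t) with hs
    have hs0 : 0 < s := by positivity
    have hev : ∀ᶠ k in atTop, ∫⁻ t in Ioi (0 : ℝ), ENNReal.ofReal
        (temporalDensity n Λ t (w t - η k t) (dw t - deriv (η k) t))
          < ENNReal.ofReal (waveCoeff n * (ε * s)) :=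
      hlim.eventually_lt_const (ENNReal.ofReal_pos.mpr (by positivity))
    filter_upwards [hev] with k hk
    have h1 : ∫⁻ t in Ioi (0 : ℝ), ENNReal.ofReal (‖dw t - deriv (η k) t‖ ^ 2)
        ≤ ENNReal.ofReal (ε * s) := by
      refine (lintegral_sq_le_of_temporalDensity (Λ := Λ) hn (fun t => w t - η k t)
        (fun t => dw t - deriv (η k) t)).trans ?_
      calc _ ≤ ENNReal.ofReal (waveCoeff n)⁻¹ * ENNReal.ofReal (waveCoeff n * (ε * s)) := by
            gcongr
        _ = ENNReal.ofReal (ε * s) := by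
            rw [← ENNReal.ofReal_mul (by positivity)]
            congr 1
            field_simp
    have h2 := (intervalIntegrable_and_norm_integral_le
      (hdwm.sub (hηd k).aestronglyMeasurable) h1 (by positivity) hs0 ht.le).2
    have h3 := (intervalIntegrable_and_norm_integral_le hdwm he he0 hs0 ht.le).1
    have h4 : ∫ s in (0 : ℝ)..t, deriv (η k) s = η k t := by
      rw [intervalIntegral.integral_deriv_eq_sub
        (fun x _ => (hη k).1.differentiable (by simp) x) ((hηd k).intervalIntegrable _ _)]
      rw [image_eq_zero_of_notMem_tsupport (f := η k) (x := 0)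
        (fun h0 => lt_irrefl (0 : ℝ) ((hη k).2.2 h0)), sub_zero]
    simp only [Pi.sub_apply] at h2
    rw [intervalIntegral.integral_sub h3 ((hηd k).intervalIntegrable _ _), h4] at h2
    rw [dist_comm, dist_eq_norm]
    refine h2.trans_lt ?_
    have h5 : s * t / 2 = ε / 4 := by rw [hs]; field_simp; norm_num
    have h6 : ε * s / (2 * s) = ε / 2 := by field_simp
    rw [h5, h6]
    linarith
  set W : ℝ → ℂ := fun t => ∫ s in (0 : ℝ)..t, dw s with hW
  have hmeas : ∀ k, AEMeasurable (fun t => ENNReal.ofReal (n * |Λ| * t ^ 2 * ‖w t - η k t‖ ^ 2))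
      (volume.restrict (Ioi (0 : ℝ))) := by
    intro k
    have h1 := hwm.aemeasurable
    have h2 := (hη k).1.continuous.measurable
    fun_prop
  have hconv : ∀ᵐ t ∂(volume.restrict (Ioi (0 : ℝ))),
      Tendsto (fun k => ENNReal.ofReal (n * |Λ| * t ^ 2 * ‖w t - η k t‖ ^ 2)) atTop
        (𝓝 (ENNReal.ofReal (n * |Λ| * t ^ 2 * ‖w t - W t‖ ^ 2))) := by
    filter_upwards [ae_restrict_mem measurableSet_Ioi] with t ht0
    exact ENNReal.tendsto_ofReal
      ((((tendsto_const_nhds.sub (hpt t ht0)).norm).pow 2).const_mul _)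
  -- by the lemma of Fatou, `w` and the pointwise limit `W` differ by a function of weighted norm
  -- `0`
  have hzero : ∫⁻ t in Ioi (0 : ℝ), ENNReal.ofReal (n * |Λ| * t ^ 2 * ‖w t - W t‖ ^ 2) = 0 := by
    rw [lintegral_congr_ae (hconv.mono fun t ht => ht.liminf_eq.symm)]
    refine le_antisymm ((lintegral_liminf_le' hmeas).trans ?_) bot_le
    have : Tendsto (fun k => ∫⁻ t in Ioi (0 : ℝ),
        ENNReal.ofReal (n * |Λ| * t ^ 2 * ‖w t - η k t‖ ^ 2)) atTop (𝓝 0) := by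
      refine tendsto_of_tendsto_of_tendsto_of_le_of_le tendsto_const_nhds hlim
        (fun _ => bot_le) fun k => lintegral_mono fun t => ENNReal.ofReal_le_ofReal ?_
      have : 0 ≤ waveCoeff n * ‖dw t - deriv (η k) t‖ ^ 2 := by positivity
      unfold temporalDensity
      linarith
    exact this.liminf_eq.le
  rw [lintegral_eq_zero_iff' (aemeasurable_of_tendsto_metrizable_ae atTop hmeas hconv)] at hzero
  filter_upwards [hzero, ae_restrict_mem measurableSet_Ioi] with t ht ht0
  simp only [Pi.zero_apply, ENNReal.ofReal_eq_zero] at ht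
  have h2 : 0 < n * |Λ| * t ^ 2 := by
    have : 0 < |Λ| := abs_pos.mpr hΛ.ne
    have : (0 : ℝ) < n := by exact_mod_cast (by omega : 0 < n)
    have : (0 : ℝ) < t := ht0
    positivity
  have h3 : ‖w t - W t‖ ^ 2 ≤ 0 := nonpos_of_mul_nonpos_right ht h2
  have h4 : ‖w t - W t‖ = 0 := by
    have := norm_nonneg (w t - W t)
    nlinarith
  exact sub_eq_zero.mp (norm_eq_zero.mp h4)

end Temporal

/-! ### Regularity of weak temporal eigenfunctions -/

section Temporal

variable {n : ℕ} {Λ : ℝ}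

/-- The coefficient `p` in the equation `w'' = p w` to which the temporal eigenvalue problem
amounts on `(0, ∞)`, continued by `0` to `t ≤ 0`. The continuation is continuous, so that solutions
live on all of `ℝ` and one-sided derivatives at `t = 0` are not needed. -/
def potential (n : ℕ) (Λ lam t : ℝ) : ℝ :=
  (n * |Λ| * max t 0 ^ 2 - lam * max t 0 ^ (2 - 4 / (n : ℝ))) / waveCoeff n

theorem two_thirds_le_exponent (hn : 3 ≤ n) : (2 / 3 : ℝ) ≤ 2 - 4 / (n : ℝ) := by
  have h : (3 : ℝ) ≤ n := by exact_mod_cast hn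
  have : 4 / (n : ℝ) ≤ 4 / 3 := by gcongr
  linarith

theorem exponent_lt_two (hn : 3 ≤ n) : 2 - 4 / (n : ℝ) < 2 := by
  have h : (3 : ℝ) ≤ n := by exact_mod_cast hn
  have : 0 < 4 / (n : ℝ) := by positivity
  linarith

theorem continuous_potential (hn : 3 ≤ n) (lam : ℝ) : Continuous (potential n Λ lam) := by
  have := two_thirds_le_exponent hn
  unfold potential
  refine ((continuous_const.mul ((continuous_id.max continuous_const).pow 2)).sub
    (continuous_const.mul ?_)).div_const _
  exact (Real.continuous_rpow_const (by linarith)).comp (continuous_id.max continuous_const)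

theorem potential_of_nonpos (hn : 3 ≤ n) (lam : ℝ) {t : ℝ} (ht : t ≤ 0) :
    potential n Λ lam t = 0 := by
  have := two_thirds_le_exponent hn
  unfold potential
  rw [max_eq_right ht, Real.zero_rpow (by linarith)]
  simp

theorem memTemporalSpace_ofReal {ψ : ℝ → ℝ} (hψ : ContDiff ℝ ∞ ψ) (hc : HasCompactSupport ψ)
    (ht : tsupport ψ ⊆ Ioi 0) :
    MemTemporalSpace n Λ (fun t => (ψ t : ℂ)) (fun t => ((deriv ψ t : ℝ) : ℂ)) := by
  have hd : ∀ t, deriv (fun t => (ψ t : ℂ)) t = ((deriv ψ t : ℝ) : ℂ) := fun t =>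
    ((hψ.differentiable (by simp)) t).hasDerivAt.ofReal_comp.deriv
  refine ⟨(Complex.continuous_ofReal.comp hψ.continuous).aestronglyMeasurable,
    (Complex.continuous_ofReal.comp (hψ.continuous_deriv (by simp))).aestronglyMeasurable,
    fun _ t => (ψ t : ℂ), fun _ => ⟨Complex.ofRealCLM.contDiff.comp hψ,
      hc.comp_left (g := fun x : ℝ => (x : ℂ)) (by simp), ?_⟩, ?_⟩
  · refine (closure_mono ?_).trans ht
    intro t h
    simpa using h
  · simp [hd, temporalDensity]

/-- `W`, with derivative `D`, is the continuation to `ℝ` of a solution of the temporal eigenvalue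
problem with eigenvalue `lam`; it is affine on `(-∞, 0]`. -/
structure IsTemporalSolution (n : ℕ) (Λ lam : ℝ) (W D : ℝ → ℂ) : Prop where
  hasDerivAt : ∀ t, HasDerivAt W (D t) t
  hasDerivAt_deriv : ∀ t, HasDerivAt D (potential n Λ lam t * W t) t
  map_zero : W 0 = 0
  mem : MemTemporalSpace n Λ W D
  weak : ∀ ψ dψ : ℝ → ℂ, MemTemporalSpace n Λ ψ dψ → formB n Λ W D ψ dψ = lam * formK n W ψ

theorem MemTemporalSpace.congr_ae {w dw w' dw' : ℝ → ℂ} (h : MemTemporalSpace n Λ w dw)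
    (h1 : w =ᵐ[volume.restrict (Ioi 0)] w') (h2 : dw =ᵐ[volume.restrict (Ioi 0)] dw') :
    MemTemporalSpace n Λ w' dw' := by
  obtain ⟨hm, hdm, η, hη, hlim⟩ := h
  refine ⟨hm.congr h1, hdm.congr h2, η, hη, hlim.congr fun k => lintegral_congr_ae ?_⟩
  filter_upwards [h1, h2] with t e1 e2
  rw [e1, e2]

/-- A weak solution of the temporal eigenvalue problem is a classical one: for test functions `ψ`
the weak equation says that `c * conj w' - Q` annihilates all `ψ'`, where `Q' = c p * conj w`, so
this difference is constant by the lemma of du Bois-Reymond. -/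
theorem IsTemporalEigenpair.exists_isTemporalSolution (hn : 3 ≤ n) (hΛ : Λ < 0) {w : ℝ → ℂ}
    {lam : ℝ} (h : IsTemporalEigenpair n Λ w lam) :
    ∃ W D : ℝ → ℂ, IsTemporalSolution n Λ lam W D ∧ ∀ t > 0, W t = w t := by
  have hc := waveCoeff_pos hn
  obtain ⟨hcont, -, dw, hmem, hweak⟩ := h
  obtain ⟨e, he0, he⟩ := hmem.exists_lintegral_sq_le hn
  have hii : ∀ T, 0 ≤ T → IntegrableOn dw (Ioc 0 T) := fun T hT =>
    (intervalIntegrable_iff_integrableOn_Ioc_of_le hT).mp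
      (intervalIntegrable_and_norm_integral_le hmem.2.1 he he0 one_pos hT).1
  -- the continuous primitive `W₀` of the weak derivative agrees with `w` on `(0, ∞)`
  set g : ℝ → ℂ := (Ioi 0).indicator dw with hg
  have hgi : ∀ a b, IntervalIntegrable g volume a b := by
    intro a b
    rw [intervalIntegrable_iff]
    have h1 : IntegrableOn g (Ioc (min a b) (max (max a b) 0)) := by
      rw [hg, integrableOn_indicator_iff measurableSet_Ioi]
      exact (hii (max (max a b) 0) (le_max_right _ _)).mono_set fun t ht => ⟨ht.1, ht.2.2⟩
    exact h1.mono_set (fun t ht => ⟨ht.1, le_max_of_le_left ht.2⟩)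
  set W₀ : ℝ → ℂ := fun t => ∫ s in (0 : ℝ)..t, g s with hW₀
  have hW₀c : Continuous W₀ := intervalIntegral.continuous_primitive hgi 0
  have hW₀w : ∀ t > 0, W₀ t = w t := by
    have hae : W₀ =ᵐ[volume.restrict (Ioi (0 : ℝ))] w := by
      filter_upwards [hmem.ae_eq_integral hn hΛ, ae_restrict_mem measurableSet_Ioi] with t ht ht0
      rw [ht]
      refine intervalIntegral.integral_congr_ae (Eventually.of_forall fun s hs => ?_)
      rw [uIoc_of_le (le_of_lt ht0)] at hs
      exact indicator_of_mem (show s ∈ Ioi (0 : ℝ) from hs.1) _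
    exact fun t ht => Measure.eqOn_open_of_ae_eq hae isOpen_Ioi hW₀c.continuousOn hcont ht
  have hpc := continuous_potential (Λ := Λ) hn lam
  -- the conjugation accounts for `formB` and `formK` being antilinear in the first argument
  set q : ℝ → ℂ := fun t => (waveCoeff n * potential n Λ lam t : ℝ) * (starRingEnd ℂ) (W₀ t) with hq
  have hqc : Continuous q := by fun_prop
  set Q : ℝ → ℂ := fun t => ∫ s in (0 : ℝ)..t, q s with hQ
  have hQd : ∀ t, HasDerivAt Q (q t) t := fun t =>
    intervalIntegral.integral_hasDerivAt_right (hqc.intervalIntegrable _ _)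
      (hqc.stronglyMeasurableAtFilter _ _) hqc.continuousAt
  have hQc : Continuous Q := continuous_iff_continuousAt.mpr fun t => (hQd t).continuousAt
  have hdwl : LocallyIntegrableOn dw (Ioi 0) := fun x hx =>
    ⟨Ioc 0 (x + 1), mem_nhdsWithin.mpr ⟨Iio (x + 1), isOpen_Iio, by simp,
      fun t ht => ⟨ht.2, le_of_lt ht.1⟩⟩, hii _ (by linarith [mem_Ioi.mp hx])⟩
  have hconj :
      LocallyIntegrableOn (fun t => (waveCoeff n : ℂ) * (starRingEnd ℂ) (dw t)) (Ioi 0) := by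
    intro x hx
    obtain ⟨s, hs, hi⟩ := hdwl x hx
    exact ⟨s, hs, ((Complex.conjCLE : ℂ →L[ℝ] ℂ).integrable_comp hi).const_mul _⟩
  obtain ⟨C, hC⟩ := ae_eq_const_of_integral_deriv_smul_eq_zero
    (f := fun t => (waveCoeff n : ℂ) * (starRingEnd ℂ) (dw t) - Q t)
    (hconj.sub (hQc.locallyIntegrable.locallyIntegrableOn _)) (by
      intro ψ hψ hψc hψt
      have h1 := hweak _ _ (memTemporalSpace_ofReal (n := n) (Λ := Λ) hψ hψc hψt)
      have hψd : Continuous (deriv ψ) := hψ.continuous_deriv (by simp)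
      have hψ0 : ∀ t ≤ 0, ψ t = 0 := fun t ht =>
        image_eq_zero_of_notMem_tsupport fun h => not_lt.mpr ht (hψt h)
      have hψ0' : ∀ t ≤ 0, deriv ψ t = 0 := fun t ht =>
        image_eq_zero_of_notMem_tsupport fun h => not_lt.mpr ht (hψt (tsupport_deriv_subset h))
      have hloc : ∀ {f : ℝ → ℂ} {χ : ℝ → ℝ}, LocallyIntegrableOn f (Ioi 0) → Continuous χ →
          HasCompactSupport χ → tsupport χ ⊆ Ioi 0 → Integrable (fun t => f t * (χ t : ℂ)) := by
        intro f χ hf h1 h2 h3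
        have hK : IntegrableOn f (tsupport χ) := hf.integrableOn_compact_subset h3 h2.isCompact
        have : IntegrableOn (fun t => f t * (χ t : ℂ)) (tsupport χ) :=
          hK.mul_continuousOn (Complex.continuous_ofReal.comp h1).continuousOn h2.isCompact
        rwa [integrableOn_iff_integrable_of_support_subset] at this
        intro t ht
        refine subset_tsupport χ fun h0 => ht ?_
        simp [h0]
      have hψt' : tsupport (deriv ψ) ⊆ Ioi 0 := tsupport_deriv_subset.trans hψt
      have i1 := hloc hconj hψd hψc.deriv hψt'
      have hcQ : ∀ (f : ℝ → ℂ) (hf : Continuous f), LocallyIntegrableOn f (Ioi 0) :=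
        fun f hf => hf.locallyIntegrable.locallyIntegrableOn _
      have i2 := hloc (hcQ Q hQc) hψd hψc.deriv hψt'
      have i3 := hloc (hcQ q hqc) hψ.continuous hψc hψt
      have i4 := hloc (hcQ Q hQc) hψ.continuous hψc hψt
      -- integration by parts
      have parts : ∫ t, Q t * ((deriv ψ t : ℝ) : ℂ) = -∫ t, q t * (ψ t : ℂ) :=
        integral_mul_deriv_eq_deriv_mul_of_integrable (fun t _ => hQd t)
          (fun t _ => ((hψ.differentiable (by simp)) t).hasDerivAt.ofReal_comp) i2 i3 i4
      -- the weak equation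
      have hex : 0 ≤ 2 - 4 / (n : ℝ) := by linarith [two_thirds_le_exponent hn]
      have i5 : Integrable (fun t => ((max t 0 ^ (2 - 4 / (n : ℝ)) : ℝ) : ℂ)
          * (starRingEnd ℂ) (W₀ t) * (ψ t : ℂ)) := by
        refine hloc (hcQ _ ?_) hψ.continuous hψc hψt
        have := (Real.continuous_rpow_const hex).comp (continuous_id.max continuous_const
          : Continuous fun t : ℝ => max t 0)
        exact (Complex.continuous_ofReal.comp this).mul (Complex.continuous_conj.comp hW₀c)
      have i6 : Integrable (fun t => ((n * |Λ| * t ^ 2 : ℝ) : ℂ)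
          * (starRingEnd ℂ) (W₀ t) * (ψ t : ℂ)) :=
        hloc (hcQ _ (by fun_prop)) hψ.continuous hψc hψt
      have e1 : formB n Λ w dw (fun t => (ψ t : ℂ)) (fun t => ((deriv ψ t : ℝ) : ℂ))
          = (∫ t, (waveCoeff n : ℂ) * (starRingEnd ℂ) (dw t) * ((deriv ψ t : ℝ) : ℂ))
            + ∫ t, ((n * |Λ| * t ^ 2 : ℝ) : ℂ) * (starRingEnd ℂ) (W₀ t) * (ψ t : ℂ) := by
        rw [← integral_add i1 i6, formB, ← integral_indicator measurableSet_Ioi]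
        congr 1
        ext t
        by_cases ht : 0 < t
        · rw [indicator_of_mem (mem_Ioi.mpr ht), hW₀w t ht]
          ring
        · rw [indicator_of_notMem (by simpa using ht), hψ0 t (not_lt.mp ht), hψ0' t (not_lt.mp ht)]
          simp
      have e2 : formK n w (fun t => (ψ t : ℂ))
          = ∫ t, ((max t 0 ^ (2 - 4 / (n : ℝ)) : ℝ) : ℂ) * (starRingEnd ℂ) (W₀ t) * (ψ t : ℂ) := by
        rw [formK, ← integral_indicator measurableSet_Ioi]
        congr 1
        ext t
        by_cases ht : 0 < t
        · rw [indicator_of_mem (mem_Ioi.mpr ht), hW₀w t ht, max_eq_left ht.le]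
          ring
        · rw [indicator_of_notMem (by simpa using ht), hψ0 t (not_lt.mp ht)]
          simp
      have e3 : ∫ t, q t * (ψ t : ℂ)
          = (∫ t, ((n * |Λ| * t ^ 2 : ℝ) : ℂ) * (starRingEnd ℂ) (W₀ t) * (ψ t : ℂ))
            - lam * ∫ t, ((max t 0 ^ (2 - 4 / (n : ℝ)) : ℝ) : ℂ) * (starRingEnd ℂ) (W₀ t)
              * (ψ t : ℂ) := by
        rw [← integral_const_mul, ← integral_sub i6 (i5.const_mul _)]
        congr 1
        ext t
        by_cases ht : 0 < t
        · have : waveCoeff n * potential n Λ lam t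
              = n * |Λ| * t ^ 2 - lam * max t 0 ^ (2 - 4 / (n : ℝ)) := by
            unfold potential
            rw [mul_div_cancel₀ _ hc.ne']
            nth_rw 1 [max_eq_left ht.le]
          simp only [hq]
          rw [this]
          push_cast
          ring
        · rw [hψ0 t (not_lt.mp ht)]
          simp
      have e4 : ∀ t, deriv ψ t • ((waveCoeff n : ℂ) * (starRingEnd ℂ) (dw t) - Q t)
          = (waveCoeff n : ℂ) * (starRingEnd ℂ) (dw t) * ((deriv ψ t : ℝ) : ℂ)
            - Q t * ((deriv ψ t : ℝ) : ℂ) := fun t => by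
        rw [Complex.real_smul]
        ring
      simp only [e4]
      rw [integral_sub i1 i2, parts, e3]
      rw [e1, e2] at h1
      linear_combination h1)
  -- a continuous representative of the weak derivative, defined on all of `ℝ`
  set D : ℝ → ℂ := fun t => (starRingEnd ℂ) (((waveCoeff n)⁻¹ : ℝ) * (C + Q t)) with hD
  have hDc : Continuous D := by fun_prop
  have hDdw : dw =ᵐ[volume.restrict (Ioi 0)] D := by
    rw [EventuallyEq, ae_restrict_iff' measurableSet_Ioi]
    filter_upwards [hC] with t ht h0
    have h1 := ht h0
    have hc' : (waveCoeff n : ℂ) ≠ 0 := by exact_mod_cast hc.ne'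
    rw [hD]
    simp only
    rw [← h1]
    push_cast
    rw [sub_add_cancel, ← mul_assoc, inv_mul_cancel₀ hc', one_mul, Complex.conj_conj]
  set W : ℝ → ℂ := fun t => ∫ s in (0 : ℝ)..t, D s with hW
  have hWd (t : ℝ) : HasDerivAt W (D t) t :=
    intervalIntegral.integral_hasDerivAt_right (hDc.intervalIntegrable _ _)
      (hDc.stronglyMeasurableAtFilter _ _) hDc.continuousAt
  have hWW₀ : ∀ t > 0, W t = W₀ t := by
    intro t ht
    refine intervalIntegral.integral_congr_ae ?_
    rw [EventuallyEq, ae_restrict_iff' measurableSet_Ioi] at hDdw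
    filter_upwards [hDdw] with s hs hst
    rw [uIoc_of_le ht.le] at hst
    rw [← hs hst.1]
    exact (indicator_of_mem (show s ∈ Ioi (0 : ℝ) from hst.1) _).symm
  have hWw : ∀ t > 0, W t = w t := fun t ht => (hWW₀ t ht).trans (hW₀w t ht)
  have haeW : w =ᵐ[volume.restrict (Ioi 0)] W := by
    filter_upwards [ae_restrict_mem measurableSet_Ioi] with t ht using (hWw t ht).symm
  refine ⟨W, D, ⟨hWd, fun t => ?_, by simp [hW], hmem.congr_ae haeW hDdw, fun ψ dψ hψ => ?_⟩, hWw⟩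
  · have h1 : HasDerivAt D ((starRingEnd ℂ) (((waveCoeff n)⁻¹ : ℝ) * q t)) t := by
      exact (((hQd t).const_add C).const_mul (((waveCoeff n)⁻¹ : ℝ) : ℂ)).star
    convert h1 using 1
    have hc' : (waveCoeff n : ℂ) ≠ 0 := by exact_mod_cast hc.ne'
    rcases lt_or_ge 0 t with ht | ht
    · rw [hWW₀ t ht]
      simp only [hq]
      push_cast
      simp only [map_mul, Complex.conj_conj, Complex.conj_ofReal, map_inv₀]
      field_simp
    · simp [hq, potential_of_nonpos hn lam ht]
  · have h1 := hweak ψ dψ hψ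
    have e1 : formB n Λ W D ψ dψ = formB n Λ w dw ψ dψ := by
      refine integral_congr_ae ?_
      filter_upwards [haeW, hDdw] with t h2 h3
      rw [h2, h3]
    have e2 : formK n W ψ = formK n w ψ := by
      refine integral_congr_ae ?_
      filter_upwards [haeW] with t h2
      rw [h2]
    rw [e1, e2, h1]

end Temporal

/-! ### Exponential decay, and regularity up to `t = 0`, of temporal eigenfunctions -/

section Temporal

variable {n : ℕ} {Λ lam : ℝ} {W D : ℝ → ℂ}

theorem one_add_sq_le_exp {t : ℝ} (ht : 0 ≤ t) : (1 + t) ^ 2 ≤ 4 * Real.exp t := by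
  have h1 := Real.add_one_le_exp (t / 2)
  have h2 : Real.exp t = Real.exp (t / 2) ^ 2 := by
    rw [← Real.exp_nat_mul]; congr 1; push_cast; ring
  rw [h2]
  nlinarith [Real.exp_pos (t / 2)]

theorem rpow_exponent_le (hn : 3 ≤ n) {t : ℝ} (ht : 0 ≤ t) :
    t ^ (2 - 4 / (n : ℝ)) ≤ (1 + t) ^ 2 := by
  have ha := two_thirds_le_exponent hn
  calc t ^ (2 - 4 / (n : ℝ)) ≤ (1 + t) ^ (2 - 4 / (n : ℝ)) :=
        Real.rpow_le_rpow ht (by linarith) (by linarith)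
    _ ≤ (1 + t) ^ (2 : ℝ) :=
        Real.rpow_le_rpow_of_exponent_le (by linarith) (exponent_lt_two hn).le
    _ = (1 + t) ^ 2 := Real.rpow_two _
theorem eventually_le_potential (hn : 3 ≤ n) (hΛ : Λ < 0) (lam A : ℝ) :
    ∀ᶠ t in atTop, A ≤ potential n Λ lam t := by
  have hc := waveCoeff_pos hn
  have hn0 : (0 : ℝ) < n := by exact_mod_cast (by omega : 0 < n)
  have hL : 0 < |Λ| := abs_pos.mpr hΛ.ne
  have h1 : Tendsto (fun t : ℝ => n * |Λ| * t ^ (4 / (n : ℝ)) - lam) atTop atTop :=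
    tendsto_atTop_add_const_right _ _
      ((tendsto_rpow_atTop (by positivity)).const_mul_atTop (by positivity))
  filter_upwards [h1.eventually_ge_atTop (|A| * waveCoeff n), eventually_ge_atTop 1] with t ht ht1
  have ht0 : 0 < t := by linarith
  have h2 : t ^ 2 = t ^ (2 - 4 / (n : ℝ)) * t ^ (4 / (n : ℝ)) := by
    rw [← Real.rpow_add ht0, sub_add_cancel, Real.rpow_two]
  have h3 : 1 ≤ t ^ (2 - 4 / (n : ℝ)) :=
    Real.one_le_rpow ht1 (by linarith [two_thirds_le_exponent hn])
  unfold potential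
  rw [max_eq_left ht0.le, le_div_iff₀ hc, h2]
  calc A * waveCoeff n ≤ |A| * waveCoeff n := by gcongr; exact le_abs_self A
    _ ≤ 1 * (n * |Λ| * t ^ (4 / (n : ℝ)) - lam) := by rw [one_mul]; exact ht
    _ ≤ t ^ (2 - 4 / (n : ℝ)) * (n * |Λ| * t ^ (4 / (n : ℝ)) - lam) := by
        refine mul_le_mul_of_nonneg_right h3 (le_trans ?_ ht)
        positivity
    _ = _ := by ring

theorem exists_abs_potential_le (hn : 3 ≤ n) (Λ lam : ℝ) :
    ∃ P : ℝ, 0 ≤ P ∧ ∀ t ≥ 0, |potential n Λ lam t| ≤ P * (1 + t) ^ 2 := by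
  have hc := waveCoeff_pos hn
  refine ⟨(n * |Λ| + |lam|) / waveCoeff n, by positivity, fun t ht => ?_⟩
  unfold potential
  rw [max_eq_left ht, abs_div, abs_of_pos hc, div_mul_eq_mul_div]
  refine div_le_div_of_nonneg_right ?_ hc.le
  have h1 := rpow_exponent_le hn ht
  have h2 : t ^ 2 ≤ (1 + t) ^ 2 := by nlinarith
  have h3 : 0 ≤ t ^ (2 - 4 / (n : ℝ)) := Real.rpow_nonneg ht _
  calc |n * |Λ| * t ^ 2 - lam * t ^ (2 - 4 / (n : ℝ))|
      ≤ |n * |Λ| * t ^ 2| + |lam * t ^ (2 - 4 / (n : ℝ))| := abs_sub _ _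
    _ = n * |Λ| * t ^ 2 + |lam| * t ^ (2 - 4 / (n : ℝ)) := by
        rw [abs_mul lam, abs_of_nonneg h3, abs_of_nonneg (by positivity)]
    _ ≤ n * |Λ| * (1 + t) ^ 2 + |lam| * (1 + t) ^ 2 := by gcongr
    _ = _ := by ring

/-- The third derivative `p' W + p W'` of a solution. Through `max t 0` it vanishes for `t ≤ 0`; at
`t = 0` the power `0 ^ (1 - 4 / n)` may have a negative exponent, but it is multiplied by `W 0 = 0`.
-/
def thirdDeriv (n : ℕ) (Λ lam : ℝ) (W D : ℝ → ℂ) (t : ℝ) : ℂ :=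
  ((2 * n * |Λ| / waveCoeff n : ℝ) : ℂ) * (((max t 0 : ℝ) : ℂ) * W (max t 0))
    - ((lam * (2 - 4 / (n : ℝ)) / waveCoeff n : ℝ) : ℂ)
      * (((max t 0 ^ (2 - 4 / (n : ℝ) - 1) : ℝ) : ℂ) * W (max t 0))
    + (potential n Λ lam t : ℂ) * D t
namespace IsTemporalSolution

theorem continuous (h : IsTemporalSolution n Λ lam W D) : Continuous W :=
  continuous_iff_continuousAt.mpr fun t => (h.hasDerivAt t).continuousAt

theorem continuous_deriv (h : IsTemporalSolution n Λ lam W D) : Continuous D :=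
  continuous_iff_continuousAt.mpr fun t => (h.hasDerivAt_deriv t).continuousAt

theorem eq_integral (h : IsTemporalSolution n Λ lam W D) (t : ℝ) :
    W t = ∫ s in (0 : ℝ)..t, D s := by
  rw [intervalIntegral.integral_eq_sub_of_hasDerivAt (fun s _ => h.hasDerivAt s)
    (h.continuous_deriv.intervalIntegrable _ _), h.map_zero, sub_zero]

/-- Functions of finite energy grow at most linearly. -/
theorem exists_norm_le (hn : 3 ≤ n) (h : IsTemporalSolution n Λ lam W D) :
    ∃ A : ℝ, 0 ≤ A ∧ ∀ t ≥ 0, ‖W t‖ ≤ A * (1 + t) := by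
  obtain ⟨e, he0, he⟩ := h.mem.exists_lintegral_sq_le hn
  refine ⟨1 + e, by positivity, fun t ht => ?_⟩
  have := (intervalIntegrable_and_norm_integral_le h.mem.2.1 he he0 one_pos ht).2
  rw [← h.eq_integral] at this
  nlinarith

/-- Beyond the point where the potential exceeds `8`, the function `f = |W|²` satisfies
`f'' ≥ 16 f` and grows at most polynomially, whence the exponential decay of `W`. The decay of the
derivatives follows from the differential equation. -/
theorem exists_norm_le_exp (hn : 3 ≤ n) (hΛ : Λ < 0) (h : IsTemporalSolution n Λ lam W D) :
    ∃ C : ℝ, 0 ≤ C ∧ ∀ t ≥ 0, ‖W t‖ ≤ C * Real.exp (-2 * t) ∧ ‖D t‖ ≤ C * Real.exp (-t) ∧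
      ‖(potential n Λ lam t : ℂ) * W t‖ ≤ C * Real.exp (-t) := by
  obtain ⟨T, hT⟩ := ((eventually_le_potential hn hΛ lam 8).and
    (eventually_ge_atTop 0)).exists_forall_of_atTop
  have hT0 : 0 ≤ T := (hT T le_rfl).2
  obtain ⟨A, hA0, hA⟩ := h.exists_norm_le hn
  have hf : ∀ t, HasDerivAt (fun t => ‖W t‖ ^ 2) (2 * inner ℝ (W t) (D t)) t :=
    fun t => (h.hasDerivAt t).norm_sq
  have hf' : ∀ t, HasDerivAt (fun t => 2 * inner ℝ (W t) (D t))
      (2 * (inner ℝ (W t) ((potential n Λ lam t : ℂ) * W t) + inner ℝ (D t) (D t))) t :=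
    fun t => ((h.hasDerivAt t).inner ℝ (h.hasDerivAt_deriv t)).const_mul 2
  have dec := le_exp_of_second_deriv (T := T) (A := A ^ 2) hf hf' (fun t ht => by
      have h1 : inner ℝ (W t) ((potential n Λ lam t : ℂ) * W t)
          = potential n Λ lam t * ‖W t‖ ^ 2 := by
        rw [← Complex.real_smul, inner_smul_right, real_inner_self_eq_norm_sq]
      rw [h1, real_inner_self_eq_norm_sq]
      have h2 := (hT t ht).1
      nlinarith [sq_nonneg ‖D t‖, sq_nonneg ‖W t‖])
    (fun t ht => by
      rw [← mul_pow]
      exact pow_le_pow_left₀ (norm_nonneg _) (hA t (hT0.trans ht)) 2)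
  set C₁ := A * (1 + T) * Real.exp (2 * T) with hC₁
  have hC₁0 : 0 ≤ C₁ := by positivity
  have hW : ∀ t ≥ 0, ‖W t‖ ≤ C₁ * Real.exp (-2 * t) := by
    intro t ht
    rcases le_total T t with hTt | hTt
    · have h1 := dec t hTt
      have h2 : ‖W t‖ ^ 2 ≤ (C₁ * Real.exp (-2 * t)) ^ 2 := by
        refine h1.trans ?_
        have h3 : Real.exp (-4 * (t - T)) = (Real.exp (2 * T) * Real.exp (-2 * t)) ^ 2 := by
          rw [← Real.exp_add, ← Real.exp_nat_mul]
          congr 1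
          push_cast
          ring
        rw [h3, ← mul_pow, hC₁, mul_assoc]
        have := hA T hT0
        gcongr
      exact le_of_sq_le_sq h2 (by positivity)
    · have h2 : 1 ≤ Real.exp (2 * T) * Real.exp (-2 * t) := by
        rw [← Real.exp_add]
        exact Real.one_le_exp (by linarith)
      calc ‖W t‖ ≤ A * (1 + t) := hA t ht
        _ ≤ A * (1 + T) * 1 := by rw [mul_one]; gcongr
        _ ≤ A * (1 + T) * (Real.exp (2 * T) * Real.exp (-2 * t)) := by gcongr
        _ = _ := by rw [hC₁]; ring
  obtain ⟨P, hP0, hP⟩ := exists_abs_potential_le hn Λ lam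
  have hpW : ∀ t ≥ 0, ‖(potential n Λ lam t : ℂ) * W t‖ ≤ 4 * P * C₁ * Real.exp (-t) := by
    intro t ht
    rw [norm_mul, Complex.norm_real, Real.norm_eq_abs]
    have h3 : Real.exp t * Real.exp (-2 * t) = Real.exp (-t) := by
      rw [← Real.exp_add]; congr 1; ring
    calc _ ≤ P * (4 * Real.exp t) * (C₁ * Real.exp (-2 * t)) := by
          have h1 := hP t ht
          have h2 := one_add_sq_le_exp ht
          have h4 := hW t ht
          gcongr
          exact h1.trans (by gcongr)
      _ = 4 * P * C₁ * (Real.exp t * Real.exp (-2 * t)) := by ring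
      _ = _ := by rw [h3]
  have hD : ∀ t ≥ 0, ‖D t‖ ≤ (2 * C₁ + 4 * P * C₁) * Real.exp (-t) := by
    intro t ht
    -- compare `D t` with the difference quotient of `W` over `[t, t + 1]`
    have hDD : ∀ s ∈ Icc t (t + 1), ‖D s - D t‖ ≤ 4 * P * C₁ * Real.exp (-t) := by
      intro s hs
      have h1 := (convex_Icc t (t + 1)).norm_image_sub_le_of_norm_hasDerivWithin_le (f := D)
        (f' := fun s => (potential n Λ lam s : ℂ) * W s) (C := 4 * P * C₁ * Real.exp (-t))
        (fun r _ => (h.hasDerivAt_deriv r).hasDerivWithinAt)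
        (fun r hr => (hpW r (ht.le.trans hr.1)).trans (by gcongr; exact hr.1))
        (left_mem_Icc.mpr (by linarith)) hs
      refine h1.trans (mul_le_of_le_one_right (by positivity) ?_)
      rw [Real.norm_eq_abs, abs_le]
      constructor <;> linarith [hs.1, hs.2]
    have h2 := (convex_Icc t (t + 1)).norm_image_sub_le_of_norm_hasDerivWithin_le
        (f := fun s => W s - (s : ℂ) * D t)
        (f' := fun s => D s - 1 * D t) (C := 4 * P * C₁ * Real.exp (-t))
        (fun r _ => ((h.hasDerivAt r).sub
          ((hasDerivAt_id r).ofReal_comp.mul_const (D t))).hasDerivWithinAt)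
        (fun r hr => by simpa using hDD r hr)
        (left_mem_Icc.mpr (by linarith)) (right_mem_Icc.mpr (by linarith))
    have h3 : W (t + 1) - ((t + 1 : ℝ) : ℂ) * D t - (W t - (t : ℂ) * D t)
        = W (t + 1) - W t - D t := by push_cast; ring
    rw [h3] at h2
    simp only [add_sub_cancel_left, norm_one, mul_one] at h2
    have h4 := hW t ht
    have h5 := hW (t + 1) (by linarith)
    have h6 : Real.exp (-2 * t) ≤ Real.exp (-t) := Real.exp_le_exp.mpr (by linarith)
    have h7 : Real.exp (-2 * (t + 1)) ≤ Real.exp (-t) := Real.exp_le_exp.mpr (by linarith)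
    have h8 : ‖D t‖ ≤ ‖W (t + 1)‖ + ‖W t‖ + ‖W (t + 1) - W t - D t‖ := by
      have : D t = W (t + 1) - W t - (W (t + 1) - W t - D t) := by ring
      calc ‖D t‖ = ‖W (t + 1) - W t - (W (t + 1) - W t - D t)‖ := by rw [← this]
        _ ≤ _ := (norm_sub_le _ _).trans (by gcongr; exact norm_sub_le _ _)
    nlinarith
  refine ⟨2 * C₁ + 4 * P * C₁, by positivity, fun t ht => ⟨(hW t ht).trans ?_, hD t ht,
    (hpW t ht).trans ?_⟩⟩
  · gcongr
    nlinarith [mul_nonneg hP0 hC₁0]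
  · gcongr
    linarith

theorem tendsto_atTop (hn : 3 ≤ n) (hΛ : Λ < 0) (h : IsTemporalSolution n Λ lam W D) :
    Tendsto W atTop (𝓝 0) := by
  obtain ⟨C, -, hC⟩ := h.exists_norm_le_exp hn hΛ
  have h1 : Tendsto (fun t : ℝ => C * Real.exp (-2 * t)) atTop (𝓝 0) := by
    simpa using (Real.tendsto_exp_atBot.comp
      (tendsto_id.const_mul_atTop_of_neg (r := (-2 : ℝ)) (by norm_num))).const_mul C
  exact squeeze_zero_norm' ((eventually_ge_atTop 0).mono fun t ht => (hC t ht).1) h1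

theorem tendsto_zero (h : IsTemporalSolution n Λ lam W D) : Tendsto W (𝓝[>] 0) (𝓝 0) := by
  have := h.continuous.tendsto 0
  rw [h.map_zero] at this
  exact this.mono_left nhdsWithin_le_nhds

/-- Since `W` vanishes to first order at `0`, the third derivative is continuous there, although
the derivative of the potential may be unbounded. -/
theorem continuous_thirdDeriv (hn : 3 ≤ n) (hΛ : Λ < 0) (h : IsTemporalSolution n Λ lam W D) :
    Continuous (thirdDeriv n Λ lam W D) := by
  have ha := two_thirds_le_exponent hn
  have hmax : Continuous fun t : ℝ => max t 0 := continuous_id.max continuous_const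
  have hWm : Continuous fun t : ℝ => W (max t 0) := h.continuous.comp hmax
  have hV : Continuous fun t : ℝ =>
      ((max t 0 ^ (2 - 4 / (n : ℝ) - 1) : ℝ) : ℂ) * W (max t 0) := by
    rw [continuous_iff_continuousAt]
    intro t
    rcases eq_or_ne t 0 with rfl | ht
    · obtain ⟨C, hC0, hC⟩ := h.exists_norm_le_exp hn hΛ
      have hWC : ∀ s ≥ 0, ‖W s‖ ≤ C * s := by
        intro s hs
        have h1 := (convex_Icc 0 s).norm_image_sub_le_of_norm_hasDerivWithin_le (f := W)
          (f' := D) (C := C) (fun r _ => (h.hasDerivAt r).hasDerivWithinAt)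
          (fun r hr => (hC r hr.1).2.1.trans
            (mul_le_of_le_one_right hC0 (Real.exp_le_one_iff.mpr (by linarith [hr.1]))))
          (left_mem_Icc.mpr hs) (right_mem_Icc.mpr hs)
        simpa [h.map_zero, abs_of_nonneg hs] using h1
      have hb : ∀ t : ℝ, ‖((max t 0 ^ (2 - 4 / (n : ℝ) - 1) : ℝ) : ℂ) * W (max t 0)‖
          ≤ C * max t 0 ^ (2 - 4 / (n : ℝ)) := by
        intro t
        have hm : 0 ≤ max t 0 := le_max_right _ _
        rw [norm_mul, Complex.norm_real, Real.norm_eq_abs, abs_of_nonneg (Real.rpow_nonneg hm _)]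
        rcases hm.eq_or_lt with h0 | h0
        · rw [← h0, h.map_zero, norm_zero, mul_zero]
          positivity
        · calc _ ≤ max t 0 ^ (2 - 4 / (n : ℝ) - 1) * (C * max t 0) := by
                gcongr
                exact hWC _ hm
            _ = C * max t 0 ^ (2 - 4 / (n : ℝ)) := by
                rw [Real.rpow_sub_one h0.ne']
                field_simp
      have hlim : Tendsto (fun t : ℝ => C * max t 0 ^ (2 - 4 / (n : ℝ))) (𝓝 0) (𝓝 0) := by
        have h1 : Continuous fun t : ℝ => C * max t 0 ^ (2 - 4 / (n : ℝ)) :=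
          continuous_const.mul ((Real.continuous_rpow_const (by linarith)).comp hmax)
        have h2 := h1.tendsto 0
        rwa [max_self, Real.zero_rpow (by linarith), mul_zero] at h2
      rw [ContinuousAt, max_self, h.map_zero, mul_zero]
      exact squeeze_zero_norm hb hlim
    · rcases lt_or_gt_of_ne ht with ht | ht
      · refine continuousAt_const (y := (0 : ℂ)) |>.congr ?_
        filter_upwards [Iio_mem_nhds ht] with s hs
        rw [max_eq_right (le_of_lt hs), h.map_zero, mul_zero]
      · refine ContinuousAt.mul ?_ hWm.continuousAt
        refine Complex.continuous_ofReal.continuousAt.comp ?_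
        exact hmax.continuousAt.rpow_const (Or.inl (by rw [max_eq_left ht.le]; exact ht.ne'))
  have hp := continuous_potential (Λ := Λ) hn lam
  have hDc := h.continuous_deriv
  exact ((continuous_const.mul ((Complex.continuous_ofReal.comp hmax).mul hWm)).sub
    (continuous_const.mul hV)).add ((Complex.continuous_ofReal.comp hp).mul hDc)

/-- Off `0` this is the product rule; at `0` it follows because the derivative extends continuously
there. -/
theorem hasDerivAt_potential_mul (hn : 3 ≤ n) (hΛ : Λ < 0) (h : IsTemporalSolution n Λ lam W D)
    (t : ℝ) : HasDerivAt (fun t => (potential n Λ lam t : ℂ) * W t)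
      (thirdDeriv n Λ lam W D t) t := by
  have ha := two_thirds_le_exponent hn
  have hp := continuous_potential (Λ := Λ) hn lam
  have hWc := h.continuous
  have hne : ∀ t : ℝ, t ≠ 0 → HasDerivAt (fun t => (potential n Λ lam t : ℂ) * W t)
      (thirdDeriv n Λ lam W D t) t := by
    intro t ht
    rcases lt_or_gt_of_ne ht with ht | ht
    · have h1 : thirdDeriv n Λ lam W D t = 0 := by
        simp [thirdDeriv, max_eq_right ht.le, h.map_zero, potential_of_nonpos hn lam ht.le]
      rw [h1]
      refine (hasDerivAt_const t (0 : ℂ)).congr_of_eventuallyEq ?_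
      filter_upwards [Iio_mem_nhds ht] with s hs
      rw [potential_of_nonpos hn lam (le_of_lt hs)]
      simp
    · have h1 : HasDerivAt (potential n Λ lam)
          ((n * |Λ| * (2 * t) - lam * ((2 - 4 / (n : ℝ)) * t ^ (2 - 4 / (n : ℝ) - 1)))
            / waveCoeff n) t := by
        have h2 : HasDerivAt (fun t : ℝ => (n * |Λ| * t ^ 2 - lam * t ^ (2 - 4 / (n : ℝ)))
            / waveCoeff n)
            ((n * |Λ| * (2 * t) - lam * ((2 - 4 / (n : ℝ)) * t ^ (2 - 4 / (n : ℝ) - 1)))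
            / waveCoeff n) t := by
          have h3 := (((hasDerivAt_pow 2 t).const_mul (n * |Λ|)).sub
            ((Real.hasDerivAt_rpow_const (p := 2 - 4 / (n : ℝ)) (Or.inl ht.ne')).const_mul
              lam)).div_const (waveCoeff n)
          simpa using h3
        refine h2.congr_of_eventuallyEq ?_
        filter_upwards [Ioi_mem_nhds ht] with s hs
        simp only [potential, max_eq_left (le_of_lt (mem_Ioi.mp hs))]
      refine (h1.ofReal_comp.mul (h.hasDerivAt t)).congr_deriv ?_
      simp only [thirdDeriv, max_eq_left ht.le]
      push_cast
      ring
  rcases eq_or_ne t 0 with rfl | ht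
  · exact hasDerivAt_of_hasDerivAt_of_ne hne (by fun_prop)
      (h.continuous_thirdDeriv hn hΛ).continuousAt
  · exact hne t ht

theorem contDiff_three (hn : 3 ≤ n) (hΛ : Λ < 0) (h : IsTemporalSolution n Λ lam W D) :
    ContDiff ℝ 3 W := by
  have h0 : deriv (fun t => (potential n Λ lam t : ℂ) * W t) = thirdDeriv n Λ lam W D :=
    funext fun t => (h.hasDerivAt_potential_mul hn hΛ t).deriv
  have h1 : deriv D = fun t => (potential n Λ lam t : ℂ) * W t :=
    funext fun t => (h.hasDerivAt_deriv t).deriv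
  have h2 : deriv W = D := funext fun t => (h.hasDerivAt t).deriv
  have c1 : ContDiff ℝ 1 (fun t => (potential n Λ lam t : ℂ) * W t) := by
    rw [contDiff_one_iff_deriv, h0]
    exact ⟨fun t => (h.hasDerivAt_potential_mul hn hΛ t).differentiableAt,
      h.continuous_thirdDeriv hn hΛ⟩
  have c2 : ContDiff ℝ (1 + 1) D := by
    rw [contDiff_succ_iff_deriv, h1]
    exact ⟨fun t => (h.hasDerivAt_deriv t).differentiableAt, by simp, c1⟩
  have c3 : ContDiff ℝ (1 + 1 + 1) W := by
    rw [contDiff_succ_iff_deriv, h2]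
    exact ⟨fun t => (h.hasDerivAt t).differentiableAt, by simp, c2⟩
  exact c3.of_le (by norm_num)

theorem iteratedDeriv_two (h : IsTemporalSolution n Λ lam W D) :
    iteratedDeriv 2 W = fun t => (potential n Λ lam t : ℂ) * W t := by
  have h1 : deriv D = fun t => (potential n Λ lam t : ℂ) * W t :=
    funext fun t => (h.hasDerivAt_deriv t).deriv
  have h2 : deriv W = D := funext fun t => (h.hasDerivAt t).deriv
  rw [iteratedDeriv_succ, iteratedDeriv_one, h2, h1]

theorem exists_norm_iteratedDeriv_le (hn : 3 ≤ n) (hΛ : Λ < 0)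
    (h : IsTemporalSolution n Λ lam W D) :
    ∃ C : ℝ, 0 ≤ C ∧ ∀ k ≤ 3, ∀ t ≥ 0, ‖iteratedDeriv k W t‖ ≤ C := by
  have hc := waveCoeff_pos hn
  have ha := two_thirds_le_exponent hn
  obtain ⟨C, hC0, hC⟩ := h.exists_norm_le_exp hn hΛ
  obtain ⟨P, hP0, hP⟩ := exists_abs_potential_le hn Λ lam
  have h0 : iteratedDeriv 3 W = thirdDeriv n Λ lam W D := by
    rw [iteratedDeriv_succ, h.iteratedDeriv_two]
    exact funext fun t => (h.hasDerivAt_potential_mul hn hΛ t).deriv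
  have h2 : deriv W = D := funext fun t => (h.hasDerivAt t).deriv
  -- a bound of the third derivative on `[0, 1]` by compactness, on `[1, ∞)` by decay
  obtain ⟨C₃, hC₃⟩ := (isCompact_Icc (a := (0 : ℝ)) (b := 1)).exists_bound_of_continuousOn
    (h.continuous_thirdDeriv hn hΛ).continuousOn
  set C₄ := |2 * n * |Λ| / waveCoeff n| * (4 * C)
    + |lam * (2 - 4 / (n : ℝ)) / waveCoeff n| * (4 * C) + 4 * P * C with hC₄
  have hthird : ∀ t ≥ 1, ‖thirdDeriv n Λ lam W D t‖ ≤ C₄ := by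
    intro t ht
    have ht0 : 0 ≤ t := by linarith
    obtain ⟨b1, b2, -⟩ := hC t ht0
    have hWb : (1 + t) ^ 2 * ‖W t‖ ≤ 4 * C := by
      have h3 : Real.exp t * Real.exp (-2 * t) ≤ 1 := by
        rw [← Real.exp_add]; exact Real.exp_le_one_iff.mpr (by linarith)
      calc (1 + t) ^ 2 * ‖W t‖ ≤ (4 * Real.exp t) * (C * Real.exp (-2 * t)) := by
            have := one_add_sq_le_exp ht0
            gcongr
        _ = 4 * C * (Real.exp t * Real.exp (-2 * t)) := by ring
        _ ≤ 4 * C * 1 := by gcongr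
        _ = _ := mul_one _
    have hDb : (1 + t) ^ 2 * ‖D t‖ ≤ 4 * C := by
      have h3 : Real.exp t * Real.exp (-t) = 1 := by
        rw [← Real.exp_add]; simp
      calc (1 + t) ^ 2 * ‖D t‖ ≤ (4 * Real.exp t) * (C * Real.exp (-t)) := by
            have := one_add_sq_le_exp ht0
            gcongr
        _ = 4 * C * (Real.exp t * Real.exp (-t)) := by ring
        _ = _ := by rw [h3, mul_one]
    have e1 : t * ‖W t‖ ≤ 4 * C := le_trans (by gcongr; nlinarith) hWb
    have e2 : t ^ (2 - 4 / (n : ℝ) - 1) * ‖W t‖ ≤ 4 * C := by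
      refine le_trans ?_ hWb
      gcongr
      calc t ^ (2 - 4 / (n : ℝ) - 1) ≤ t ^ (2 : ℝ) :=
            Real.rpow_le_rpow_of_exponent_le ht (by linarith [exponent_lt_two hn])
        _ = t ^ 2 := Real.rpow_two t
        _ ≤ (1 + t) ^ 2 := by gcongr; linarith
    have e3 : |potential n Λ lam t| * ‖D t‖ ≤ 4 * P * C := by
      calc _ ≤ P * (1 + t) ^ 2 * ‖D t‖ := by gcongr; exact hP t ht0
        _ = P * ((1 + t) ^ 2 * ‖D t‖) := by ring
        _ ≤ P * (4 * C) := by gcongr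
        _ = _ := by ring
    unfold thirdDeriv
    rw [max_eq_left ht0, hC₄]
    refine (norm_add_le _ _).trans (add_le_add ((norm_sub_le _ _).trans (add_le_add ?_ ?_)) ?_)
    · rw [norm_mul, norm_mul, Complex.norm_real, Complex.norm_real, Real.norm_eq_abs,
        Real.norm_eq_abs, abs_of_nonneg ht0]
      gcongr
    · rw [norm_mul, norm_mul, Complex.norm_real, Complex.norm_real, Real.norm_eq_abs,
        Real.norm_eq_abs, abs_of_nonneg (Real.rpow_nonneg ht0 _)]
      gcongr
    · rw [norm_mul, Complex.norm_real, Real.norm_eq_abs]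
      exact e3
  have hexp1 : ∀ t ≥ (0 : ℝ), C * Real.exp (-t) ≤ C := fun t ht =>
    mul_le_of_le_one_right hC0 (Real.exp_le_one_iff.mpr (by linarith))
  refine ⟨max C (max C₃ C₄), le_max_of_le_left hC0, fun k hk t ht => ?_⟩
  obtain ⟨b1, b2, b3⟩ := hC t ht
  interval_cases k
  · rw [iteratedDeriv_zero]
    exact le_max_of_le_left (b1.trans
      (mul_le_of_le_one_right hC0 (Real.exp_le_one_iff.mpr (by linarith))))
  · rw [iteratedDeriv_one, h2]
    exact le_max_of_le_left (b2.trans (hexp1 t ht))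
  · rw [h.iteratedDeriv_two]
    exact le_max_of_le_left (b3.trans (hexp1 t ht))
  · rw [h0]
    rcases le_total t 1 with h1 | h1
    · exact le_max_of_le_right (le_max_of_le_left (hC₃ t ⟨ht, h1⟩))
    · exact le_max_of_le_right (le_max_of_le_right (hthird t h1))

/-- The potential is smooth for `t > 0`, so the differential equation improves the regularity step
by step. -/
theorem contDiffOn_Ioi (h : IsTemporalSolution n Λ lam W D) : ContDiffOn ℝ ∞ W (Ioi 0) := by
  have hp : ContDiffOn ℝ ∞ (fun t => (potential n Λ lam t : ℂ)) (Ioi 0) := by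
    have h1 : ContDiffOn ℝ ∞ (fun t : ℝ => (n * |Λ| * t ^ 2 - lam * t ^ (2 - 4 / (n : ℝ)))
        / waveCoeff n) (Ioi 0) := by
      refine ContDiffOn.div_const (ContDiffOn.sub (by fun_prop) ?_) _
      exact contDiffOn_const.mul (contDiffOn_id.rpow_const_of_ne fun t ht => ne_of_gt ht)
    have h2 : ContDiffOn ℝ ∞ (potential n Λ lam) (Ioi 0) :=
      h1.congr fun t ht => by simp only [potential, max_eq_left (le_of_lt (mem_Ioi.mp ht))]
    exact Complex.ofRealCLM.contDiff.comp_contDiffOn h2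
  have key : ∀ k : ℕ, ContDiffOn ℝ k W (Ioi 0) ∧ ContDiffOn ℝ k D (Ioi 0) := by
    intro k
    induction k with
    | zero =>
      exact ⟨contDiffOn_zero.mpr h.continuous.continuousOn,
        contDiffOn_zero.mpr h.continuous_deriv.continuousOn⟩
    | succ k ih =>
      push_cast
      rw [contDiffOn_succ_iff_deriv_of_isOpen isOpen_Ioi,
        contDiffOn_succ_iff_deriv_of_isOpen isOpen_Ioi]
      refine ⟨⟨fun t _ => (h.hasDerivAt t).differentiableAt.differentiableWithinAt, by simp,
        ih.2.congr fun t _ => (h.hasDerivAt t).deriv⟩,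
        ⟨fun t _ => (h.hasDerivAt_deriv t).differentiableAt.differentiableWithinAt, by simp,
        ((hp.of_le (by exact_mod_cast le_top)).mul ih.1).congr
          fun t _ => (h.hasDerivAt_deriv t).deriv⟩⟩
  exact contDiffOn_infty.mpr fun k => (key k).1

end IsTemporalSolution

end Temporal

/-! ### Positivity and unboundedness of the temporal eigenvalues -/

section Temporal

variable {n : ℕ} {Λ : ℝ}

theorem integrableOn_of_norm_le_exp {f : ℝ → ℂ} (hf : AEStronglyMeasurable f
    (volume.restrict (Ioi (0 : ℝ)))) {C : ℝ} (h : ∀ t > 0, ‖f t‖ ≤ C * Real.exp (-t)) :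
    IntegrableOn f (Ioi 0) := by
  refine Integrable.mono' ((integrableOn_exp_neg_Ioi 0).const_mul C) hf ?_
  filter_upwards [ae_restrict_mem measurableSet_Ioi] with t ht using h t ht

variable {lam lam' : ℝ} {W D W' D' : ℝ → ℂ}

theorem IsTemporalSolution.integrableOn_mul (hn : 3 ≤ n) (hΛ : Λ < 0)
    (h : IsTemporalSolution n Λ lam W D) (h' : IsTemporalSolution n Λ lam' W' D')
    {q : ℝ → ℝ} (hq : Continuous q) (hq' : ∀ t ≥ 0, |q t| ≤ (1 + t) ^ 2) :
    IntegrableOn (fun t => (q t : ℂ) * ((starRingEnd ℂ) (W t) * W' t)) (Ioi 0) := by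
  obtain ⟨C, hC0, hC⟩ := h.exists_norm_le_exp hn hΛ
  obtain ⟨C', hC0', hC'⟩ := h'.exists_norm_le_exp hn hΛ
  have c1 := h.continuous
  have c2 := h'.continuous
  refine integrableOn_of_norm_le_exp (C := 4 * C * C')
    (Continuous.aestronglyMeasurable (by fun_prop)) fun t ht => ?_
  rw [norm_mul, norm_mul, RCLike.norm_conj, Complex.norm_real, Real.norm_eq_abs]
  have e1 := (hq' t ht.le).trans (one_add_sq_le_exp ht.le)
  have e2 := (hC t ht.le).1
  have e3 : ‖W' t‖ ≤ C' * 1 := (hC' t ht.le).1.trans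
    (by gcongr; exact Real.exp_le_one_iff.mpr (by linarith))
  have e4 : Real.exp t * Real.exp (-2 * t) = Real.exp (-t) := by
    rw [← Real.exp_add]; congr 1; ring
  calc |q t| * (‖W t‖ * ‖W' t‖) ≤ 4 * Real.exp t * (C * Real.exp (-2 * t) * (C' * 1)) := by gcongr
    _ = 4 * C * C' * (Real.exp t * Real.exp (-2 * t)) := by ring
    _ = _ := by rw [e4]

theorem IsTemporalSolution.integrableOn_deriv_mul (hn : 3 ≤ n) (hΛ : Λ < 0)
    (h : IsTemporalSolution n Λ lam W D) (h' : IsTemporalSolution n Λ lam' W' D') :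
    IntegrableOn (fun t => (starRingEnd ℂ) (D t) * D' t) (Ioi 0) := by
  obtain ⟨C, hC0, hC⟩ := h.exists_norm_le_exp hn hΛ
  obtain ⟨C', hC0', hC'⟩ := h'.exists_norm_le_exp hn hΛ
  have c1 := h.continuous_deriv
  have c2 := h'.continuous_deriv
  refine integrableOn_of_norm_le_exp (C := C * C')
    (Continuous.aestronglyMeasurable (by fun_prop)) fun t ht => ?_
  rw [norm_mul, RCLike.norm_conj]
  have e2 := (hC t ht.le).2.1
  have e3 : ‖D' t‖ ≤ C' * 1 := (hC' t ht.le).2.1.trans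
    (by gcongr; exact Real.exp_le_one_iff.mpr (by linarith))
  calc ‖D t‖ * ‖D' t‖ ≤ C * Real.exp (-t) * (C' * 1) := by gcongr
    _ = _ := by ring

theorem continuous_rpow_max (hn : 3 ≤ n) : Continuous fun t : ℝ => max t 0 ^ (2 - 4 / (n : ℝ)) :=
  (Real.continuous_rpow_const (by linarith [two_thirds_le_exponent hn])).comp
    (continuous_id.max continuous_const)

theorem IsTemporalSolution.integrableOn_formK (hn : 3 ≤ n) (hΛ : Λ < 0)
    (h : IsTemporalSolution n Λ lam W D) (h' : IsTemporalSolution n Λ lam' W' D') :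
    IntegrableOn (fun t => ((t ^ (2 - 4 / (n : ℝ)) : ℝ) : ℂ) * ((starRingEnd ℂ) (W t) * W' t))
      (Ioi 0) := by
  refine (h.integrableOn_mul hn hΛ h' (continuous_rpow_max hn) fun t ht => ?_).congr_fun
    (fun t ht => ?_) measurableSet_Ioi
  · rw [max_eq_left ht, abs_of_nonneg (Real.rpow_nonneg ht _)]
    exact rpow_exponent_le hn ht
  · simp only [max_eq_left (le_of_lt (mem_Ioi.mp ht))]

theorem IsTemporalSolution.integrableOn_formB (hn : 3 ≤ n) (hΛ : Λ < 0)
    (h : IsTemporalSolution n Λ lam W D) (h' : IsTemporalSolution n Λ lam' W' D') :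
    IntegrableOn (fun t => ((waveCoeff n : ℝ) : ℂ) * ((starRingEnd ℂ) (D t) * D' t)
      + (((n : ℝ) * |Λ| * t ^ 2 : ℝ) : ℂ) * ((starRingEnd ℂ) (W t) * W' t)) (Ioi 0) := by
  refine ((h.integrableOn_deriv_mul hn hΛ h').const_mul _).add ?_
  have := (h.integrableOn_mul hn hΛ h' (q := fun t => t ^ 2) (by fun_prop) fun t ht => by
    rw [abs_of_nonneg (by positivity)]; nlinarith).const_mul (((n : ℝ) * |Λ| : ℝ) : ℂ)
  refine this.congr (Eventually.of_forall fun t => ?_)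
  push_cast
  ring

theorem conj_formB (w dw ψ dψ : ℝ → ℂ) :
    (starRingEnd ℂ) (formB n Λ w dw ψ dψ) = formB n Λ ψ dψ w dw := by
  unfold formB
  rw [← integral_conj]
  congr 1
  ext t
  simp only [map_add, map_mul, Complex.conj_conj, Complex.conj_ofReal]
  ring

theorem conj_formK (w ψ : ℝ → ℂ) : (starRingEnd ℂ) (formK n w ψ) = formK n ψ w := by
  unfold formK
  rw [← integral_conj]
  congr 1
  ext t
  simp only [map_mul, Complex.conj_conj, Complex.conj_ofReal]
  ring

theorem formB_self (w dw : ℝ → ℂ) :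
    formB n Λ w dw w dw = ((∫ t in Ioi (0 : ℝ), temporalDensity n Λ t (w t) (dw t) : ℝ) : ℂ) := by
  refine Eq.trans ?_ (integral_ofReal (𝕜 := ℂ))
  unfold formB
  congr 1
  ext t
  simp only [temporalDensity, Complex.conj_mul']
  push_cast
  rfl

theorem formK_self (w : ℝ → ℂ) :
    formK n w w = ((∫ t in Ioi (0 : ℝ), t ^ (2 - 4 / (n : ℝ)) * ‖w t‖ ^ 2 : ℝ) : ℂ) := by
  refine Eq.trans ?_ (integral_ofReal (𝕜 := ℂ))
  unfold formK
  congr 1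
  ext t
  simp only [Complex.conj_mul']
  push_cast
  rfl

theorem IsTemporalSolution.integrableOn_density (hn : 3 ≤ n) (hΛ : Λ < 0)
    (h : IsTemporalSolution n Λ lam W D) :
    IntegrableOn (fun t => temporalDensity n Λ t (W t) (D t)) (Ioi 0) := by
  have := (h.integrableOn_formB hn hΛ h).re
  refine this.congr (Eventually.of_forall fun t => ?_)
  simp only [temporalDensity, Complex.conj_mul']
  norm_cast

theorem IsTemporalSolution.integrableOn_weighted_sq (hn : 3 ≤ n) (hΛ : Λ < 0)
    (h : IsTemporalSolution n Λ lam W D) :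
    IntegrableOn (fun t => t ^ (2 - 4 / (n : ℝ)) * ‖W t‖ ^ 2) (Ioi 0) := by
  have := (h.integrableOn_formK hn hΛ h).re
  refine this.congr (Eventually.of_forall fun t => ?_)
  simp only [Complex.conj_mul']
  norm_cast

/-- The weak equation tested with the solution itself: `B(W, W) = λ K(W, W)`. -/
theorem IsTemporalSolution.density_eq (h : IsTemporalSolution n Λ lam W D) :
    ∫ t in Ioi (0 : ℝ), temporalDensity n Λ t (W t) (D t)
      = lam * ∫ t in Ioi (0 : ℝ), t ^ (2 - 4 / (n : ℝ)) * ‖W t‖ ^ 2 := by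
  have := h.weak W D h.mem
  rw [formB_self, formK_self] at this
  exact_mod_cast this

theorem integral_pos_of_continuousOn {f : ℝ → ℝ} (hf : ContinuousOn f (Ioi 0))
    (hi : IntegrableOn f (Ioi 0)) (h0 : ∀ t > 0, 0 ≤ f t) {t : ℝ} (ht : 0 < t) (hft : 0 < f t) :
    0 < ∫ t in Ioi (0 : ℝ), f t := by
  rw [setIntegral_pos_iff_support_of_nonneg_ae
    ((ae_restrict_mem measurableSet_Ioi).mono fun t ht => h0 t ht) hi]
  have hopen : IsOpen (Ioi (0 : ℝ) ∩ f ⁻¹' Ioi 0) := hf.isOpen_inter_preimage isOpen_Ioi isOpen_Ioi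
  refine (hopen.measure_pos volume ⟨t, ht, hft⟩).trans_le (measure_mono ?_)
  exact fun s hs => ⟨ne_of_gt hs.2, hs.1⟩

theorem IsTemporalSolution.density_pos (hn : 3 ≤ n) (hΛ : Λ < 0)
    (h : IsTemporalSolution n Λ lam W D) {t : ℝ} (ht : 0 < t) (hW : W t ≠ 0) :
    0 < ∫ t in Ioi (0 : ℝ), temporalDensity n Λ t (W t) (D t) := by
  have c1 := h.continuous
  have c2 := h.continuous_deriv
  refine integral_pos_of_continuousOn ?_ (h.integrableOn_density hn hΛ)
    (fun t _ => temporalDensity_nonneg hn t _ _) ht ?_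
  · unfold temporalDensity
    fun_prop
  · have hn0 : (0 : ℝ) < n := by exact_mod_cast (by omega : 0 < n)
    have hL : 0 < |Λ| := abs_pos.mpr hΛ.ne
    have hc := waveCoeff_pos hn
    have := norm_pos_iff.mpr hW
    unfold temporalDensity
    positivity

theorem IsTemporalSolution.weighted_sq_nonneg :
    0 ≤ ∫ t in Ioi (0 : ℝ), t ^ (2 - 4 / (n : ℝ)) * ‖W t‖ ^ 2 :=
  setIntegral_nonneg measurableSet_Ioi fun t ht =>
    mul_nonneg (Real.rpow_nonneg (le_of_lt ht) _) (by positivity)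

theorem IsTemporalSolution.eigenvalue_pos (hn : 3 ≤ n) (hΛ : Λ < 0)
    (h : IsTemporalSolution n Λ lam W D) {t : ℝ} (ht : 0 < t) (hW : W t ≠ 0) : 0 < lam := by
  have h1 := h.density_pos hn hΛ ht hW
  rw [h.density_eq] at h1
  exact pos_of_mul_pos_left h1 weighted_sq_nonneg

/-- Eigenfunctions for different eigenvalues are orthogonal. -/
theorem IsTemporalSolution.formB_eq_zero (h : IsTemporalSolution n Λ lam W D)
    (h' : IsTemporalSolution n Λ lam' W' D') (hne : lam ≠ lam') :
    formB n Λ W D W' D' = 0 := by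
  have h1 := h.weak W' D' h'.mem
  have h2 := congrArg (starRingEnd ℂ) (h'.weak W D h.mem)
  rw [conj_formB, map_mul, Complex.conj_ofReal, conj_formK] at h2
  rw [h1] at h2
  have h3 : ((lam : ℂ) - lam') * formK n W W' = 0 := by rw [sub_mul, h2, sub_self]
  have h4 : (lam : ℂ) - lam' ≠ 0 := by
    rw [sub_ne_zero]
    exact_mod_cast hne
  rw [h1, (mul_eq_zero.mp h3).resolve_left h4, mul_zero]

/-- The point evaluation at `x` of the functions in the energy space has squared norm at most
`x / c`, where `c` is the coefficient of `|w'|²`. For orthogonal functions with energies `bᵢ` this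
is a Bessel inequality: it follows from the bound for `u = ∑ᵢ conj (Wᵢ x) / bᵢ • Wᵢ`, whose value at
`x` and whose energy both equal the sum on the left. -/
theorem sum_sq_div_energy_le (hn : 3 ≤ n) (hΛ : Λ < 0) {lam : ℕ → ℝ}
    (hlam : Function.Injective lam) {W D : ℕ → ℝ → ℂ}
    (h : ∀ i, IsTemporalSolution n Λ (lam i) (W i) (D i)) {b : ℕ → ℝ}
    (hb : ∀ i, ∫ t in Ioi (0 : ℝ), temporalDensity n Λ t (W i t) (D i t) = b i)
    (hb0 : ∀ i, 0 < b i) (N : ℕ) {x : ℝ} (hx : 0 ≤ x) :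
    ∑ i ∈ Finset.range N, ‖W i x‖ ^ 2 / b i ≤ x / waveCoeff n := by
  have hc := waveCoeff_pos hn
  set S := ∑ i ∈ Finset.range N, ‖W i x‖ ^ 2 / b i with hS
  have hS0 : 0 ≤ S := Finset.sum_nonneg fun i _ => div_nonneg (by positivity) (hb0 i).le
  set c : ℕ → ℂ := fun i => (starRingEnd ℂ) (W i x) / b i with hcdef
  set u : ℝ → ℂ := fun t => ∑ i ∈ Finset.range N, c i * W i t with hu
  set du : ℝ → ℂ := fun t => ∑ i ∈ Finset.range N, c i * D i t with hdu
  have huc : Continuous u := continuous_finsetSum _ fun i _ =>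
    continuous_const.mul (h i).continuous
  have hduc : Continuous du := continuous_finsetSum _ fun i _ =>
    continuous_const.mul (h i).continuous_deriv
  have hud : ∀ t, HasDerivAt u (du t) t := fun t =>
    HasDerivAt.fun_sum fun i _ => ((h i).hasDerivAt t).const_mul (c i)
  have hux : u x = S := by
    rw [hu, hS]
    push_cast
    refine Finset.sum_congr rfl fun i _ => ?_
    rw [hcdef]
    simp only
    rw [div_mul_eq_mul_div, Complex.conj_mul']
  have hpt : ∀ t, ((waveCoeff n : ℝ) : ℂ) * ((starRingEnd ℂ) (du t) * du t)
      + (((n : ℝ) * |Λ| * t ^ 2 : ℝ) : ℂ) * ((starRingEnd ℂ) (u t) * u t)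
      = ∑ i ∈ Finset.range N, ∑ j ∈ Finset.range N, ((starRingEnd ℂ) (c i) * c j) *
        (((waveCoeff n : ℝ) : ℂ) * ((starRingEnd ℂ) (D i t) * D j t)
        + (((n : ℝ) * |Λ| * t ^ 2 : ℝ) : ℂ) * ((starRingEnd ℂ) (W i t) * W j t)) := by
    intro t
    simp only [hu, hdu, map_sum, map_mul, Finset.sum_mul_sum]
    rw [Finset.mul_sum, Finset.mul_sum, ← Finset.sum_add_distrib]
    refine Finset.sum_congr rfl fun i _ => ?_
    rw [Finset.mul_sum, Finset.mul_sum, ← Finset.sum_add_distrib]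
    refine Finset.sum_congr rfl fun j _ => ?_
    ring
  have hint : ∀ i j, IntegrableOn (fun t => ((starRingEnd ℂ) (c i) * c j) *
        (((waveCoeff n : ℝ) : ℂ) * ((starRingEnd ℂ) (D i t) * D j t)
        + (((n : ℝ) * |Λ| * t ^ 2 : ℝ) : ℂ) * ((starRingEnd ℂ) (W i t) * W j t))) (Ioi 0) :=
    fun i j => ((h i).integrableOn_formB hn hΛ (h j)).const_mul _
  have hform : formB n Λ u du u du = S := by
    have e1 : formB n Λ u du u du = ∑ i ∈ Finset.range N, ∑ j ∈ Finset.range N,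
        ((starRingEnd ℂ) (c i) * c j) * formB n Λ (W i) (D i) (W j) (D j) := by
      unfold formB
      simp only [hpt]
      rw [integral_finsetSum _ fun i _ => integrable_finsetSum _ fun j _ => hint i j]
      refine Finset.sum_congr rfl fun i _ => ?_
      rw [integral_finsetSum _ fun j _ => hint i j]
      exact Finset.sum_congr rfl fun j _ => integral_const_mul _ _
    rw [e1, hS]
    push_cast
    refine Finset.sum_congr rfl fun i hi => ?_
    rw [Finset.sum_eq_single_of_mem i hi fun j _ hj => by
      rw [(h i).formB_eq_zero (h j) fun he => hj (hlam he).symm, mul_zero]]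
    rw [formB_self, hb, hcdef]
    have hbi : (b i : ℂ) ≠ 0 := by exact_mod_cast (hb0 i).ne'
    simp only [map_div₀, Complex.conj_conj, Complex.conj_ofReal]
    field_simp
    rw [Complex.mul_conj']
  have hdens : IntegrableOn (fun t => temporalDensity n Λ t (u t) (du t)) (Ioi 0) := by
    have h1 : IntegrableOn (fun t => ((waveCoeff n : ℝ) : ℂ) * ((starRingEnd ℂ) (du t) * du t)
      + (((n : ℝ) * |Λ| * t ^ 2 : ℝ) : ℂ) * ((starRingEnd ℂ) (u t) * u t)) (Ioi 0) := by
      simp only [hpt]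
      exact integrable_finsetSum _ fun i _ => integrable_finsetSum _ fun j _ => hint i j
    refine h1.re.congr (Eventually.of_forall fun t => ?_)
    simp only [temporalDensity, Complex.conj_mul']
    norm_cast
  have hdensS : ∫ t in Ioi (0 : ℝ), temporalDensity n Λ t (u t) (du t) = S := by
    rw [formB_self] at hform
    exact_mod_cast hform
  have hlint : ∫⁻ t in Ioi (0 : ℝ), ENNReal.ofReal (‖du t‖ ^ 2)
      ≤ ENNReal.ofReal (S / waveCoeff n) := by
    refine (lintegral_sq_le_of_temporalDensity (Λ := Λ) hn u du).trans ?_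
    rw [← ofReal_integral_eq_lintegral_ofReal hdens
      (Eventually.of_forall fun t => temporalDensity_nonneg hn t _ _), hdensS,
      ← ENNReal.ofReal_mul (by positivity), inv_mul_eq_div]
  -- the choice `s = 1 / c` makes the energy term `S / 2`
  have h1 := (intervalIntegrable_and_norm_integral_le hduc.aestronglyMeasurable hlint
    (by positivity) (inv_pos.mpr hc) hx).2
  have hu0 : u 0 = 0 := by simp [hu, (h _).map_zero]
  rw [intervalIntegral.integral_eq_sub_of_hasDerivAt (fun s _ => hud s)
    (hduc.intervalIntegrable _ _), hu0, sub_zero, hux, Complex.norm_real, Real.norm_eq_abs,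
    abs_of_nonneg hS0] at h1
  have h2 : S / waveCoeff n / (2 * (waveCoeff n)⁻¹) = S / 2 := by field_simp
  rw [h2] at h1
  have h3 : (waveCoeff n)⁻¹ * x / 2 = x / waveCoeff n / 2 := by field_simp
  rw [h3] at h1
  linarith

/-- The eigenvalues are unbounded: if all were at most `L`, every eigenfunction of unit energy
would have weighted mass at least `1 / (2 L)` on a fixed interval `(0, T]`, since the energy
controls the mass beyond `T`; but the total mass there is finite by the Bessel inequality. -/
theorem exists_le_eigenvalue (hn : 3 ≤ n) (hΛ : Λ < 0) {lam : ℕ → ℝ}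
    (hlam : Function.Injective lam) {W D : ℕ → ℝ → ℂ}
    (h : ∀ i, IsTemporalSolution n Λ (lam i) (W i) (D i)) (hne : ∀ i, ∃ t > 0, W i t ≠ 0) (L : ℝ) :
    ∃ i, L ≤ lam i := by
  by_contra! hcon
  have hpos : ∀ i, 0 < lam i := fun i => by
    obtain ⟨t, ht, hWt⟩ := hne i
    exact (h i).eigenvalue_pos hn hΛ ht hWt
  have hL : 0 < L := (hpos 0).trans (hcon 0)
  have hc := waveCoeff_pos hn
  have hn0 : (0 : ℝ) < n := by exact_mod_cast (by omega : 0 < n)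
  have hΛ0 : 0 < |Λ| := abs_pos.mpr hΛ.ne
  set b : ℕ → ℝ := fun i => ∫ t in Ioi (0 : ℝ), temporalDensity n Λ t (W i t) (D i t) with hb
  have hb0 : ∀ i, 0 < b i := fun i => by
    obtain ⟨t, ht, hWt⟩ := hne i
    exact (h i).density_pos hn hΛ ht hWt
  -- beyond `T` the weight of `K` is at most `1 / (2 L)` times that of `B`
  obtain ⟨T, hT⟩ := (((tendsto_rpow_atTop (show 0 < 4 / (n : ℝ) by positivity)).eventually_ge_atTop
    (2 * L / (n * |Λ|))).and (eventually_ge_atTop 1)).exists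
  have hT0 : 0 < T := by linarith [hT.2]
  have hTa : 0 < T ^ (4 / (n : ℝ)) := Real.rpow_pos_of_pos hT0 _
  have hloc : ∀ i, IntegrableOn (fun t => t ^ (2 - 4 / (n : ℝ)) * ‖W i t‖ ^ 2) (Ioc 0 T) := fun i =>
    ((h i).integrableOn_weighted_sq hn hΛ).mono_set fun t ht => ht.1
  have hmass : ∀ i, 1 / (2 * L) ≤
      ∫ t in Ioc 0 T, t ^ (2 - 4 / (n : ℝ)) * (‖W i t‖ ^ 2 / b i) := by
    intro i
    have e1 : ∫ t in Ioi (0 : ℝ), t ^ (2 - 4 / (n : ℝ)) * ‖W i t‖ ^ 2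
        ≤ (∫ t in Ioc 0 T, t ^ (2 - 4 / (n : ℝ)) * ‖W i t‖ ^ 2) + (1 / (2 * L)) * b i := by
      have hsplit : Ioi (0 : ℝ) = Ioc 0 T ∪ Ioi T := (Ioc_union_Ioi_eq_Ioi hT0.le).symm
      have hIoi : Ioi T ⊆ Ioi (0 : ℝ) := Ioi_subset_Ioi hT0.le
      nth_rw 1 [hsplit]
      rw [setIntegral_union (Ioc_disjoint_Ioi le_rfl) measurableSet_Ioi
        (hloc i) (((h i).integrableOn_weighted_sq hn hΛ).mono_set hIoi)]
      refine add_le_add le_rfl ?_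
      calc ∫ t in Ioi T, t ^ (2 - 4 / (n : ℝ)) * ‖W i t‖ ^ 2
          ≤ ∫ t in Ioi T, 1 / (2 * L) * temporalDensity n Λ t (W i t) (D i t) := by
            refine setIntegral_mono_on (((h i).integrableOn_weighted_sq hn hΛ).mono_set hIoi)
              ((((h i).integrableOn_density hn hΛ).mono_set hIoi).const_mul _) measurableSet_Ioi
              fun t ht => ?_
            have ht0 : 0 < t := hT0.trans ht
            have f1 : t ^ (2 - 4 / (n : ℝ)) ≤ 1 / (2 * L) * (n * |Λ| * t ^ 2) := by
              rw [Real.rpow_sub ht0, Real.rpow_two, div_le_iff₀ (Real.rpow_pos_of_pos ht0 _)]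
              have f2 : T ^ (4 / (n : ℝ)) ≤ t ^ (4 / (n : ℝ)) :=
                Real.rpow_le_rpow hT0.le (le_of_lt ht) (by positivity)
              have f3 := hT.1.trans f2
              rw [div_le_iff₀ (by positivity)] at f3
              calc t ^ 2 = 1 / (2 * L) * t ^ 2 * (2 * L) := by field_simp
                _ ≤ 1 / (2 * L) * t ^ 2 * (t ^ (4 / (n : ℝ)) * (n * |Λ|)) := by gcongr
                _ = _ := by ring
            have f4 : 0 ≤ 1 / (2 * L) * (waveCoeff n * ‖D i t‖ ^ 2) := by positivity
            have f5 := mul_le_mul_of_nonneg_right f1 (sq_nonneg ‖W i t‖)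
            unfold temporalDensity
            linarith
        _ = 1 / (2 * L) * ∫ t in Ioi T, temporalDensity n Λ t (W i t) (D i t) :=
            integral_const_mul _ _
        _ ≤ 1 / (2 * L) * b i := by
            gcongr
            exact setIntegral_mono_set ((h i).integrableOn_density hn hΛ)
              (Eventually.of_forall fun t => temporalDensity_nonneg hn t _ _)
              (Eventually.of_forall hIoi)
    have e2 : b i / L ≤ ∫ t in Ioi (0 : ℝ), t ^ (2 - 4 / (n : ℝ)) * ‖W i t‖ ^ 2 := by
      rw [div_le_iff₀ hL, hb]
      simp only
      rw [(h i).density_eq, mul_comm]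
      exact mul_le_mul_of_nonneg_left (hcon i).le IsTemporalSolution.weighted_sq_nonneg
    have e3 : ∀ t, t ^ (2 - 4 / (n : ℝ)) * (‖W i t‖ ^ 2 / b i)
        = t ^ (2 - 4 / (n : ℝ)) * ‖W i t‖ ^ 2 / b i := fun t => by ring
    simp only [e3]
    rw [integral_div, le_div_iff₀ (hb0 i)]
    have e4 : b i / L = 1 / (2 * L) * b i + 1 / (2 * L) * b i := by field_simp; norm_num
    linarith
  -- by the Bessel inequality, the masses on `(0, T]` add up to at most `G`
  set G := ∫ t in Ioc 0 T, t ^ (2 - 4 / (n : ℝ)) * (t / waveCoeff n) with hG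
  have hbound : ∀ N : ℕ, N * (1 / (2 * L)) ≤ G := by
    intro N
    have hi : ∀ i, IntegrableOn (fun t => t ^ (2 - 4 / (n : ℝ)) * (‖W i t‖ ^ 2 / b i)) (Ioc 0 T) :=
      fun i => ((hloc i).div_const (b i)).congr (Eventually.of_forall fun t => by
        simp only; ring)
    calc N * (1 / (2 * L)) = ∑ i ∈ Finset.range N, 1 / (2 * L) := by simp
      _ ≤ ∑ i ∈ Finset.range N, ∫ t in Ioc 0 T, t ^ (2 - 4 / (n : ℝ)) * (‖W i t‖ ^ 2 / b i) :=
          Finset.sum_le_sum fun i _ => hmass i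
      _ = ∫ t in Ioc 0 T, ∑ i ∈ Finset.range N, t ^ (2 - 4 / (n : ℝ)) * (‖W i t‖ ^ 2 / b i) :=
          (integral_finsetSum _ fun i _ => hi i).symm
      _ ≤ G := by
          refine setIntegral_mono_on (integrable_finsetSum _ fun i _ => hi i) ?_ measurableSet_Ioc
            fun t ht => ?_
          · have : Continuous fun t : ℝ => max t 0 ^ (2 - 4 / (n : ℝ)) * (t / waveCoeff n) :=
              (continuous_rpow_max hn).mul (by fun_prop)
            refine IntegrableOn.congr_fun (this.integrableOn_Ioc) (fun t ht => ?_) measurableSet_Ioc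
            simp only [max_eq_left ht.1.le]
          · rw [← Finset.mul_sum]
            exact mul_le_mul_of_nonneg_left (sum_sq_div_energy_le hn hΛ hlam h (fun i => rfl) hb0 N
              ht.1.le) (Real.rpow_nonneg ht.1.le _)
  obtain ⟨N, hN⟩ := exists_nat_gt (G * (2 * L))
  have h1 := hbound N
  rw [mul_one_div, div_le_iff₀ (by positivity)] at h1
  linarith

end Temporal

/-! ### Metric coefficients in charts, and constant curvature -/

section Metric

variable {E : Type*} [NormedAddCommGroup E] [NormedSpace ℝ E]
  {H : Type*} [TopologicalSpace H] {I : ModelWithCorners ℝ E H} [I.Boundaryless]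
  {M : Type*} [TopologicalSpace M] [ChartedSpace H M] [IsManifold I ∞ M]
  (σ : Bundle.ContMDiffRiemannianMetric I ∞ E (fun x : M => TangentSpace I x))

/-- The coordinate fields `d(x⁻¹)(bᵢ)` are smooth sections of the tangent bundle over the chart
domain, and a smooth metric takes smooth sections to smooth functions. -/
theorem contDiffOn_chartMetric {ι : Type*} (b : Module.Basis ι ℝ E) (p₀ : M) (i j : ι) :
    ContDiffOn ℝ ∞ (fun y => chartMetric I b σ.inner p₀ y i j) (extChartAt I p₀).target := by
  have hopen := isOpen_extChartAt_target (I := I) p₀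
  have hsymm : ContMDiffOn 𝓘(ℝ, E) I ∞ (extChartAt I p₀).symm (extChartAt I p₀).target :=
    contMDiffOn_extChartAt_symm p₀
  have hv : ∀ k : ι, ContMDiffOn 𝓘(ℝ, E) (I.prod 𝓘(ℝ, E)) ∞
      (fun y => (Bundle.TotalSpace.mk' E ((extChartAt I p₀).symm y)
        (mfderiv 𝓘(ℝ, E) I (extChartAt I p₀).symm y (b k)) : TangentBundle I M))
      (extChartAt I p₀).target := by
    intro k
    have h1 := hsymm.contMDiffOn_tangentMapWithin (m := ∞) (by simp) hopen.uniqueMDiffOn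
    have h2 : ContMDiffOn 𝓘(ℝ, E) (𝓘(ℝ, E).prod 𝓘(ℝ, E)) ∞
        (fun y => (Bundle.TotalSpace.mk' E y (b k) : TangentBundle 𝓘(ℝ, E) E))
        (extChartAt I p₀).target :=
      contMDiffOn_vectorSpace_iff_contDiffOn.mpr contDiffOn_const
    have h3 := h1.comp h2 (fun y hy => hy)
    refine h3.congr fun y hy => ?_
    simp only [Function.comp_def, tangentMapWithin, Bundle.TotalSpace.mk']
    rw [mfderivWithin_of_isOpen hopen hy]
  have h4 : ContMDiffOn 𝓘(ℝ, E) (I.prod 𝓘(ℝ, ℝ)) ∞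
      (fun y => Bundle.TotalSpace.mk' ℝ (E := Bundle.Trivial M ℝ) ((extChartAt I p₀).symm y)
        (chartMetric I b σ.inner p₀ y i j)) (extChartAt I p₀).target :=
    ContMDiffOn.clm_bundle_apply₂ (F₁ := E) (F₂ := E)
      (σ.contMDiff.comp_contMDiffOn hsymm) (hv i) (hv j)
  intro y hy
  have h5 := h4 y hy
  simp only [Bundle.contMDiffWithinAt_totalSpace] at h5
  exact contMDiffWithinAt_iff_contDiffWithinAt.mp h5.2

variable {ι : Type*} [Fintype ι] (b : Module.Basis ι ℝ E)

theorem sum_left_of_add_of_smul {ι V : Type*} [AddCommGroup V] [Module ℝ V] (B : V → V → ℝ)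
    (hadd : ∀ u v w, B (u + v) w = B u w + B v w) (hsmul : ∀ (a : ℝ) v w, B (a • v) w = a * B v w)
    (s : Finset ι) (f : ι → V) (w : V) : B (∑ i ∈ s, f i) w = ∑ i ∈ s, B (f i) w := by
  classical
  induction s using Finset.induction_on with
  | empty => simpa using hsmul 0 0 w
  | insert a s ha ih => rw [Finset.sum_insert ha, Finset.sum_insert ha, hadd, ih]

/-- Gram matrices of linearly independent families are positive definite. The form is a function
together with its laws, so that forms on tangent spaces can also be read on the model space. -/
theorem posDef_of_inner {ι : Type*} [Fintype ι] {V : Type*} [AddCommGroup V] [Module ℝ V]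
    (B : V → V → ℝ)
    (hadd : ∀ u v w, B (u + v) w = B u w + B v w) (hsmul : ∀ (a : ℝ) v w, B (a • v) w = a * B v w)
    (hsymm : ∀ v w, B v w = B w v) (hpos : ∀ v, v ≠ 0 → 0 < B v v) {v : ι → V}
    (hv : LinearIndependent ℝ v) : (Matrix.of fun i j => B (v i) (v j)).PosDef := by
  have hsum := sum_left_of_add_of_smul (ι := ι) B hadd hsmul
  refine Matrix.PosDef.of_dotProduct_mulVec_pos ?_ fun x hx => ?_
  · ext i j
    simp [hsymm (v i) (v j)]
  · have h1 : star x ⬝ᵥ (Matrix.of fun i j => B (v i) (v j)).mulVec x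
        = B (∑ i, x i • v i) (∑ i, x i • v i) := by
      simp only [dotProduct, Matrix.mulVec, Matrix.of_apply, star_trivial, hsum, hsmul]
      refine Finset.sum_congr rfl fun i _ => ?_
      rw [hsymm, hsum]
      congr 1
      refine Finset.sum_congr rfl fun j _ => ?_
      rw [hsmul, hsymm, mul_comm]
    rw [h1]
    refine hpos _ fun h0 => hx ?_
    exact funext fun i => (Fintype.linearIndependent_iff.mp hv) x h0 i

theorem posDef_chartMetric (p₀ : M) {y : E} (hy : y ∈ (extChartAt I p₀).target) :
    (chartMetric I b σ.inner p₀ y).PosDef := by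
  have hinv := isInvertible_mfderivWithin_extChartAt_symm (I := I) hy
  rw [I.range_eq_univ, mfderivWithin_univ] at hinv
  obtain ⟨L, hL⟩ := hinv
  refine posDef_of_inner (fun v w => σ.inner ((extChartAt I p₀).symm y) v w)
    (fun u v w => by rw [map_add]; rfl) (fun a v w => by rw [map_smul]; rfl) (σ.symm _) (σ.pos _)
    (v := fun i => mfderiv 𝓘(ℝ, E) I (extChartAt I p₀).symm y (b i)) ?_
  rw [← hL]
  exact b.linearIndependent.map' L.toLinearEquiv.toLinearMap (LinearEquiv.ker _)

variable [DecidableEq ι]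

theorem contDiffOn_det {V : Type*} [NormedAddCommGroup V] [NormedSpace ℝ V] {U : Set V}
    {G : V → Matrix ι ι ℝ} (hG : ∀ i j, ContDiffOn ℝ ∞ (fun y => G y i j) U) :
    ContDiffOn ℝ ∞ (fun y => (G y).det) U := by
  simp only [Matrix.det_apply]
  refine ContDiffOn.sum fun τ _ => ContDiffOn.const_smul _ ?_
  exact contDiffOn_prod fun i _ => hG _ _

theorem contDiffOn_inv {V : Type*} [NormedAddCommGroup V] [NormedSpace ℝ V] {U : Set V}
    {G : V → Matrix ι ι ℝ} (hG : ∀ i j, ContDiffOn ℝ ∞ (fun y => G y i j) U)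
    (hdet : ∀ y ∈ U, (G y).det ≠ 0) (i j : ι) : ContDiffOn ℝ ∞ (fun y => (G y)⁻¹ i j) U := by
  have h1 : ∀ y, (G y)⁻¹ i j = ((G y).det)⁻¹ * ((G y).updateRow j (Pi.single i 1)).det := by
    intro y
    rw [Matrix.inv_def, Ring.inverse_eq_inv', Matrix.smul_apply, Matrix.adjugate_apply, smul_eq_mul]
  simp only [h1]
  refine (contDiffOn_det hG |>.inv hdet).mul (contDiffOn_det fun k l => ?_)
  by_cases hk : k = j
  · subst hk
    simp only [Matrix.updateRow_self]
    exact contDiffOn_const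
  · simp only [Matrix.updateRow_ne hk]
    exact hG k l

theorem contDiffOn_fderiv_apply {V F : Type*} [NormedAddCommGroup V] [NormedSpace ℝ V]
    [NormedAddCommGroup F] [NormedSpace ℝ F] {U : Set V} (hU : IsOpen U) {f : V → F}
    (hf : ContDiffOn ℝ ∞ f U) (v : V) : ContDiffOn ℝ ∞ (fun y => fderiv ℝ f y v) U :=
  (hf.fderiv_of_isOpen hU (by simp)).clm_apply contDiffOn_const

theorem contDiffOn_christoffel {U : Set E} (hU : IsOpen U)
    {G : E → Matrix ι ι ℝ} (hG : ∀ i j, ContDiffOn ℝ ∞ (fun y => G y i j) U)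
    (hdet : ∀ y ∈ U, (G y).det ≠ 0) (k i j : ι) : ContDiffOn ℝ ∞ (christoffel b G k i j) U := by
  unfold christoffel
  refine contDiffOn_const.mul (ContDiffOn.sum fun l _ => ?_)
  exact (contDiffOn_inv hG hdet k l).mul (((contDiffOn_fderiv_apply hU (hG j l) _).add
    (contDiffOn_fderiv_apply hU (hG i l) _)).sub (contDiffOn_fderiv_apply hU (hG i j) _))

end Metric

section ConstantCurvature

variable {E : Type*} [NormedAddCommGroup E] [NormedSpace ℝ E]
  {ι : Type*} [Fintype ι] [DecidableEq ι] (b : Module.Basis ι ℝ E)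

/-- The scalar curvature of a metric of constant sectional curvature `κ` is `κ d (d - 1)`. -/
theorem coordScalarCurvature_of_constantCurvature {G : E → Matrix ι ι ℝ} {y : E} {κ : ℝ}
    (hdet : (G y).det ≠ 0) (hsymm : ∀ i j, G y i j = G y j i)
    (h : ∀ l k i j : ι, ∑ m, G y l m * riemannTensor b G m k i j y
      = κ * (G y l i * G y k j - G y l j * G y k i)) :
    coordScalarCurvature b G y = κ * (Fintype.card ι * (Fintype.card ι - 1)) := by
  have hunit : IsUnit (G y).det := isUnit_iff_ne_zero.mpr hdet
  have hinv : ∀ i k, ∑ l, (G y)⁻¹ i l * G y l k = if i = k then 1 else 0 := by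
    intro i k
    rw [← Matrix.mul_apply, Matrix.nonsing_inv_mul _ hunit, Matrix.one_apply]
  have hR : ∀ m k i j, riemannTensor b G m k i j y
      = κ * ((if m = i then 1 else 0) * G y k j - (if m = j then 1 else 0) * G y k i) := by
    intro m k i j
    have h1 : ∑ l, (G y)⁻¹ m l * ∑ m', G y l m' * riemannTensor b G m' k i j y
        = riemannTensor b G m k i j y := by
      simp only [Finset.mul_sum, ← mul_assoc]
      rw [Finset.sum_comm]
      simp only [← Finset.sum_mul, hinv]
      simp
    rw [← h1]
    simp only [h]
    rw [← hinv m i, ← hinv m j, Finset.sum_mul, Finset.sum_mul, ← Finset.sum_sub_distrib,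
      Finset.mul_sum]
    exact Finset.sum_congr rfl fun l _ => by ring
  have hRic : ∀ k j, ∑ i, riemannTensor b G i k i j y = κ * (Fintype.card ι - 1) * G y k j := by
    intro k j
    simp only [hR, if_true, one_mul]
    rw [← Finset.mul_sum, Finset.sum_sub_distrib]
    simp
    ring
  unfold coordScalarCurvature
  simp only [hRic]
  have h2 : ∀ k, ∑ j, (G y)⁻¹ k j * (κ * (Fintype.card ι - 1) * G y k j)
      = κ * (Fintype.card ι - 1) := by
    intro k
    have := hinv k k
    rw [if_pos rfl] at this
    calc _ = κ * (Fintype.card ι - 1) * ∑ j, (G y)⁻¹ k j * G y j k := by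
          rw [Finset.mul_sum]
          exact Finset.sum_congr rfl fun j _ => by rw [hsymm k j]; ring
      _ = _ := by rw [this, mul_one]
  simp only [h2]
  simp
  ring

end ConstantCurvature

/-! ### The metric `dτ² + r² g` in coordinates -/

section Product

variable {E : Type*} [NormedAddCommGroup E] [NormedSpace ℝ E]
  {ι : Type*} (b : Module.Basis ι ℝ E)

/-- The directions of the product basis are `∂τ` and the coordinate directions of `E`; a function of
the second variable has no derivative in the former. -/
theorem fderiv_comp_snd {F : Type*} [NormedAddCommGroup F] [NormedSpace ℝ F] {f : E → F}
    {y : ℝ × E} (hf : DifferentiableAt ℝ f y.2) (i : Unit ⊕ ι) :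
    fderiv ℝ (fun w : ℝ × E => f w.2) y (((Module.Basis.singleton Unit ℝ).prod b) i)
      = Sum.elim (fun _ => 0) (fun k => fderiv ℝ f y.2 (b k)) i := by
  have h1 : HasFDerivAt (fun w : ℝ × E => f w.2)
      ((fderiv ℝ f y.2).comp (ContinuousLinearMap.snd ℝ ℝ E)) y :=
    hf.hasFDerivAt.comp y hasFDerivAt_snd
  rw [h1.fderiv]
  rcases i with i | i
  · simp [Module.Basis.prod_apply]
  · simp [Module.Basis.prod_apply]

theorem fderiv_mul_prod {f : ℝ → ℂ} {p : E → ℂ} {y : ℝ × E}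
    (hf : DifferentiableAt ℝ f y.1) (hp : DifferentiableAt ℝ p y.2) (i : Unit ⊕ ι) :
    fderiv ℝ (fun w : ℝ × E => f w.1 * p w.2) y (((Module.Basis.singleton Unit ℝ).prod b) i)
      = Sum.elim (fun _ => deriv f y.1 * p y.2) (fun k => f y.1 * fderiv ℝ p y.2 (b k)) i := by
  have h1 : HasFDerivAt (fun w : ℝ × E => f w.1)
      ((fderiv ℝ f y.1).comp (ContinuousLinearMap.fst ℝ ℝ E)) y :=
    hf.hasFDerivAt.comp y hasFDerivAt_fst
  have h2 : HasFDerivAt (fun w : ℝ × E => p w.2)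
      ((fderiv ℝ p y.2).comp (ContinuousLinearMap.snd ℝ ℝ E)) y :=
    hp.hasFDerivAt.comp y hasFDerivAt_snd
  rw [(h1.fun_mul h2).fderiv]
  rcases i with i | i
  · simp [Module.Basis.prod_apply, mul_comm]
  · simp [Module.Basis.prod_apply]

variable [Fintype ι] [DecidableEq ι]

/-- The coefficients of `dτ² + r² g`. -/
def warpedBlock (r : ℝ) (A : Matrix ι ι ℝ) : Matrix (Unit ⊕ ι) (Unit ⊕ ι) ℝ :=
  Matrix.fromBlocks 1 0 0 (r ^ 2 • A)

theorem inv_warpedBlock {r : ℝ} (hr : r ≠ 0) {A : Matrix ι ι ℝ} (hA : A.det ≠ 0) :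
    (warpedBlock r A)⁻¹ = Matrix.fromBlocks 1 0 0 ((r ^ 2)⁻¹ • A⁻¹) := by
  refine Matrix.inv_eq_right_inv ?_
  have hr2 : r ^ 2 ≠ 0 := pow_ne_zero 2 hr
  rw [warpedBlock, Matrix.fromBlocks_multiply]
  simp [Matrix.mul_nonsing_inv A (isUnit_iff_ne_zero.mpr hA), smul_smul, hr2]

/-- The Christoffel symbols of `dτ² + r² g` in terms of those of `g`. -/
def warpedChristoffel (G : E → Matrix ι ι ℝ) : Unit ⊕ ι → Unit ⊕ ι → Unit ⊕ ι → E → ℝ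
  | Sum.inr k, Sum.inr i, Sum.inr j => christoffel b G k i j
  | _, _, _ => fun _ => 0

/-- The curvature tensor of `dτ² + r² g` in terms of that of `g`. -/
def warpedRiemann (G : E → Matrix ι ι ℝ) :
    Unit ⊕ ι → Unit ⊕ ι → Unit ⊕ ι → Unit ⊕ ι → E → ℝ
  | Sum.inr l, Sum.inr k, Sum.inr i, Sum.inr j => riemannTensor b G l k i j
  | _, _, _, _ => fun _ => 0

variable {G : E → Matrix ι ι ℝ} {U : Set E} {r : ℝ}
  {G' : ℝ × E → Matrix (Unit ⊕ ι) (Unit ⊕ ι) ℝ}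

/-- The coefficients of `dτ² + r² g` do not depend on `τ` and have no mixed terms, and the factor
`r²` cancels between the inverse metric and the derivatives of the metric. -/
theorem christoffel_warped (hU : IsOpen U) (hG : ∀ i j, ContDiffOn ℝ ∞ (fun y => G y i j) U)
    (hdet : ∀ y ∈ U, (G y).det ≠ 0) (hr : r ≠ 0)
    (hG' : ∀ y : ℝ × E, y.2 ∈ U → G' y = warpedBlock r (G y.2)) {y : ℝ × E} (hy : y.2 ∈ U)
    (k i j : Unit ⊕ ι) :
    christoffel ((Module.Basis.singleton Unit ℝ).prod b) G' k i j y
      = warpedChristoffel b G k i j y.2 := by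
  have hr2 : r ^ 2 ≠ 0 := pow_ne_zero 2 hr
  have hev : ∀ᶠ w : ℝ × E in 𝓝 y, w.2 ∈ U := continuousAt_snd.eventually_mem (hU.mem_nhds hy)
  have hd : ∀ i j, DifferentiableAt ℝ (fun z => G z i j) y.2 := fun i j =>
    ((hG i j).contDiffAt (hU.mem_nhds hy)).differentiableAt (by simp)
  have hdw : ∀ i j, DifferentiableAt ℝ (fun z => warpedBlock r (G z) i j) y.2 := by
    intro i j
    rcases i with i | i <;> rcases j with j | j
    all_goals simp only [warpedBlock, Matrix.fromBlocks_apply₁₁, Matrix.fromBlocks_apply₁₂,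
      Matrix.fromBlocks_apply₂₁, Matrix.fromBlocks_apply₂₂, Matrix.smul_apply, Matrix.zero_apply]
    · fun_prop
    · fun_prop
    · fun_prop
    · exact (hd i j).const_smul (r ^ 2)
  have hder : ∀ i j l, fderiv ℝ (fun w => G' w j l) y (((Module.Basis.singleton Unit ℝ).prod b) i)
      = Sum.elim (fun _ => 0)
        (fun k => fderiv ℝ (fun z => warpedBlock r (G z) j l) y.2 (b k)) i := by
    intro i j l
    rw [← fderiv_comp_snd b (hdw j l)]
    congr 1
    refine Filter.EventuallyEq.fderiv_eq ?_
    filter_upwards [hev] with w hw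
    rw [hG' w hw]
  have hsm : ∀ i j k, fderiv ℝ (fun z => r ^ 2 * G z i j) y.2 (b k)
      = r ^ 2 * fderiv ℝ (fun z => G z i j) y.2 (b k) := by
    intro i j k
    rw [fderiv_const_mul (hd i j)]
    rfl
  unfold christoffel
  simp only [hder, hG' y hy, inv_warpedBlock hr (hdet _ hy), Fintype.sum_sum_type]
  rcases k with k | k <;> rcases i with i | i <;> rcases j with j | j <;>
    simp [warpedBlock, warpedChristoffel, hsm, christoffel]
  refine Finset.sum_congr rfl fun l _ => ?_
  field_simp

theorem riemannTensor_warped (hU : IsOpen U) (hG : ∀ i j, ContDiffOn ℝ ∞ (fun y => G y i j) U)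
    (hdet : ∀ y ∈ U, (G y).det ≠ 0) (hr : r ≠ 0)
    (hG' : ∀ y : ℝ × E, y.2 ∈ U → G' y = warpedBlock r (G y.2)) {y : ℝ × E} (hy : y.2 ∈ U)
    (l k i j : Unit ⊕ ι) :
    riemannTensor ((Module.Basis.singleton Unit ℝ).prod b) G' l k i j y
      = warpedRiemann b G l k i j y.2 := by
  have hev : ∀ᶠ w : ℝ × E in 𝓝 y, w.2 ∈ U := continuousAt_snd.eventually_mem (hU.mem_nhds hy)
  have hd : ∀ k i j, DifferentiableAt ℝ (warpedChristoffel b G k i j) y.2 := by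
    intro k i j
    rcases k with k | k <;> rcases i with i | i <;> rcases j with j | j
    all_goals simp only [warpedChristoffel]
    case inr.inr.inr =>
      exact ((contDiffOn_christoffel b hU hG hdet k i j).contDiffAt
        (hU.mem_nhds hy)).differentiableAt (by simp)
    all_goals fun_prop
  have hder : ∀ l j k i, fderiv ℝ (christoffel ((Module.Basis.singleton Unit ℝ).prod b) G' l j k) y
      (((Module.Basis.singleton Unit ℝ).prod b) i)
      = Sum.elim (fun _ => 0) (fun m => fderiv ℝ (warpedChristoffel b G l j k) y.2 (b m)) i := by
    intro l j k i
    rw [← fderiv_comp_snd b (hd l j k)]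
    congr 1
    refine Filter.EventuallyEq.fderiv_eq ?_
    filter_upwards [hev] with w hw
    exact christoffel_warped b hU hG hdet hr hG' hw l j k
  unfold riemannTensor
  simp only [hder, christoffel_warped b hU hG hdet hr hG' hy, Fintype.sum_sum_type]
  rcases l with l | l <;> rcases k with k | k <;> rcases i with i | i <;> rcases j with j | j <;>
    simp [warpedRiemann, warpedChristoffel, riemannTensor]

theorem coordScalarCurvature_warped (hU : IsOpen U)
    (hG : ∀ i j, ContDiffOn ℝ ∞ (fun y => G y i j) U)
    (hdet : ∀ y ∈ U, (G y).det ≠ 0) (hr : r ≠ 0)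
    (hG' : ∀ y : ℝ × E, y.2 ∈ U → G' y = warpedBlock r (G y.2)) {y : ℝ × E} (hy : y.2 ∈ U) :
    coordScalarCurvature ((Module.Basis.singleton Unit ℝ).prod b) G' y
      = (r ^ 2)⁻¹ * coordScalarCurvature b G y.2 := by
  unfold coordScalarCurvature
  simp only [riemannTensor_warped b hU hG hdet hr hG' hy, hG' y hy, inv_warpedBlock hr (hdet _ hy),
    Fintype.sum_sum_type]
  simp [warpedRiemann, Finset.mul_sum, mul_assoc]

/-- The Laplacian of `dτ² + r² g` on products is `∂τ² + r⁻² Δ`. -/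
theorem coordLaplacian_warped (hU : IsOpen U) (hG : ∀ i j, ContDiffOn ℝ ∞ (fun y => G y i j) U)
    (hdet : ∀ y ∈ U, (G y).det ≠ 0) (hr : r ≠ 0)
    (hG' : ∀ y : ℝ × E, y.2 ∈ U → G' y = warpedBlock r (G y.2)) {y : ℝ × E} (hy : y.2 ∈ U)
    {f : ℝ → ℂ} (hf : ContDiff ℝ ∞ f) {p : E → ℂ} (hp : ContDiffOn ℝ ∞ p U) :
    coordLaplacian ((Module.Basis.singleton Unit ℝ).prod b) G' (fun w => f w.1 * p w.2) y
      = iteratedDeriv 2 f y.1 * p y.2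
        + (((r ^ 2)⁻¹ : ℝ) : ℂ) * (f y.1 * coordLaplacian b G p y.2) := by
  have hev : ∀ᶠ w : ℝ × E in 𝓝 y, w.2 ∈ U := continuousAt_snd.eventually_mem (hU.mem_nhds hy)
  have hfd : Differentiable ℝ f := hf.differentiable (by simp)
  have hfd' : Differentiable ℝ (deriv f) :=
    ((contDiff_infty_iff_deriv.mp hf).2).differentiable (by simp)
  have hpd : ∀ z ∈ U, DifferentiableAt ℝ p z := fun z hz =>
    (hp.contDiffAt (hU.mem_nhds hz)).differentiableAt (by simp)
  have hpd' : ∀ v, DifferentiableAt ℝ (fun z => fderiv ℝ p z v) y.2 := fun v =>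
    ((contDiffOn_fderiv_apply hU hp v).contDiffAt (hU.mem_nhds hy)).differentiableAt (by simp)
  have h2 : ∀ i j, fderiv ℝ (fun w => fderiv ℝ (fun w : ℝ × E => f w.1 * p w.2) w
        (((Module.Basis.singleton Unit ℝ).prod b) j)) y (((Module.Basis.singleton Unit ℝ).prod b) i)
      = Sum.elim
        (fun _ => Sum.elim (fun _ => iteratedDeriv 2 f y.1 * p y.2)
          (fun k => deriv f y.1 * fderiv ℝ p y.2 (b k)) i)
        (fun m => Sum.elim (fun _ => deriv f y.1 * fderiv ℝ p y.2 (b m))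
          (fun k => f y.1 * fderiv ℝ (fun z => fderiv ℝ p z (b m)) y.2 (b k)) i) j := by
    intro i j
    have h3 : (fun w => fderiv ℝ (fun w : ℝ × E => f w.1 * p w.2) w
        (((Module.Basis.singleton Unit ℝ).prod b) j)) =ᶠ[𝓝 y]
        fun w => Sum.elim (fun _ => deriv f w.1 * p w.2)
          (fun k => f w.1 * fderiv ℝ p w.2 (b k)) j := by
      filter_upwards [hev] with w hw
      exact fderiv_mul_prod b (hfd _) (hpd _ hw) j
    rw [h3.fderiv_eq]
    rcases j with j | j
    · simp only [Sum.elim_inl]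
      rw [fderiv_mul_prod b (hfd' _) (hpd _ hy) i, iteratedDeriv_succ, iteratedDeriv_one]
    · simp only [Sum.elim_inr]
      rw [fderiv_mul_prod b (hfd _) (hpd' (b j)) i]
  unfold coordLaplacian
  simp only [h2, fderiv_mul_prod b (hfd _) (hpd _ hy), christoffel_warped b hU hG hdet hr hG' hy,
    hG' y hy, inv_warpedBlock hr (hdet _ hy), Fintype.sum_sum_type]
  simp [warpedChristoffel, Finset.mul_sum]
  refine Finset.sum_congr rfl fun i _ => Finset.sum_congr rfl fun j _ => ?_
  rw [mul_assoc]
  congr 1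
  rw [mul_left_comm]
  congr 1
  rw [mul_sub, Finset.mul_sum]
  congr 1
  exact Finset.sum_congr rfl fun k _ => by ring

end Product

/-! ### Charts, curvature and Laplacian of the cylinder `ℝ × M` -/

section Cylinder

variable {d : ℕ} {M : Type*} [TopologicalSpace M] [ChartedSpace (EuclideanSpace ℝ (Fin d)) M]

theorem extChartAt_cylinder_symm (p₀ : ℝ × M) (y : ℝ × EuclideanSpace ℝ (Fin d)) :
    (extChartAt (prodModel d) p₀).symm y = (y.1, (extChartAt (𝓡 d) p₀.2).symm y.2) := by
  rw [extChartAt_prod]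
  simp [chartAt_self_eq]

theorem mem_extChartAt_cylinder_target {p₀ : ℝ × M} {y : ℝ × EuclideanSpace ℝ (Fin d)} :
    y ∈ (extChartAt (prodModel d) p₀).target ↔ y.2 ∈ (extChartAt (𝓡 d) p₀.2).target := by
  rw [extChartAt_prod]
  simp [chartAt_self_eq]

theorem cylinderMetric_apply (r : ℝ) (σ : MetricField (𝓡 d) M) (p : ℝ × M)
    (v w : ℝ × EuclideanSpace ℝ (Fin d)) :
    cylinderMetric d r σ p v w = v.1 * w.1
      + r ^ 2 * (σ p.2 : EuclideanSpace ℝ (Fin d) →L[ℝ] EuclideanSpace ℝ (Fin d) →L[ℝ] ℝ) v.2 w.2 :=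
  rfl

variable [IsManifold (𝓡 d) ∞ M]

theorem mfderiv_extChartAt_cylinder_symm {p₀ : ℝ × M} {y : ℝ × EuclideanSpace ℝ (Fin d)}
    (hy : y.2 ∈ (extChartAt (𝓡 d) p₀.2).target) (v : ℝ × EuclideanSpace ℝ (Fin d)) :
    (mfderiv 𝓘(ℝ, ℝ × EuclideanSpace ℝ (Fin d)) (prodModel d) (extChartAt (prodModel d) p₀).symm y v
        : ℝ × EuclideanSpace ℝ (Fin d))
      = (v.1, mfderiv (𝓡 d) (𝓡 d) (extChartAt (𝓡 d) p₀.2).symm y.2 v.2) := by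
  have h1 : ((extChartAt (prodModel d) p₀).symm : ℝ × EuclideanSpace ℝ (Fin d) → ℝ × M)
      = Prod.map id (extChartAt (𝓡 d) p₀.2).symm := funext fun z => extChartAt_cylinder_symm p₀ z
  have h2 : MDifferentiableAt (𝓡 d) (𝓡 d) (extChartAt (𝓡 d) p₀.2).symm y.2 :=
    ((contMDiffOn_extChartAt_symm (n := ∞) p₀.2).contMDiffAt
      ((isOpen_extChartAt_target p₀.2).mem_nhds hy)).mdifferentiableAt (by simp)
  rw [h1, modelWithCornersSelf_prod, ← chartedSpaceSelf_prod]
  rw [mfderiv_prodMap (mdifferentiableAt_id) h2, mfderiv_id]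
  rfl

theorem chartMetric_cylinder (r : ℝ) (σ : MetricField (𝓡 d) M) {p₀ : ℝ × M}
    {y : ℝ × EuclideanSpace ℝ (Fin d)} (hy : y.2 ∈ (extChartAt (𝓡 d) p₀.2).target) :
    chartMetric (prodModel d) (prodBasis d) (cylinderMetric d r σ) p₀ y
      = warpedBlock r (chartMetric (𝓡 d) (stdBasis d) σ p₀.2 y.2) := by
  have e0 : ∀ i, (prodBasis d) (Sum.inl i) = (1, 0) := fun i => by
    simp [Module.Basis.prod_apply]
  have e1 : ∀ i, (prodBasis d) (Sum.inr i) = (0, stdBasis d i) := fun i => by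
    simp [Module.Basis.prod_apply]
  -- the computation for a fixed bilinear form on the model space, free of tangent space coercions
  have key : ∀ (B : EuclideanSpace ℝ (Fin d) →L[ℝ] EuclideanSpace ℝ (Fin d) →L[ℝ] ℝ)
      (L : EuclideanSpace ℝ (Fin d) →L[ℝ] EuclideanSpace ℝ (Fin d)) (i j : Unit ⊕ Fin d),
      (prodBasis d i).1 * (prodBasis d j).1 + r ^ 2 * B (L (prodBasis d i).2) (L (prodBasis d j).2)
        = warpedBlock r (Matrix.of fun i j => B (L (stdBasis d i)) (L (stdBasis d j))) i j := by
    intro B L i j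
    rcases i with i | i <;> rcases j with j | j
    · simp only [e0, map_zero, warpedBlock, Matrix.fromBlocks_apply₁₁]
      simp
    · simp only [e0, e1, map_zero, warpedBlock, Matrix.fromBlocks_apply₁₂]
      simp
    · simp only [e0, e1, map_zero, warpedBlock, Matrix.fromBlocks_apply₂₁]
      simp
    · simp only [e1, warpedBlock, Matrix.fromBlocks_apply₂₂]
      simp
  ext i j
  simp only [chartMetric, Matrix.of_apply]
  rw [mfderiv_extChartAt_cylinder_symm hy, mfderiv_extChartAt_cylinder_symm hy,
    extChartAt_cylinder_symm]
  exact (cylinderMetric_apply r σ _ _ _).trans (key _ _ i j)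

variable (σ : Bundle.ContMDiffRiemannianMetric (𝓡 d) ∞ (EuclideanSpace ℝ (Fin d))
      (fun x : M => TangentSpace (𝓡 d) x))

theorem chartScalarCurvature_cylinder {κ r : ℝ} (hr : r ≠ 0)
    (hσ : HasConstantCurvature (𝓡 d) (stdBasis d) σ.inner κ) {p₀ : ℝ × M}
    {y : ℝ × EuclideanSpace ℝ (Fin d)} (hy : y.2 ∈ (extChartAt (𝓡 d) p₀.2).target) :
    chartScalarCurvature (prodModel d) (prodBasis d) (cylinderMetric d r σ.inner) p₀ y
      = (r ^ 2)⁻¹ * (κ * (d * (d - 1))) := by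
  unfold chartScalarCurvature
  rw [coordScalarCurvature_warped (stdBasis d) (isOpen_extChartAt_target (I := 𝓡 d) p₀.2)
    (fun i j => contDiffOn_chartMetric σ (stdBasis d) p₀.2 i j)
    (fun z hz => (posDef_chartMetric σ (stdBasis d) p₀.2 hz).det_pos.ne') hr
    (fun z hz => chartMetric_cylinder r σ.inner hz) hy]
  have hpos := posDef_chartMetric σ (stdBasis d) p₀.2 hy
  rw [coordScalarCurvature_of_constantCurvature (stdBasis d) hpos.det_pos.ne'
    (fun i j => by simpa using (hpos.isHermitian.apply i j).symm) (hσ p₀.2 y.2 hy)]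
  simp

/-- The scalar curvature of `dτ² + r² σ` is that of `r² σ`, the first factor being flat. -/
theorem scalarCurvature_cylinder {κ r : ℝ} (hr : r ≠ 0)
    (hσ : HasConstantCurvature (𝓡 d) (stdBasis d) σ.inner κ) (p : ℝ × M) :
    scalarCurvature (prodModel d) (prodBasis d) (cylinderMetric d r σ.inner) p
      = (r ^ 2)⁻¹ * (κ * (d * (d - 1))) := by
  refine chartScalarCurvature_cylinder σ hr hσ ?_
  rw [← mem_extChartAt_cylinder_target]
  exact mem_extChartAt_target p

theorem contDiffOn_comp_extChartAt_symm {φ : M → ℂ} (hφ : ContMDiff (𝓡 d) 𝓘(ℝ, ℂ) ∞ φ) (x₀ : M) :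
    ContDiffOn ℝ ∞ (fun z => φ ((extChartAt (𝓡 d) x₀).symm z)) (extChartAt (𝓡 d) x₀).target :=
  (hφ.comp_contMDiffOn (contMDiffOn_extChartAt_symm x₀)).contDiffOn

theorem chartLaplacian_cylinder {r : ℝ} (hr : r ≠ 0) {f : ℝ → ℂ} (hf : ContDiff ℝ ∞ f)
    {φ : M → ℂ} {μ : ℝ} (hφ : IsLaplaceEigenpair (𝓡 d) (stdBasis d) σ.inner φ μ) {p₀ : ℝ × M}
    {y : ℝ × EuclideanSpace ℝ (Fin d)} (hy : y.2 ∈ (extChartAt (𝓡 d) p₀.2).target) :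
    chartLaplacian (prodModel d) (prodBasis d) (cylinderMetric d r σ.inner) p₀
        (fun p => f p.1 * φ p.2) y
      = (iteratedDeriv 2 f y.1 - (((r ^ 2)⁻¹ * μ : ℝ) : ℂ) * f y.1)
        * φ ((extChartAt (𝓡 d) p₀.2).symm y.2) := by
  unfold chartLaplacian
  have h1 : (fun z : ℝ × EuclideanSpace ℝ (Fin d) =>
      f ((extChartAt (prodModel d) p₀).symm z).1 * φ ((extChartAt (prodModel d) p₀).symm z).2)
      = fun z => f z.1 * (fun z => φ ((extChartAt (𝓡 d) p₀.2).symm z)) z.2 := by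
    funext z
    rw [extChartAt_cylinder_symm]
  rw [h1, coordLaplacian_warped (stdBasis d) (isOpen_extChartAt_target (I := 𝓡 d) p₀.2)
    (fun i j => contDiffOn_chartMetric σ (stdBasis d) p₀.2 i j)
    (fun z hz => (posDef_chartMetric σ (stdBasis d) p₀.2 hz).det_pos.ne') hr
    (fun z hz => chartMetric_cylinder r σ.inner hz) hy hf
    (contDiffOn_comp_extChartAt_symm hφ.1 p₀.2)]
  have h2 := hφ.2.2 p₀.2 y.2 hy
  unfold chartLaplacian at h2
  rw [neg_eq_iff_eq_neg] at h2
  rw [h2]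
  push_cast
  ring

end Cylinder

/-! ### The wave equation for products, and the oscillators `ζ_ω` -/

section Wave

variable {n : ℕ} {Λ : ℝ}
  {M : Type*} [TopologicalSpace M] [ChartedSpace (EuclideanSpace ℝ (Fin (n - 1))) M]
  [IsManifold (𝓡 (n - 1)) ∞ M]
  (σ : Bundle.ContMDiffRiemannianMetric (𝓡 (n - 1)) ∞ (EuclideanSpace ℝ (Fin (n - 1)))
      (fun x : M => TangentSpace (𝓡 (n - 1)) x))

/-- For `u = w ζ φ` every term of the wave equation is a multiple of `u`: the equation of `w` turns
the first and the last term into `-λ t ^ (2 - 4 / n) u`, while Laplacian and scalar curvature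
contribute `((n - 1) r⁻² ν² + μ̂) t ^ (2 - 4 / n) u`. -/
theorem solvesWaveEquation_productFunction (hn : 3 ≤ n) (hΛ : Λ < 0) {κ r : ℝ} (hr : r ≠ 0)
    (hσ : HasConstantCurvature (𝓡 (n - 1)) (stdBasis (n - 1)) σ.inner κ)
    {φ : M → ℂ} {μ : ℝ} (hφ : IsLaplaceEigenpair (𝓡 (n - 1)) (stdBasis (n - 1)) σ.inner φ μ)
    {lam : ℝ} {W D w : ℝ → ℂ} (hW : IsTemporalSolution n Λ lam W D) (hWw : ∀ t > 0, W t = w t)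
    {ζ : ℝ → ℝ} (hζ : ContDiff ℝ ∞ ζ) {ν : ℝ}
    (hζν : ∀ τ, -iteratedDeriv 2 ζ τ = (r ^ 2)⁻¹ * ν ^ 2 * ζ τ)
    (hlam : lam = ((n : ℝ) - 1) * (r ^ 2)⁻¹ * ν ^ 2 + muHat n r κ μ) :
    SolvesWaveEquation n Λ (cylinderMetric (n - 1) r σ.inner) (productFunction w ζ φ) := by
  intro t ht p₀ y hy
  have hy' := mem_extChartAt_cylinder_target.mp hy
  have hc := waveCoeff_pos hn
  have hd : ((n - 1 : ℕ) : ℝ) = n - 1 := by rw [Nat.cast_sub (by omega), Nat.cast_one]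
  have h1 : ∀ c : ℂ,
      iteratedDeriv 2 (fun s => w s * c) t = (potential n Λ lam t : ℂ) * w t * c := by
    intro c
    have e1 : (fun s => w s * c) =ᶠ[𝓝 t] fun s => W s * c := by
      filter_upwards [Ioi_mem_nhds ht] with s hs
      rw [hWw s hs]
    have e2 : deriv (fun s => W s * c) = fun s => D s * c :=
      funext fun s => ((hW.hasDerivAt s).mul_const c).deriv
    rw [e1.iteratedDeriv_eq, iteratedDeriv_succ, iteratedDeriv_one, e2,
      ((hW.hasDerivAt_deriv t).mul_const c).deriv, hWw t ht]
  have hζ2 : ∀ τ, iteratedDeriv 2 (fun τ => w t * (ζ τ : ℂ)) τ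
      = w t * ((-((r ^ 2)⁻¹ * ν ^ 2 * ζ τ) : ℝ) : ℂ) := by
    intro τ
    have d1 : ∀ τ, HasDerivAt (fun τ => w t * (ζ τ : ℂ)) (w t * ((deriv ζ τ : ℝ) : ℂ)) τ := fun τ =>
      ((hζ.differentiable (by simp)) τ).hasDerivAt.ofReal_comp.const_mul _
    have d2 : ∀ τ, HasDerivAt (fun τ => w t * ((deriv ζ τ : ℝ) : ℂ))
        (w t * ((deriv (deriv ζ) τ : ℝ) : ℂ)) τ := fun τ =>
      HasDerivAt.const_mul _
        (((contDiff_infty_iff_deriv.mp hζ).2.differentiable (by simp)) τ).hasDerivAt.ofReal_comp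
    rw [iteratedDeriv_succ, iteratedDeriv_one, (funext fun τ => (d1 τ).deriv : deriv _ = _),
      (d2 τ).deriv, ← hζν τ, neg_neg, iteratedDeriv_succ, iteratedDeriv_one]
  have hf : ContDiff ℝ ∞ fun τ => w t * (ζ τ : ℂ) :=
    contDiff_const.mul (Complex.ofRealCLM.contDiff.comp hζ)
  have hLap : chartLaplacian (prodModel (n - 1)) (prodBasis (n - 1))
      (cylinderMetric (n - 1) r σ.inner) p₀ (productFunction w ζ φ t) y = _ :=
    chartLaplacian_cylinder σ hr hf hφ hy'
  have hpair : ∀ s, productFunction w ζ φ s ((extChartAt (prodModel (n - 1)) p₀).symm y)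
      = w s * ((ζ y.1 : ℂ) * φ ((extChartAt (𝓡 (n - 1)) p₀.2).symm y.2)) := by
    intro s
    rw [extChartAt_cylinder_symm]
    simp only [productFunction]
    ring
  simp only [hpair]
  rw [hLap, h1, hζ2, chartScalarCurvature_cylinder σ hr hσ hy', hd]
  have hpot : waveCoeff n * potential n Λ lam t
      = -(n * Λ * t ^ 2) - lam * t ^ (2 - 4 / (n : ℝ)) := by
    unfold potential
    rw [mul_div_cancel₀ _ hc.ne', max_eq_left ht.le, abs_of_neg hΛ]
    ring
  have hpot' : (waveCoeff n : ℂ) * (potential n Λ lam t : ℂ)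
      = -(n * Λ * t ^ 2) - (((lam * t ^ (2 - 4 / (n : ℝ)) : ℝ)) : ℂ) := by
    exact_mod_cast congrArg (fun x : ℝ => (x : ℂ)) hpot
  generalize potential n Λ lam t = P at hpot' ⊢
  rw [hlam, muHat] at hpot'
  generalize φ ((extChartAt (𝓡 (n - 1)) p₀.2).symm y.2) = Φ
  push_cast at hpot' ⊢
  linear_combination (w t * ζ y.1 * Φ) * hpot'

end Wave

theorem contDiff_oscillator (r ν : ℝ) : ContDiff ℝ ∞ (oscillator r ν) := by
  unfold oscillator
  by_cases h : ν = 0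
  · simp only [h, if_true]
    exact contDiff_const
  · simp only [h, if_false]
    fun_prop

theorem iteratedDeriv_two_oscillator (r ν τ : ℝ) :
    -iteratedDeriv 2 (oscillator r ν) τ = (r ^ 2)⁻¹ * ν ^ 2 * oscillator r ν τ := by
  by_cases h : ν = 0
  · have h1 : oscillator r ν = fun _ => 1 := funext fun τ => by simp [oscillator, h]
    rw [h1, iteratedDeriv_const]
    simp [h]
  · have h1 : oscillator r ν
        = fun τ => √(2 * (r⁻¹ * ν) / Real.pi) * Real.sin (r⁻¹ * ν * τ) :=
      funext fun τ => by simp [oscillator, h]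
    set A := √(2 * (r⁻¹ * ν) / Real.pi)
    set k := r⁻¹ * ν with hk
    have d1 : ∀ τ, HasDerivAt (fun τ => A * Real.sin (k * τ)) (A * (Real.cos (k * τ) * k)) τ :=
      fun τ => by simpa using (((hasDerivAt_id τ).const_mul k).sin).const_mul A
    have d2 : ∀ τ, HasDerivAt (fun τ => A * (Real.cos (k * τ) * k))
        (A * (-Real.sin (k * τ) * k * k)) τ :=
      fun τ => by simpa using ((((hasDerivAt_id τ).const_mul k).cos).mul_const k).const_mul A
    rw [h1, iteratedDeriv_succ, iteratedDeriv_one, (funext fun τ => (d1 τ).deriv : deriv _ = _),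
      (d2 τ).deriv]
    simp only
    rw [hk]
    ring

theorem integral_oscillator_sq {r ν : ℝ} (hr : 0 < r) (hν : 0 < ν) :
    ∫ τ in (0 : ℝ)..(Real.pi / (r⁻¹ * ν)), oscillator r ν τ ^ 2 = 1 := by
  have hk : 0 < r⁻¹ * ν := by positivity
  have hpi := Real.pi_pos
  simp only [oscillator, hν.ne', if_false]
  set k := r⁻¹ * ν
  have h1 : ∀ τ, (√(2 * k / Real.pi) * Real.sin (k * τ)) ^ 2
      = 2 * k / Real.pi * (fun x => Real.sin x ^ 2) (k * τ) := by
    intro τ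
    rw [mul_pow, Real.sq_sqrt (by positivity)]
  simp only [h1]
  rw [intervalIntegral.integral_const_mul,
    intervalIntegral.integral_comp_mul_left (fun x => Real.sin x ^ 2) hk.ne', integral_sin_sq]
  have : k * (Real.pi / k) = Real.pi := by field_simp
  rw [this]
  simp
  field_simp

theorem abs_oscillator_le (r ν τ : ℝ) :
    |oscillator r ν τ| ≤ max 1 √(2 * (r⁻¹ * ν) / Real.pi) := by
  unfold oscillator
  split_ifs
  · simp
  · rw [abs_mul, abs_of_nonneg (Real.sqrt_nonneg _)]
    exact le_max_of_le_right
      (mul_le_of_le_one_right (Real.sqrt_nonneg _) (Real.abs_sin_le_one _))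

/-! ### Maximum principles for the Laplacian in coordinates -/

section MaximumPrinciple

variable {E : Type*} [NormedAddCommGroup E] [InnerProductSpace ℝ E]
  {ι : Type*} [Fintype ι] [DecidableEq ι] (b : Module.Basis ι ℝ E)

/-- The Laplacian of a real valued function in coordinates, as `coordLaplacian` is for complex
valued ones: maximum principles are applied to the real functions `l ∘ φ` with `l : ℂ → ℝ` linear.
-/
def realLaplacian (G : E → Matrix ι ι ℝ) (f : E → ℝ) (y : E) : ℝ :=
  ∑ i, ∑ j, (G y)⁻¹ i j *
    (fderiv ℝ (fun z => fderiv ℝ f z (b j)) y (b i)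
      - ∑ k, christoffel b G k i j y * fderiv ℝ f y (b k))

variable {G : E → Matrix ι ι ℝ} {U : Set E}

theorem realLaplacian_comp (hU : IsOpen U) {P : E → ℂ} (hP : ContDiffOn ℝ ∞ P U) {y : E}
    (hy : y ∈ U) (l : ℂ →L[ℝ] ℝ) :
    realLaplacian b G (fun z => l (P z)) y = l (coordLaplacian b G P y) := by
  have h1 : ∀ z ∈ U, ∀ v, fderiv ℝ (fun z => l (P z)) z v = l (fderiv ℝ P z v) := by
    intro z hz v
    have hd : DifferentiableAt ℝ P z := (hP.contDiffAt (hU.mem_nhds hz)).differentiableAt (by simp)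
    have h : HasFDerivAt (fun z => l (P z)) (l.comp (fderiv ℝ P z)) z :=
      l.hasFDerivAt.comp z hd.hasFDerivAt
    rw [h.fderiv]
    rfl
  have h2 : ∀ v w, fderiv ℝ (fun z => fderiv ℝ (fun z => l (P z)) z v) y w
      = l (fderiv ℝ (fun z => fderiv ℝ P z v) y w) := by
    intro v w
    have hd : DifferentiableAt ℝ (fun z => fderiv ℝ P z v) y :=
      ((contDiffOn_fderiv_apply hU hP v).contDiffAt (hU.mem_nhds hy)).differentiableAt (by simp)
    have e1 : (fun z => fderiv ℝ (fun z => l (P z)) z v) =ᶠ[𝓝 y] fun z => l (fderiv ℝ P z v) := by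
      filter_upwards [hU.mem_nhds hy] with z hz using h1 z hz v
    have h : HasFDerivAt (fun z => l (fderiv ℝ P z v))
        (l.comp (fderiv ℝ (fun z => fderiv ℝ P z v) y)) y := l.hasFDerivAt.comp y hd.hasFDerivAt
    rw [e1.fderiv_eq, h.fderiv]
    rfl
  unfold realLaplacian coordLaplacian
  simp only [h2, h1 y hy, map_sum, ← Complex.real_smul, map_smul, map_sub, smul_eq_mul]

theorem realLaplacian_add_const_mul (hU : IsOpen U) {f g : E → ℝ} (hf : ContDiffOn ℝ ∞ f U)
    (hg : ContDiffOn ℝ ∞ g U) (c : ℝ) {y : E} (hy : y ∈ U) :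
    realLaplacian b G (fun z => f z + c * g z) y
      = realLaplacian b G f y + c * realLaplacian b G g y := by
  have hd : ∀ {f : E → ℝ}, ContDiffOn ℝ ∞ f U → ∀ z ∈ U, DifferentiableAt ℝ f z := fun hf z hz =>
    (hf.contDiffAt (hU.mem_nhds hz)).differentiableAt (by simp)
  have key : ∀ {f g : E → ℝ}, ContDiffOn ℝ ∞ f U → ContDiffOn ℝ ∞ g U → ∀ z ∈ U, ∀ v,
      fderiv ℝ (fun z => f z + c * g z) z v = fderiv ℝ f z v + c * fderiv ℝ g z v := by
    intro f g hf hg z hz v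
    rw [((hd hf z hz).hasFDerivAt.fun_add ((hd hg z hz).hasFDerivAt.const_mul c)).fderiv]
    rfl
  have h2 : ∀ v w, fderiv ℝ (fun z => fderiv ℝ (fun z => f z + c * g z) z v) y w
      = fderiv ℝ (fun z => fderiv ℝ f z v) y w + c * fderiv ℝ (fun z => fderiv ℝ g z v) y w := by
    intro v w
    have e1 : (fun z => fderiv ℝ (fun z => f z + c * g z) z v)
        =ᶠ[𝓝 y] fun z => fderiv ℝ f z v + c * fderiv ℝ g z v := by
      filter_upwards [hU.mem_nhds hy] with z hz using key hf hg z hz v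
    rw [e1.fderiv_eq, key (contDiffOn_fderiv_apply hU hf v) (contDiffOn_fderiv_apply hU hg v) y hy]
  unfold realLaplacian
  simp only [h2, key hf hg y hy]
  rw [Finset.mul_sum, ← Finset.sum_add_distrib]
  refine Finset.sum_congr rfl fun i _ => ?_
  rw [Finset.mul_sum, ← Finset.sum_add_distrib]
  refine Finset.sum_congr rfl fun j _ => ?_
  have : ∑ k, christoffel b G k i j y * (fderiv ℝ f y (b k) + c * fderiv ℝ g y (b k))
      = ∑ k, christoffel b G k i j y * fderiv ℝ f y (b k)
        + c * ∑ k, christoffel b G k i j y * fderiv ℝ g y (b k) := by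
    rw [Finset.mul_sum, ← Finset.sum_add_distrib]
    exact Finset.sum_congr rfl fun k _ => by ring
  rw [this]
  ring

theorem fderiv_fderiv_apply_self_nonpos_of_isLocalMax {f : E → ℝ} {y : E} (hU : IsOpen U)
    (hf : ContDiffOn ℝ ∞ f U) (hy : y ∈ U) (hmax : IsLocalMax f y) (v : E) :
    fderiv ℝ (fun z => fderiv ℝ f z v) y v ≤ 0 := by
  by_contra! hpos
  set g : ℝ → ℝ := fun t => f (y + t • v) with hg
  have hline : ∀ t : ℝ, HasDerivAt (fun t : ℝ => y + t • v) v t := fun t => by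
    simpa using ((hasDerivAt_id t).smul_const v).const_add y
  have hmem : ∀ᶠ t : ℝ in 𝓝 0, y + t • v ∈ U := by
    refine (hline 0).continuousAt.eventually_mem ?_
    simpa using hU.mem_nhds hy
  have hd : ∀ z ∈ U, DifferentiableAt ℝ f z := fun z hz =>
    (hf.contDiffAt (hU.mem_nhds hz)).differentiableAt (by simp)
  have hd1 : ∀ᶠ t : ℝ in 𝓝 0, deriv g t = fderiv ℝ f (y + t • v) v := by
    filter_upwards [hmem] with t ht
    exact ((hd _ ht).hasFDerivAt.comp_hasDerivAt t (hline t)).deriv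
  have hd2 : deriv (deriv g) 0 = fderiv ℝ (fun z => fderiv ℝ f z v) y v := by
    have hdd : DifferentiableAt ℝ (fun z => fderiv ℝ f z v) (y + (0 : ℝ) • v) := by
      rw [zero_smul, add_zero]
      exact ((contDiffOn_fderiv_apply hU hf v).contDiffAt (hU.mem_nhds hy)).differentiableAt
        (by simp)
    have := (hdd.hasFDerivAt.comp_hasDerivAt 0 (hline 0)).deriv
    rw [zero_smul, add_zero] at this
    have e1 : deriv g =ᶠ[𝓝 0] fun t => fderiv ℝ f (y + t • v) v := hd1
    rw [e1.deriv_eq]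
    exact this
  have hgc : ContinuousAt g 0 := by
    have : ContinuousAt f (y + (0 : ℝ) • v) := by
      rw [zero_smul, add_zero]
      exact (hd y hy).continuousAt
    exact ContinuousAt.comp this (hline 0).continuousAt
  have hgmax : IsLocalMax g 0 := by
    have : Tendsto (fun t : ℝ => y + t • v) (𝓝 0) (𝓝 y) := by
      have := (hline 0).continuousAt.tendsto
      rwa [zero_smul, add_zero] at this
    have h2 := this.eventually hmax
    filter_upwards [h2] with t ht
    simpa [hg] using ht
  -- a positive second derivative makes `0` a local minimum as well, so `g` is locally constant
  have hgmin : IsLocalMin g 0 := isLocalMin_of_deriv_deriv_pos (by rw [hd2]; exact hpos)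
    hgmax.deriv_eq_zero hgc
  have hconst : g =ᶠ[𝓝 0] fun _ => g 0 := by
    filter_upwards [hgmax, hgmin] with t h1 h2 using le_antisymm h1 h2
  have h0 : deriv (deriv g) 0 = 0 := by
    have e1 : deriv g =ᶠ[𝓝 0] fun _ => 0 := by
      have := hconst.deriv
      refine this.trans ?_
      simp
    rw [e1.deriv_eq]
    simp
  rw [hd2] at h0
  linarith

open scoped MatrixOrder Matrix.Norms.L2Operator in
theorem exists_eq_star_mul_self_of_posSemidef {A : Matrix ι ι ℝ} (hA : A.PosSemidef) :
    ∃ S : Matrix ι ι ℝ, A = star S * S :=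
  CStarAlgebra.nonneg_iff_eq_star_mul_self.mp hA.nonneg

/-- With `G⁻¹ = Sᵀ S`, the Laplacian at a critical point is a sum of second derivatives in the
directions given by the rows of `S`. -/
theorem realLaplacian_nonpos_of_isLocalMax {f : E → ℝ} {y : E} (hU : IsOpen U)
    (hf : ContDiffOn ℝ ∞ f U) (hy : y ∈ U) (hG : (G y).PosDef) (hmax : IsLocalMax f y) :
    realLaplacian b G f y ≤ 0 := by
  have h0 : fderiv ℝ f y = 0 := hmax.fderiv_eq_zero
  have hdf : DifferentiableAt ℝ (fderiv ℝ f) y :=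
    ((hf.fderiv_of_isOpen hU (m := ∞) (by simp)).contDiffAt (hU.mem_nhds hy)).differentiableAt
      (by simp)
  set B := fderiv ℝ (fderiv ℝ f) y with hB
  have hB' : ∀ v w, fderiv ℝ (fun z => fderiv ℝ f z v) y w = B w v := by
    intro v w
    have : HasFDerivAt (fun z => fderiv ℝ f z v)
        ((ContinuousLinearMap.apply ℝ ℝ v).comp B) y :=
      (ContinuousLinearMap.apply ℝ ℝ v).hasFDerivAt.comp y hdf.hasFDerivAt
    rw [this.fderiv]
    rfl
  have hneg : ∀ v, B v v ≤ 0 := fun v => by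
    rw [← hB']
    exact fderiv_fderiv_apply_self_nonpos_of_isLocalMax hU hf hy hmax v
  obtain ⟨S, hS⟩ := exists_eq_star_mul_self_of_posSemidef hG.inv.posSemidef
  unfold realLaplacian
  simp only [hB', h0]
  have h1 : ∀ i j, (G y)⁻¹ i j = ∑ k, S k i * S k j := by
    intro i j
    rw [hS, Matrix.mul_apply]
    simp [Matrix.star_apply]
  calc _ = ∑ i, ∑ j, (G y)⁻¹ i j * B (b i) (b j) := by simp
    _ = ∑ k, B (∑ i, S k i • b i) (∑ j, S k j • b j) := by
        have h2 : ∀ k, B (∑ i, S k i • b i) (∑ j, S k j • b j)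
            = ∑ i, ∑ j, S k i * S k j * B (b i) (b j) := by
          intro k
          simp only [map_sum, sum_apply, map_smul, FunLike.coe_smul, Pi.smul_apply, smul_eq_mul]
          rw [Finset.sum_comm]
          refine Finset.sum_congr rfl fun i _ => ?_
          rw [Finset.mul_sum]
          exact Finset.sum_congr rfl fun j _ => by ring
        simp only [h1, h2, Finset.sum_mul]
        rw [Finset.sum_comm' (t' := Finset.univ) (s' := fun _ => Finset.univ) (by simp)]
        conv_rhs => rw [Finset.sum_comm]
        rw [Finset.sum_comm]
        exact Finset.sum_congr rfl fun i _ => Finset.sum_comm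
    _ ≤ 0 := Finset.sum_nonpos fun k _ => hneg _

theorem continuousOn_realLaplacian (hU : IsOpen U)
    (hG : ∀ i j, ContDiffOn ℝ ∞ (fun y => G y i j) U) (hpos : ∀ y ∈ U, (G y).PosDef)
    {f : E → ℝ} (hf : ContDiffOn ℝ ∞ f U) : ContinuousOn (realLaplacian b G f) U := by
  have hdet : ∀ y ∈ U, (G y).det ≠ 0 := fun y hy => (hpos y hy).det_pos.ne'
  unfold realLaplacian
  refine continuousOn_finsetSum _ fun i _ => continuousOn_finsetSum _ fun j _ => ?_
  refine (contDiffOn_inv hG hdet i j).continuousOn.mul (ContinuousOn.sub ?_ ?_)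
  · exact (contDiffOn_fderiv_apply hU (contDiffOn_fderiv_apply hU hf _) _).continuousOn
  · exact continuousOn_finsetSum _ fun k _ =>
      (contDiffOn_christoffel b hU hG hdet k i j).continuousOn.mul
        (contDiffOn_fderiv_apply hU hf _).continuousOn

/-- The barrier `exp (-α |x - c|²)` is strictly subharmonic off its centre for large `α`: apart from
the positive factor, its Laplacian is `α² A - α Δ|x - c|²`, where `A` is the squared length of the
gradient of `|x - c|²`. -/
theorem exists_pos_realLaplacian_exp (hU : IsOpen U)
    (hG : ∀ i j, ContDiffOn ℝ ∞ (fun y => G y i j) U) (hpos : ∀ y ∈ U, (G y).PosDef)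
    {K : Set E} (hK : IsCompact K) (hKU : K ⊆ U) {c : E} (hc : c ∉ K) :
    ∃ α > 0, ∀ x ∈ K, 0 < realLaplacian b G (fun z => Real.exp (-α * ‖z - c‖ ^ 2)) x := by
  have hdet : ∀ y ∈ U, (G y).det ≠ 0 := fun y hy => (hpos y hy).det_pos.ne'
  set q : E → ℝ := fun z => ‖z - c‖ ^ 2 with hq
  have hqs : ContDiff ℝ ∞ q := (contDiff_id.sub contDiff_const).norm_sq ℝ
  have hqd : Differentiable ℝ q := hqs.differentiable (by simp)
  have hqd' : ∀ v, Differentiable ℝ fun z => fderiv ℝ q z v := fun v =>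
    ((hqs.fderiv_right (m := ∞) (by simp)).clm_apply contDiff_const).differentiable (by simp)
  set A : E → ℝ := fun x => ∑ i, ∑ j, (G x)⁻¹ i j * (fderiv ℝ q x (b i) * fderiv ℝ q x (b j))
    with hA
  have hAc : ContinuousOn A U := by
    refine continuousOn_finsetSum _ fun i _ => continuousOn_finsetSum _ fun j _ => ?_
    refine (contDiffOn_inv hG hdet i j).continuousOn.mul ?_
    exact ((hqd' _).continuous.mul (hqd' _).continuous).continuousOn
  have hApos : ∀ x ∈ K, 0 < A x := by
    intro x hx
    have hxc : x - c ≠ 0 := sub_ne_zero.mpr fun h => hc (h ▸ hx)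
    have hne : (fun i => fderiv ℝ q x (b i)) ≠ 0 := by
      intro h0
      have h1 : fderiv ℝ q x = 0 := by
        refine ContinuousLinearMap.coe_injective (b.ext fun i => ?_)
        exact congrFun h0 i
      have h2 : HasFDerivAt q (2 • (innerSL ℝ (x - c))) x := by
        have := (hasFDerivAt_id x |>.sub_const c).norm_sq
        simpa using this
      rw [h2.fderiv] at h1
      have h3 := congrArg (fun L : E →L[ℝ] ℝ => L (x - c)) h1
      simp only [FunLike.coe_smul, Pi.smul_apply, innerSL_apply_apply, real_inner_self_eq_norm_sq,
        zero_apply] at h3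
      have : ‖x - c‖ ≠ 0 := norm_ne_zero_iff.mpr hxc
      simp_all
    have h4 := (hpos x (hKU hx)).inv.dotProduct_mulVec_pos hne
    refine h4.trans_eq ?_
    simp only [dotProduct, Matrix.mulVec, star_trivial, Finset.mul_sum, hA]
    exact Finset.sum_congr rfl fun i _ => Finset.sum_congr rfl fun j _ => by ring
  have hform : ∀ α x, realLaplacian b G (fun z => Real.exp (-α * q z)) x
      = Real.exp (-α * q x) * (α ^ 2 * A x - α * realLaplacian b G q x) := by
    intro α x
    have d1 : ∀ z v, fderiv ℝ (fun z => Real.exp (-α * q z)) z v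
        = Real.exp (-α * q z) * (-α * fderiv ℝ q z v) := by
      intro z v
      rw [(((hqd z).hasFDerivAt.const_mul (-α)).exp).fderiv]
      simp
    have d2 : ∀ v w, fderiv ℝ (fun z => fderiv ℝ (fun z => Real.exp (-α * q z)) z v) x w
        = Real.exp (-α * q x) * (α ^ 2 * (fderiv ℝ q x w * fderiv ℝ q x v)
          - α * fderiv ℝ (fun z => fderiv ℝ q z v) x w) := by
      intro v w
      simp only [d1]
      have e1 := ((hqd x).hasFDerivAt.const_mul (-α)).exp.fun_mul
        (((hqd' v) x).hasFDerivAt.const_mul (-α))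
      rw [e1.fderiv]
      simp
      ring
    unfold realLaplacian
    simp only [d2]
    simp only [d1, hA]
    rw [Finset.mul_sum, Finset.mul_sum, ← Finset.sum_sub_distrib, Finset.mul_sum]
    refine Finset.sum_congr rfl fun i _ => ?_
    rw [Finset.mul_sum, Finset.mul_sum, ← Finset.sum_sub_distrib, Finset.mul_sum]
    refine Finset.sum_congr rfl fun j _ => ?_
    have : ∑ k, christoffel b G k i j x * (Real.exp (-α * q x) * (-α * fderiv ℝ q x (b k)))
        = -α * Real.exp (-α * q x) * ∑ k, christoffel b G k i j x * fderiv ℝ q x (b k) := by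
      rw [Finset.mul_sum]
      exact Finset.sum_congr rfl fun k _ => by ring
    rw [this]
    ring
  rcases K.eq_empty_or_nonempty with rfl | hKne
  · exact ⟨1, one_pos, by simp⟩
  obtain ⟨x₁, hx₁, hmin⟩ := hK.exists_isMinOn hKne (hAc.mono hKU)
  obtain ⟨C, hC⟩ := hK.exists_bound_of_continuousOn
    ((continuousOn_realLaplacian b hU hG hpos hqs.contDiffOn).mono hKU)
  have hC0 : 0 ≤ C := (norm_nonneg _).trans (hC x₁ hx₁)
  have hA₁ := hApos x₁ hx₁
  refine ⟨(C + 1) / A x₁, by positivity, fun x hx => ?_⟩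
  rw [hform]
  refine mul_pos (Real.exp_pos _) ?_
  set α := (C + 1) / A x₁ with hα
  have hα0 : 0 < α := by positivity
  have h1 : A x₁ ≤ A x := hmin hx
  have h2 : realLaplacian b G q x ≤ C := (le_abs_self _).trans (hC x hx)
  have h3 : α * A x₁ = C + 1 := by rw [hα]; field_simp
  have h4 : α * A x₁ ≤ α * A x := by gcongr
  nlinarith

variable [FiniteDimensional ℝ E]

/-- The strong maximum principle, after Hopf: at a nearest point `z` of the maximal set to a point
off it, adding a small multiple of the barrier would create an interior maximum with positive
Laplacian. -/
theorem eventually_eq_of_realLaplacian_eq_zero (hU : IsOpen U)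
    (hG : ∀ i j, ContDiffOn ℝ ∞ (fun y => G y i j) U) (hpos : ∀ y ∈ U, (G y).PosDef)
    {f : E → ℝ} (hf : ContDiffOn ℝ ∞ f U) (hLf : ∀ y ∈ U, realLaplacian b G f y = 0)
    {m : ℝ} (hle : ∀ y ∈ U, f y ≤ m) {y₀ : E} (hy₀ : y₀ ∈ U) (hfy₀ : f y₀ = m) :
    ∀ᶠ y in 𝓝 y₀, f y = m := by
  obtain ⟨ρ', hρ', hball⟩ := Metric.isOpen_iff.mp hU y₀ hy₀
  set ρ := ρ' / 4 with hρdef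
  have hρ : 0 < ρ := by positivity
  by_contra hnot
  obtain ⟨y₁, hy₁, hfy₁⟩ : ∃ y₁ ∈ Metric.ball y₀ ρ, f y₁ ≠ m := by
    by_contra! hcon
    exact hnot (Filter.mem_of_superset (Metric.ball_mem_nhds y₀ hρ) hcon)
  have hcl : Metric.closedBall y₀ (2 * ρ) ⊆ U := fun x hx => hball (by
    rw [Metric.mem_closedBall] at hx
    rw [Metric.mem_ball]
    linarith)
  have hZ : IsCompact (Metric.closedBall y₀ (2 * ρ) ∩ f ⁻¹' {m}) :=
    (isCompact_closedBall y₀ (2 * ρ)).of_isClosed_subset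
      ((hf.continuousOn.mono hcl).preimage_isClosed_of_isClosed Metric.isClosed_closedBall
        isClosed_singleton) inter_subset_left
  have hZy₀ : y₀ ∈ Metric.closedBall y₀ (2 * ρ) ∩ f ⁻¹' {m} :=
    ⟨Metric.mem_closedBall_self (by positivity), hfy₀⟩
  obtain ⟨z, hz, hzmin⟩ := hZ.exists_infDist_eq_dist ⟨y₀, hZy₀⟩ y₁
  have hznear : ∀ x ∈ Metric.closedBall y₀ (2 * ρ), f x = m → dist y₁ z ≤ dist y₁ x := by
    intro x hx hfx
    rw [← hzmin]
    exact Metric.infDist_le_dist_of_mem ⟨hx, hfx⟩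
  set R := dist y₁ z with hR
  have hRρ : R < ρ := (hznear y₀ hZy₀.1 hfy₀).trans_lt hy₁
  have hR0 : 0 < R := dist_pos.mpr fun h => hfy₁ (h ▸ hz.2)
  -- the ball with diameter from `y₁` to `z` touches the maximal set only at `z`
  set c := midpoint ℝ y₁ z with hc
  have hcz : z - c = (1 / 2 : ℝ) • (z - y₁) := by
    rw [hc, midpoint_eq_smul_add, invOf_eq_inv]
    module
  have hcy : c - y₁ = (1 / 2 : ℝ) • (z - y₁) := by
    rw [hc, midpoint_eq_smul_add, invOf_eq_inv]
    module
  have hRn : ‖z - y₁‖ = R := by rw [hR, dist_comm, dist_eq_norm]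
  have hcz' : ‖z - c‖ = R / 2 := by
    rw [hcz, norm_smul, hRn]
    norm_num
    ring
  have htouch : ∀ x, ‖x - c‖ ≤ R / 2 → x ≠ z → x ∈ U → f x < m := by
    intro x hx hxz hxU
    refine lt_of_le_of_ne (hle x hxU) fun hfx => ?_
    have h1 := parallelogram_law_with_norm ℝ (x - c) (z - c)
    have h2 : x - c + (z - c) = x - y₁ := by rw [hcz, ← hcy]; abel
    have h3 : x - c - (z - c) = x - z := by abel
    rw [h2, h3, hcz'] at h1
    have h4 : 0 < ‖x - z‖ := norm_pos_iff.mpr (sub_ne_zero.mpr hxz)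
    have h5 : ‖x - y₁‖ < R := by
      have h0 := norm_nonneg (x - c)
      refine lt_of_pow_lt_pow_left₀ 2 hR0.le ?_
      nlinarith
    have h6 : dist y₁ x < R := by rw [dist_comm, dist_eq_norm]; exact h5
    have h7 : x ∈ Metric.closedBall y₀ (2 * ρ) := by
      rw [Metric.mem_closedBall]
      have := dist_triangle x y₁ y₀
      rw [dist_comm x y₁] at this
      have h8 : dist y₁ y₀ < ρ := hy₁
      linarith
    exact absurd (hznear x h7 hfx) (not_le.mpr h6)
  have hzy₀ : dist z y₀ < 2 * ρ := by
    have := dist_triangle z y₁ y₀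
    rw [dist_comm z y₁] at this
    have h8 : dist y₁ y₀ < ρ := hy₁
    linarith
  set s := R / 4 with hs
  have hs0 : 0 < s := by positivity
  set K := Metric.closedBall z s with hK
  have hKU : K ⊆ U := fun x hx => hball (by
    rw [Metric.mem_ball]
    have h1 : dist x z ≤ s := hx
    have := dist_triangle x z y₀
    linarith)
  have hcK : c ∉ K := by
    intro h
    have h1 : dist c z ≤ s := h
    rw [dist_comm, dist_eq_norm, hcz'] at h1
    linarith
  obtain ⟨α, hα, hbar⟩ :=
    exists_pos_realLaplacian_exp b hU hG hpos (isCompact_closedBall z s) hKU hcK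
  set h : E → ℝ := fun x => Real.exp (-α * ‖x - c‖ ^ 2) with hh
  have hhs : ContDiff ℝ ∞ h :=
    (contDiff_const.mul ((contDiff_id.sub contDiff_const).norm_sq ℝ)).exp
  have hh1 : ∀ x, h x ≤ 1 := fun x => Real.exp_le_one_iff.mpr (by nlinarith [sq_nonneg ‖x - c‖])
  have hS : IsCompact (Metric.sphere z s ∩ Metric.closedBall c (R / 2)) :=
    (isCompact_sphere z s).inter_right Metric.isClosed_closedBall
  have hSK : Metric.sphere z s ⊆ K := Metric.sphere_subset_closedBall
  -- on the part of the sphere around `z` inside the touching ball, `f` stays below `m` by some `ε`;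
  -- on the rest the barrier is smaller than at `z`, so the maximum of `f + ε h` over `K` is
  -- interior
  obtain ⟨ε, hε, hεS⟩ : ∃ ε > 0, ∀ x ∈ Metric.sphere z s ∩ Metric.closedBall c (R / 2),
      f x + ε < m := by
    rcases (Metric.sphere z s ∩ Metric.closedBall c (R / 2)).eq_empty_or_nonempty with he | hne
    · exact ⟨1, one_pos, by simp [he]⟩
    · obtain ⟨x₁, hx₁, hmax⟩ := hS.exists_isMaxOn hne
        (hf.continuousOn.mono ((inter_subset_left.trans hSK).trans hKU))
      have hx₁m : f x₁ < m := by
        refine htouch x₁ ?_ ?_ (hKU (hSK hx₁.1))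
        · rw [← dist_eq_norm]; exact hx₁.2
        · rintro rfl
          have : dist x₁ x₁ = s := hx₁.1
          rw [dist_self] at this
          linarith
      refine ⟨(m - f x₁) / 2, by linarith, fun x hx => ?_⟩
      have : f x ≤ f x₁ := hmax hx
      linarith
  have hF : ContDiffOn ℝ ∞ (fun x => f x + ε * h x) U :=
    hf.add (contDiffOn_const.mul hhs.contDiffOn)
  obtain ⟨x, hxK, hxmax⟩ := (isCompact_closedBall z s).exists_isMaxOn
    ⟨z, Metric.mem_closedBall_self hs0.le⟩ (hF.continuousOn.mono hKU)
  have hzx : m + ε * h z ≤ f x + ε * h x := by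
    have := hxmax (Metric.mem_closedBall_self hs0.le)
    have hfz : f z = m := hz.2
    simpa [hfz] using this
  have hxball : x ∈ Metric.ball z s := by
    by_contra hnb
    have hxs : x ∈ Metric.sphere z s := by
      rw [Metric.mem_sphere]
      exact le_antisymm hxK (not_lt.mp hnb)
    have hhz : 0 < h z := Real.exp_pos _
    by_cases hxc : x ∈ Metric.closedBall c (R / 2)
    · have h1 := hεS x ⟨hxs, hxc⟩
      nlinarith [hh1 x]
    · have h2 : h x < h z := by
        refine Real.exp_lt_exp.mpr ?_
        rw [hcz']
        have h3 : R / 2 < ‖x - c‖ := by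
          rw [Metric.mem_closedBall, not_le, dist_eq_norm] at hxc
          exact hxc
        have h4 : (R / 2) ^ 2 < ‖x - c‖ ^ 2 := pow_lt_pow_left₀ h3 (by positivity) (by norm_num)
        nlinarith
      have h5 := hle x (hKU hxK)
      nlinarith
  have hlm : IsLocalMax (fun x => f x + ε * h x) x :=
    (hxmax.isLocalMax (Filter.mem_of_superset (Metric.isOpen_ball.mem_nhds hxball)
      Metric.ball_subset_closedBall))
  have h1 := realLaplacian_nonpos_of_isLocalMax b hU hF (hKU hxK) (hpos x (hKU hxK)) hlm
  rw [realLaplacian_add_const_mul b hU hf hhs.contDiffOn ε (hKU hxK), hLf x (hKU hxK)] at h1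
  have h2 := hbar x hxK
  have h3 : 0 < ε * realLaplacian b G h x := mul_pos hε h2
  linarith

end MaximumPrinciple

/-! ### The lowest eigenvalue of a closed Riemannian manifold -/

section ClosedManifold

variable {d : ℕ} {M : Type*} [TopologicalSpace M] [ChartedSpace (EuclideanSpace ℝ (Fin d)) M]

theorem realLaplacian_eigenfunction [IsManifold (𝓡 d) ∞ M]
    {g : MetricField (𝓡 d) M} {φ : M → ℂ} {μ : ℝ}
    (hφ : IsLaplaceEigenpair (𝓡 d) (stdBasis d) g φ μ) (p₀ : M) (l : ℂ →L[ℝ] ℝ)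
    {y : EuclideanSpace ℝ (Fin d)} (hy : y ∈ (extChartAt (𝓡 d) p₀).target) :
    realLaplacian (stdBasis d) (chartMetric (𝓡 d) (stdBasis d) g p₀)
        (fun z => l (φ ((extChartAt (𝓡 d) p₀).symm z))) y
      = -μ * l (φ ((extChartAt (𝓡 d) p₀).symm y)) := by
  rw [realLaplacian_comp (stdBasis d) (isOpen_extChartAt_target (I := 𝓡 d) p₀)
    (contDiffOn_comp_extChartAt_symm hφ.1 p₀) hy l]
  have h := hφ.2.2 p₀ y hy
  unfold chartLaplacian at h
  rw [neg_eq_iff_eq_neg, ← neg_mul, ← Complex.ofReal_neg, ← Complex.real_smul] at h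
  rw [h, map_smul, smul_eq_mul]

theorem isLaplaceEigenpair_const [Nonempty M] (g : MetricField (𝓡 d) M) {c : ℂ} (hc : c ≠ 0) :
    IsLaplaceEigenpair (𝓡 d) (stdBasis d) g (fun _ => c) 0 := by
  refine ⟨contMDiff_const, fun h => hc (congrFun h (Classical.arbitrary M)), fun p₀ y _ => ?_⟩
  simp [chartLaplacian, coordLaplacian]

variable [CompactSpace M] [IsManifold (𝓡 d) ∞ M]
  (σ : Bundle.ContMDiffRiemannianMetric (𝓡 d) ∞ (EuclideanSpace ℝ (Fin d))
      (fun x : M => TangentSpace (𝓡 d) x))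
  {φ : M → ℂ} {μ : ℝ}

/-- For `μ < 0`, at a maximum `p` of `l ∘ φ`, with `l = ± Re, ± Im`, the maximum principle gives
`-μ l (φ p) = Δ (l ∘ φ) (p) ≤ 0`, hence `l ∘ φ ≤ 0`; so `φ` would vanish. -/
theorem IsLaplaceEigenpair.eigenvalue_nonneg
    (hφ : IsLaplaceEigenpair (𝓡 d) (stdBasis d) σ.inner φ μ) : 0 ≤ μ := by
  by_contra! hμ
  have key : ∀ (l : ℂ →L[ℝ] ℝ) (x : M), l (φ x) ≤ 0 := by
    intro l x
    obtain ⟨p, -, hp⟩ := isCompact_univ.exists_isMaxOn ⟨x, mem_univ x⟩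
      (l.continuous.comp hφ.1.continuous).continuousOn
    have hp' : ∀ x, l (φ x) ≤ l (φ p) := fun x => hp (mem_univ x)
    have hmax : IsLocalMax (fun z => l (φ ((extChartAt (𝓡 d) p).symm z))) (extChartAt (𝓡 d) p p) :=
      Filter.Eventually.of_forall fun z => by
        simp only [extChartAt_to_inv]
        exact hp' _
    have h1 := realLaplacian_nonpos_of_isLocalMax (stdBasis d)
      (isOpen_extChartAt_target (I := 𝓡 d) p)
      (l.contDiff.comp_contDiffOn (contDiffOn_comp_extChartAt_symm hφ.1 p))
      (mem_extChartAt_target p)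
      (posDef_chartMetric σ (stdBasis d) p (mem_extChartAt_target p)) hmax
    have h2 := realLaplacian_eigenfunction hφ p l (mem_extChartAt_target p)
    rw [extChartAt_to_inv] at h2
    have h3 : -μ * l (φ p) ≤ 0 := h2.symm.trans_le h1
    have h4 : l (φ p) ≤ 0 := by nlinarith
    exact (hp' x).trans h4
  refine hφ.2.1 (funext fun x => Complex.ext ?_ ?_)
  · have h1 := key Complex.reCLM x
    have h2 := key (-Complex.reCLM) x
    simp at h1 h2
    exact le_antisymm h1 h2
  · have h1 := key Complex.imCLM x
    have h2 := key (-Complex.imCLM) x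
    simp at h1 h2
    exact le_antisymm h1 h2

/-- A harmonic function on a closed connected manifold is constant: by the strong maximum principle
the set where `l ∘ φ` attains its maximum is open. -/
theorem IsLaplaceEigenpair.eq_of_eigenvalue_eq_zero [PreconnectedSpace M]
    (hφ : IsLaplaceEigenpair (𝓡 d) (stdBasis d) σ.inner φ 0) (x x' : M) : φ x = φ x' := by
  have key : ∀ l : ℂ →L[ℝ] ℝ, l (φ x) = l (φ x') := by
    intro l
    have hc : Continuous fun x => l (φ x) := l.continuous.comp hφ.1.continuous
    obtain ⟨p, -, hp⟩ := isCompact_univ.exists_isMaxOn ⟨x, mem_univ x⟩ hc.continuousOn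
    have hp' : ∀ x, l (φ x) ≤ l (φ p) := fun x => hp (mem_univ x)
    have hclopen : IsClopen {x | l (φ x) = l (φ p)} := by
      refine ⟨isClosed_eq hc continuous_const, isOpen_iff_mem_nhds.mpr fun q hq => ?_⟩
      have h1 := eventually_eq_of_realLaplacian_eq_zero (stdBasis d)
        (isOpen_extChartAt_target (I := 𝓡 d) q)
        (fun i j => contDiffOn_chartMetric σ (stdBasis d) q i j)
        (fun y hy => posDef_chartMetric σ (stdBasis d) q hy)
        (l.contDiff.comp_contDiffOn (contDiffOn_comp_extChartAt_symm hφ.1 q))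
        (fun y hy => (realLaplacian_eigenfunction hφ q l hy).trans (by simp))
        (m := l (φ p)) (fun y _ => hp' _) (mem_extChartAt_target q)
        (by rw [Function.comp_apply, extChartAt_to_inv]; exact hq)
      filter_upwards [(continuousAt_extChartAt (I := 𝓡 d) q).eventually h1,
        extChartAt_source_mem_nhds (I := 𝓡 d) q] with x h2 hx
      rwa [Function.comp_apply, (extChartAt (𝓡 d) q).left_inv hx] at h2
    have huniv := hclopen.eq_univ ⟨p, rfl⟩
    have hx : ∀ x, l (φ x) = l (φ p) := fun x => by
      have : x ∈ {x | l (φ x) = l (φ p)} := huniv ▸ mem_univ x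
      exact this
    rw [hx x, hx x']
  exact Complex.ext (key Complex.reCLM) (key Complex.imCLM)

/-- The constants are eigenfunctions, so `0` occurs in every complete list of eigenvalues. -/
theorem IsLaplaceSpectrum.eigenvalue_zero [Nonempty M] {φ : ℕ → M → ℂ} {μ : ℕ → ℝ}
    (hφ : IsLaplaceSpectrum (𝓡 d) (stdBasis d) σ.inner φ μ) : μ 0 = 0 := by
  have h1 := hφ.complete _ 0 (isLaplaceEigenpair_const σ.inner (one_ne_zero (α := ℂ)))
  obtain ⟨j, hj⟩ : ∃ j, μ j = 0 := by
    by_contra! hne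
    have : {j | μ j = 0} = ∅ := Set.eq_empty_of_forall_notMem fun j hj => hne j hj
    rw [this, image_empty, Submodule.span_empty, Submodule.mem_bot] at h1
    have := congrFun h1 (Classical.arbitrary M)
    simp at this
  exact le_antisymm ((hφ.monotone (Nat.zero_le j)).trans hj.le)
    ((hφ.eigenpair 0).eigenvalue_nonneg σ)

theorem IsLaplaceSpectrum.exists_eq_const [ConnectedSpace M] {φ : ℕ → M → ℂ} {μ : ℕ → ℝ}
    (hφ : IsLaplaceSpectrum (𝓡 d) (stdBasis d) σ.inner φ μ) : ∃ c : ℂ, c ≠ 0 ∧ ∀ x, φ 0 x = c := by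
  have h0 := hφ.eigenpair 0
  obtain ⟨x₀, hx₀⟩ := Function.ne_iff.mp h0.2.1
  rw [hφ.eigenvalue_zero σ] at h0
  exact ⟨φ 0 x₀, hx₀, fun x => h0.eq_of_eigenvalue_eq_zero σ x x₀⟩

theorem muHat_zero_nonpos {n : ℕ} (hn : 3 ≤ n) {κ : ℝ} (hκ : 0 ≤ κ) (r : ℝ) :
    muHat n r κ 0 ≤ 0 := by
  have h : (3 : ℝ) ≤ n := by exact_mod_cast hn
  have : 0 ≤ (n : ℝ) / 2 * ((n : ℝ) - 1) * ((n : ℝ) - 2) * (r ^ 2)⁻¹ * κ := by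
    have h1 : (0 : ℝ) ≤ n - 1 := by linarith
    have h2 : (0 : ℝ) ≤ n - 2 := by linarith
    positivity
  simp only [muHat, mul_zero, zero_sub]
  linarith

end ClosedManifold

/-! ### Finiteness of the energies -/

section Energies

/-- The squared length `q = ξᵀ G⁻¹ ξ` of a covector is at most `C` if `ξ(u)² ≤ C B(u, u)` for all
`u`: the vector `u` with coordinates `G⁻¹ ξ` has `ξ(u) = B(u, u) = q`, whence `q² ≤ C q`. -/
theorem sum_inv_mul_le {V ι : Type*} [AddCommGroup V] [Module ℝ V] [Fintype ι] [DecidableEq ι]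
    (v : ι → V) (B : V → V → ℝ)
    (hadd : ∀ u v w, B (u + v) w = B u w + B v w) (hsmul : ∀ (a : ℝ) v w, B (a • v) w = a * B v w)
    (hsymm : ∀ v w, B v w = B w v) (hdet : (Matrix.of fun i j => B (v i) (v j)).det ≠ 0)
    (ξ : V →ₗ[ℝ] ℝ) {C : ℝ} (hC : 0 ≤ C) (hξ : ∀ v, ξ v ^ 2 ≤ C * B v v) :
    ∑ i, ∑ j, (Matrix.of fun i j => B (v i) (v j))⁻¹ i j * (ξ (v i) * ξ (v j)) ≤ C := by
  set G := Matrix.of fun i j => B (v i) (v j) with hG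
  set c : ι → ℝ := G⁻¹.mulVec fun j => ξ (v j) with hc
  have hGc : G.mulVec c = fun j => ξ (v j) := by
    rw [hc, Matrix.mulVec_mulVec, Matrix.mul_nonsing_inv _ (isUnit_iff_ne_zero.mpr hdet),
      Matrix.one_mulVec]
  have hsum := sum_left_of_add_of_smul (ι := ι) B hadd hsmul
  have h1 : ξ (∑ i, c i • v i) = ∑ i, ∑ j, G⁻¹ i j * (ξ (v i) * ξ (v j)) := by
    simp only [map_sum, map_smul, smul_eq_mul, hc, Matrix.mulVec, dotProduct, Finset.sum_mul]
    exact Finset.sum_congr rfl fun i _ => Finset.sum_congr rfl fun j _ => by ring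
  have h2 : B (∑ i, c i • v i) (∑ i, c i • v i) = ξ (∑ i, c i • v i) := by
    rw [hsum, map_sum]
    refine Finset.sum_congr rfl fun i _ => ?_
    rw [hsmul, hsymm, hsum, map_smul, smul_eq_mul]
    congr 1
    have := congrFun hGc i
    simp only [Matrix.mulVec, dotProduct, hG, Matrix.of_apply] at this
    rw [← this]
    refine Finset.sum_congr rfl fun j _ => ?_
    rw [hsmul, hsymm, mul_comm]
  have h3 := hξ (∑ i, c i • v i)
  rw [h2, h1] at h3
  by_contra! hlt
  nlinarith

/-- Measurability of `f` is not needed, since otherwise `m.map f` is `0`. -/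
theorem map_apply_le {α β : Type*} [MeasurableSpace α] [MeasurableSpace β] (m : Measure α)
    (f : α → β) {s : Set β} (hs : MeasurableSet s) : m.map f s ≤ m (f ⁻¹' s) := by
  by_cases hf : AEMeasurable f m
  · rw [Measure.map_apply_of_aemeasurable hf hs]
  · rw [Measure.map_of_not_aemeasurable hf]
    simp

section Gradient

variable {E : Type*} [NormedAddCommGroup E] [NormedSpace ℝ E]
  {H : Type*} [TopologicalSpace H] {I : ModelWithCorners ℝ E H}
  {M : Type*} [TopologicalSpace M] [ChartedSpace H M]

/-- The factor `2` comes from bounding real and imaginary part separately. -/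
theorem gradNormSq_le {ι : Type*} [Fintype ι] [DecidableEq ι] (b : Module.Basis ι ℝ E)
    (g : MetricField I M) (f : M → ℂ) (p : M) (hsymm : ∀ v w, g p v w = g p w v)
    (hpos : ∀ v, v ≠ 0 → 0 < g p v v) {C : ℝ} (hC : 0 ≤ C)
    (h : ∀ v : E, ‖manifoldDifferential I f p v‖ ^ 2 ≤ C * g p v v) :
    gradNormSq I b g f p ≤ 2 * C := by
  have hadd : ∀ u v w : TangentSpace I p, g p (u + v) w = g p u w + g p v w := fun u v w => by
    rw [map_add]; rfl
  have hsmul : ∀ (a : ℝ) (v w : TangentSpace I p), g p (a • v) w = a * g p v w := fun a v w => by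
    rw [map_smul]; rfl
  have hdet : (Matrix.of fun i j => g p (b i) (b j)).det ≠ 0 :=
    (posDef_of_inner (V := E) (fun v w => g p v w) hadd hsmul hsymm hpos
      b.linearIndependent).det_pos.ne'
  set ξ := manifoldDifferential I f p
  have key : ∀ l : ℂ →L[ℝ] ℝ, (∀ z, l z ^ 2 ≤ ‖z‖ ^ 2) →
      ∑ i, ∑ j, (Matrix.of fun i j => g p (b i) (b j))⁻¹ i j * (l (ξ (b i)) * l (ξ (b j))) ≤ C :=
    fun l hl => sum_inv_mul_le (V := E) b (fun v w => g p v w) hadd hsmul hsymm hdet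
      (l.comp ξ).toLinearMap hC fun v => (hl _).trans (h v)
  have h1 := key Complex.reCLM fun z => by
    rw [Complex.sq_norm, Complex.normSq_apply]; simp; nlinarith [mul_self_nonneg z.im]
  have h2 := key Complex.imCLM fun z => by
    rw [Complex.sq_norm, Complex.normSq_apply]; simp; nlinarith [mul_self_nonneg z.re]
  have h3 : gradNormSq I b g f p
      = (∑ i, ∑ j, (Matrix.of fun i j => g p (b i) (b j))⁻¹ i j
          * (Complex.reCLM (ξ (b i)) * Complex.reCLM (ξ (b j))))
        + ∑ i, ∑ j, (Matrix.of fun i j => g p (b i) (b j))⁻¹ i j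
          * (Complex.imCLM (ξ (b i)) * Complex.imCLM (ξ (b j))) := by
    simp only [gradNormSq, ← Finset.sum_add_distrib]
    refine Finset.sum_congr rfl fun i _ => Finset.sum_congr rfl fun j _ => ?_
    simp only [Complex.mul_re, Complex.conj_re, Complex.conj_im, Complex.reCLM_apply,
      Complex.imCLM_apply]
    ring
  rw [h3]
  linarith

end Gradient

section Volume

variable {E : Type*} [NormedAddCommGroup E] [NormedSpace ℝ E] [FiniteDimensional ℝ E]
  [MeasurableSpace E] [BorelSpace E]
  {H : Type*} [TopologicalSpace H] {I : ModelWithCorners ℝ E H} [I.Boundaryless]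
  {M : Type*} [TopologicalSpace M] [ChartedSpace H M] [IsManifold I ∞ M] [T2Space M]
  [SigmaCompactSpace M] [MeasurableSpace M] [OpensMeasurableSpace M]

/-- Only finitely many members of the partition of unity meet a compact set, and the volume density
of each is bounded on a compact subset of the chart. -/
theorem riemannianVolume_lt_top {ι : Type*} [Fintype ι] [DecidableEq ι] (b : Module.Basis ι ℝ E)
    (g : MetricField I M)
    (hdet : ∀ p₀, ContinuousOn (fun y => (chartMetric I b g p₀ y).det) (extChartAt I p₀).target)
    {K S : Set M} (hK : IsCompact K) (hS : IsOpen S) (hSK : S ⊆ K) :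
    riemannianVolume I b g S < ⊤ := by
  have hSm : MeasurableSet S := hS.measurableSet
  set ρ := chartPartition I M with hρ
  have hsub : ρ.IsSubordinate fun p => (chartAt H p).source :=
    (SmoothPartitionOfUnity.exists_isSubordinate_chartAt_source I M).choose_spec
  have hfin := ρ.locallyFinite.finite_nonempty_inter_compact hK
  have hle : ∀ p₀ : M, Measure.map (extChartAt I p₀).symm
      ((b.addHaar.restrict (extChartAt I p₀).target).withDensity fun y =>
        ENNReal.ofReal (ρ p₀ ((extChartAt I p₀).symm y) * √(chartMetric I b g p₀ y).det)) S
      ≤ ∫⁻ y in (extChartAt I p₀).target ∩ (extChartAt I p₀).symm ⁻¹' S,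
        ENNReal.ofReal (ρ p₀ ((extChartAt I p₀).symm y) * √(chartMetric I b g p₀ y).det)
          ∂b.addHaar := by
    intro p₀
    refine (map_apply_le _ _ hSm).trans_eq ?_
    rw [withDensity_apply', Measure.restrict_restrict'
      (isOpen_extChartAt_target p₀).measurableSet, inter_comm]
  have hmeas : ∀ p₀ : M,
      MeasurableSet ((extChartAt I p₀).target ∩ (extChartAt I p₀).symm ⁻¹' S) := fun p₀ =>
    ((continuousOn_extChartAt_symm p₀).isOpen_inter_preimage
      (isOpen_extChartAt_target p₀) hS).measurableSet
  unfold riemannianVolume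
  rw [Measure.sum_apply _ hSm, tsum_eq_sum (s := hfin.toFinset) ?_]
  · refine ENNReal.sum_lt_top.mpr fun p₀ _ => (hle p₀).trans_lt ?_
    set e := extChartAt I p₀ with he
    set Q := e '' (tsupport (ρ p₀) ∩ K) with hQ
    have hsrc : tsupport (ρ p₀) ⊆ e.source := by
      rw [he, extChartAt_source]
      exact hsub p₀
    have hQc : IsCompact Q := (hK.inter_left (isClosed_tsupport _)).image_of_continuousOn
      ((continuousOn_extChartAt p₀).mono (inter_subset_left.trans hsrc))
    have hQt : Q ⊆ e.target := by
      rintro _ ⟨p, hp, rfl⟩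
      exact e.map_source (hsrc hp.1)
    obtain ⟨C, hC⟩ := hQc.exists_bound_of_continuousOn
      (Real.continuous_sqrt.comp_continuousOn ((hdet p₀).mono hQt))
    calc _ ≤ ∫⁻ y in e.target ∩ e.symm ⁻¹' S, Q.indicator (fun _ => ENNReal.ofReal C) y
          ∂b.addHaar := by
          refine setLIntegral_mono' (hmeas p₀) fun y hy => ?_
          by_cases hyQ : y ∈ Q
          · rw [indicator_of_mem hyQ]
            refine ENNReal.ofReal_le_ofReal ?_
            calc _ ≤ 1 * √(chartMetric I b g p₀ y).det := by
                  gcongr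
                  exact ρ.le_one p₀ _
              _ ≤ C := by
                  rw [one_mul]
                  exact (le_abs_self _).trans (hC y hyQ)
          · have h0 : ρ p₀ (e.symm y) = 0 := by
              by_contra hne
              refine hyQ ⟨e.symm y, ⟨subset_tsupport _ hne, hSK hy.2⟩, e.right_inv hy.1⟩
            rw [h0, zero_mul, ENNReal.ofReal_zero]
            exact zero_le
      _ ≤ ∫⁻ y, Q.indicator (fun _ => ENNReal.ofReal C) y ∂b.addHaar :=
          lintegral_mono' Measure.restrict_le_self le_rfl
      _ < ⊤ := by
          rw [lintegral_indicator_const hQc.measurableSet]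
          exact ENNReal.mul_lt_top ENNReal.ofReal_lt_top hQc.measure_lt_top
  · intro p₀ hp₀
    refine le_antisymm ((hle p₀).trans_eq ?_) zero_le
    rw [setLIntegral_congr_fun (g := 0) (hmeas p₀)]
    · simp
    · intro y hy
      have h0 : ρ p₀ ((extChartAt I p₀).symm y) = 0 := by
        by_contra hne
        exact hp₀ (hfin.mem_toFinset.mpr ⟨_, hne, hSK hy.2⟩)
      simp only [h0, zero_mul, ENNReal.ofReal_zero, Pi.zero_apply]

end Volume

open Bundle in
/-- Near a point `p₀` the differential factors through the chart, whose derivative is the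
trivialization of the tangent bundle and hence has locally bounded norm with respect to the metric;
compactness of `M` makes the bound uniform. -/
theorem exists_norm_mfderiv_le {E : Type*} [NormedAddCommGroup E] [NormedSpace ℝ E]
    {H : Type*} [TopologicalSpace H] {I : ModelWithCorners ℝ E H} [I.Boundaryless]
    {M : Type*} [TopologicalSpace M] [ChartedSpace H M] [IsManifold I ∞ M] [CompactSpace M]
    (σ : Bundle.ContMDiffRiemannianMetric I ∞ E (fun x : M => TangentSpace I x))
    {φ : M → ℂ} (hφ : ContMDiff I 𝓘(ℝ, ℂ) ∞ φ) :
    ∃ C : ℝ, 0 ≤ C ∧ ∀ p (v : TangentSpace I p),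
      ‖manifoldDifferential I φ p v‖ ^ 2 ≤ C * σ.inner p v v := by
  let : RiemannianBundle (fun x : M => TangentSpace I x) := ⟨σ.toRiemannianMetric⟩
  have : IsContinuousRiemannianBundle E (fun x : M => TangentSpace I x) :=
    ⟨⟨σ.inner, σ.contMDiff.continuous, fun _ _ _ => rfl⟩⟩
  have hnorm : ∀ p (v : TangentSpace I p), ‖v‖ ^ 2 = σ.inner p v v := fun p v =>
    (real_inner_self_eq_norm_sq v).symm
  have hlocal : ∀ p₀ : M, ∃ C : ℝ, 0 ≤ C ∧ ∀ᶠ p in 𝓝 p₀, ∀ v : TangentSpace I p,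
      ‖manifoldDifferential I φ p v‖ ^ 2 ≤ C * σ.inner p v v := by
    intro p₀
    obtain ⟨C, hC, h⟩ := eventually_norm_trivializationAt_lt E (fun x : M => TangentSpace I x) p₀
    set P : E → ℂ := fun z => φ ((extChartAt I p₀).symm z) with hP
    have hopen := isOpen_extChartAt_target (I := I) p₀
    have hPs : ContDiffOn ℝ ∞ P (extChartAt I p₀).target :=
      (hφ.comp_contMDiffOn (contMDiffOn_extChartAt_symm p₀)).contDiffOn
    have hdP : ContinuousAt (fun p => ‖fderiv ℝ P (extChartAt I p₀ p)‖) p₀ := by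
      have h1 := (hPs.continuousOn_fderiv_of_isOpen hopen (by simp)).continuousAt
        (hopen.mem_nhds (mem_extChartAt_target (I := I) p₀))
      exact (h1.comp (continuousAt_extChartAt (I := I) p₀)).norm
    set C' := ‖fderiv ℝ P (extChartAt I p₀ p₀)‖ + 1 with hC'
    have hlt := hdP.eventually_lt_const (lt_add_one _)
    refine ⟨(C' * C) ^ 2, by positivity, ?_⟩
    filter_upwards [h, hlt, extChartAt_source_mem_nhds (I := I) p₀] with p h1 h2 hp v
    have hp' : p ∈ (chartAt H p₀).source := by rwa [extChartAt_source] at hp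
    have hmd : MDifferentiableAt I 𝓘(ℝ, E) (extChartAt I p₀) p :=
      mdifferentiableAt_extChartAt hp'
    have hPd : HasFDerivAt P (fderiv ℝ P (extChartAt I p₀ p)) (extChartAt I p₀ p) :=
      ((hPs.contDiffAt (hopen.mem_nhds ((extChartAt I p₀).map_source hp))).differentiableAt
        (by simp)).hasFDerivAt
    have hcomp := hPd.hasMFDerivAt.comp p hmd.hasMFDerivAt
    have heq : P ∘ extChartAt I p₀ =ᶠ[𝓝 p] φ := by
      filter_upwards [(isOpen_extChartAt_source (I := I) p₀).mem_nhds hp] with q hq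
      simp only [Function.comp_apply, hP, (extChartAt I p₀).left_inv hq]
    have hder := (hcomp.congr_of_eventuallyEq heq.symm).mfderiv
    unfold manifoldDifferential
    rw [hder, ← hnorm, ← mul_pow]
    refine pow_le_pow_left₀ (norm_nonneg _) ?_ 2
    have hL := TangentBundle.continuousLinearMapAt_trivializationAt (I := I) hp'
    let z : E := mfderiv I 𝓘(ℝ, E) (extChartAt I p₀) p v
    have h3 : ‖z‖ ≤ C * ‖v‖ := by
      have h4 := (Bundle.Trivialization.continuousLinearMapAt ℝ
        (trivializationAt E (fun x : M => TangentSpace I x) p₀) p).le_of_opNorm_le h1.le v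
      rw [hL] at h4
      exact h4
    calc _ ≤ ‖fderiv ℝ P (extChartAt I p₀ p)‖
          * ‖z‖ := (fderiv ℝ P (extChartAt I p₀ p)).le_opNorm _
      _ ≤ C' * (C * ‖v‖) := by gcongr
      _ = C' * C * ‖v‖ := by ring
  choose C hC hCl using hlocal
  obtain ⟨t, ht⟩ := CompactSpace.elim_nhds_subcover _ hCl
  refine ⟨∑ q ∈ t, C q, Finset.sum_nonneg fun q _ => hC q, fun p v => ?_⟩
  have hp : p ∈ (⊤ : Set M) := trivial
  rw [← ht] at hp
  obtain ⟨q, hq, hpq⟩ := mem_iUnion₂.mp hp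
  refine (hpq v).trans ?_
  rw [← hnorm]
  have : C q ≤ ∑ q ∈ t, C q := Finset.single_le_sum (fun q _ => hC q) hq
  gcongr

section Cylinder

variable {d : ℕ} {M : Type*} [TopologicalSpace M] [ChartedSpace (EuclideanSpace ℝ (Fin d)) M]

theorem manifoldDifferential_cylinder {f : ℝ → ℂ} {φ : M → ℂ} {p : ℝ × M}
    (hf : DifferentiableAt ℝ f p.1) (hφ : MDifferentiableAt (𝓡 d) 𝓘(ℝ, ℂ) φ p.2)
    (v : ℝ × EuclideanSpace ℝ (Fin d)) :
    manifoldDifferential (prodModel d) (fun p : ℝ × M => f p.1 * φ p.2) p v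
      = v.1 * deriv f p.1 * φ p.2 + f p.1 * manifoldDifferential (𝓡 d) φ p.2 v.2 := by
  have h1 : HasMFDerivAt (prodModel d) 𝓘(ℝ, ℂ) (fun p : ℝ × M => f p.1) p _ :=
    HasMFDerivAt.comp p hf.hasFDerivAt.hasMFDerivAt (hasMFDerivAt_fst p)
  have h2 : HasMFDerivAt (prodModel d) 𝓘(ℝ, ℂ) (fun p : ℝ × M => φ p.2) p _ :=
    HasMFDerivAt.comp p hφ.hasMFDerivAt (hasMFDerivAt_snd p)
  have h3 := (h1.mul h2).mfderiv
  unfold manifoldDifferential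
  have h4 : (fun p : ℝ × M => f p.1 * φ p.2) = (fun p => f p.1) * fun p => φ p.2 := rfl
  rw [h4, h3]
  have h5 : fderiv ℝ f p.1 v.1 = v.1 * deriv f p.1 := by
    rw [hf.hasDerivAt.hasFDerivAt.fderiv]
    simp
  rw [← h5]
  let a : ℂ := fderiv ℝ f p.1 v.1
  let c : ℂ := mfderiv (𝓡 d) 𝓘(ℝ, ℂ) φ p.2 v.2
  have h6 : f p.1 * c + φ p.2 * a = a * φ p.2 + f p.1 * c := by ring
  exact h6

theorem exists_norm_le_of_contMDiff [CompactSpace M] {φ : M → ℂ}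
    (hφ : ContMDiff (𝓡 d) 𝓘(ℝ, ℂ) ∞ φ) :
    ∃ C : ℝ, 0 ≤ C ∧ ∀ x, ‖φ x‖ ≤ C := by
  obtain ⟨C, hC⟩ := isCompact_univ.exists_bound_of_continuousOn hφ.continuous.continuousOn
  exact ⟨max C 0, le_max_right _ _, fun x => (hC x (mem_univ x)).trans (le_max_left _ _)⟩

variable [IsManifold (𝓡 d) ∞ M]
  (σ : Bundle.ContMDiffRiemannianMetric (𝓡 d) ∞ (EuclideanSpace ℝ (Fin d))
      (fun x : M => TangentSpace (𝓡 d) x))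

theorem det_chartMetric_cylinder (r : ℝ) {p₀ : ℝ × M}
    {y : ℝ × EuclideanSpace ℝ (Fin d)} (hy : y.2 ∈ (extChartAt (𝓡 d) p₀.2).target) :
    (chartMetric (prodModel d) (prodBasis d) (cylinderMetric d r σ.inner) p₀ y).det
      = (r ^ 2) ^ d * (chartMetric (𝓡 d) (stdBasis d) σ.inner p₀.2 y.2).det := by
  rw [chartMetric_cylinder r σ.inner hy, warpedBlock, Matrix.det_fromBlocks_zero₂₁, Matrix.det_one,
    one_mul, Matrix.det_smul, Fintype.card_fin]

variable [CompactSpace M]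

/-- The constant depends on `φ` only, so that the bound for `f = w(t) ζ` is uniform in `t`. -/
theorem exists_gradNormSq_cylinder_le {r : ℝ} (hr : 0 < r) {φ : M → ℂ}
    (hφ : ContMDiff (𝓡 d) 𝓘(ℝ, ℂ) ∞ φ) :
    ∃ C : ℝ, 0 ≤ C ∧ ∀ (f : ℝ → ℂ) (A : ℝ), Differentiable ℝ f → (∀ τ, ‖f τ‖ ≤ A) →
      (∀ τ, ‖deriv f τ‖ ≤ A) → ∀ p,
      gradNormSq (prodModel d) (prodBasis d) (cylinderMetric d r σ.inner)
        (fun p => f p.1 * φ p.2) p ≤ A ^ 2 * C := by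
  obtain ⟨Φ, hΦ0, hΦ⟩ := exists_norm_le_of_contMDiff hφ
  obtain ⟨C, hC0, hC⟩ := exists_norm_mfderiv_le σ hφ
  have hφd : MDifferentiable (𝓡 d) 𝓘(ℝ, ℂ) φ := hφ.mdifferentiable (by simp)
  refine ⟨2 * (2 * (Φ ^ 2 + C * (r ^ 2)⁻¹)), by positivity, fun f A hf hfA hdfA p => ?_⟩
  have hA : 0 ≤ A := (norm_nonneg _).trans (hfA 0)
  have hnn : ∀ v : TangentSpace (𝓡 d) p.2, 0 ≤ σ.inner p.2 v v := fun v => by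
    rcases eq_or_ne v 0 with rfl | hv
    · exact le_of_eq (by simp)
    · exact (σ.pos p.2 v hv).le
  have h := gradNormSq_le (prodBasis d) (cylinderMetric d r σ.inner) (fun p => f p.1 * φ p.2) p
    (C := 2 * A ^ 2 * (Φ ^ 2 + C * (r ^ 2)⁻¹)) ?_ ?_ (by positivity) ?_
  · refine h.trans_eq (by ring)
  · intro v w
    refine (cylinderMetric_apply r σ.inner p v w).trans
      (Eq.trans ?_ (cylinderMetric_apply r σ.inner p w v).symm)
    have := σ.symm p.2 v.2 w.2
    rw [mul_comm v.1]
    congr 2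
  · intro v hv
    refine lt_of_lt_of_eq ?_ (cylinderMetric_apply r σ.inner p v v).symm
    by_cases h1 : v.1 = 0
    · have h2 : v.2 ≠ 0 := fun h2 => hv (Prod.ext h1 h2)
      have h3 := mul_pos (pow_pos hr 2) (σ.pos p.2 v.2 h2)
      have h4 := mul_self_nonneg v.1
      exact add_pos_of_nonneg_of_pos h4 h3
    · have h3 := mul_nonneg (pow_pos hr 2).le (hnn v.2)
      have h4 := mul_self_pos.mpr h1
      exact add_pos_of_pos_of_nonneg h4 h3
  · intro v
    rw [manifoldDifferential_cylinder (hf p.1) (hφd p.2)]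
    refine le_of_le_of_eq ?_ (congrArg _ (cylinderMetric_apply r σ.inner p v v).symm)
    have h1 := hC p.2 v.2
    have h2 := hnn v.2
    set s : ℝ := σ.inner p.2 v.2 v.2 with hs
    set ξ := manifoldDifferential (𝓡 d) φ p.2 v.2
    change _ ≤ _ * (v.1 * v.1 + r ^ 2 * s)
    have e1 : ‖(v.1 : ℂ) * deriv f p.1 * φ p.2‖ ≤ |v.1| * A * Φ := by
      rw [norm_mul, norm_mul, Complex.norm_real, Real.norm_eq_abs]
      have := hdfA p.1
      have := hΦ p.2
      gcongr
    have e2 : ‖f p.1 * ξ‖ ^ 2 ≤ A ^ 2 * (C * s) := by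
      rw [norm_mul, mul_pow]
      have := hfA p.1
      gcongr
    have e3 : ‖(v.1 : ℂ) * deriv f p.1 * φ p.2‖ ^ 2 ≤ v.1 ^ 2 * A ^ 2 * Φ ^ 2 := by
      rw [← sq_abs v.1, ← mul_pow, ← mul_pow]
      exact pow_le_pow_left₀ (norm_nonneg _) e1 2
    have hr2 : (r ^ 2)⁻¹ * r ^ 2 = 1 := inv_mul_cancel₀ (pow_pos hr 2).ne'
    calc _ ≤ 2 * (‖(v.1 : ℂ) * deriv f p.1 * φ p.2‖ ^ 2 + ‖f p.1 * ξ‖ ^ 2) := by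
          have := norm_add_le ((v.1 : ℂ) * deriv f p.1 * φ p.2) (f p.1 * ξ)
          nlinarith [norm_nonneg ((v.1 : ℂ) * deriv f p.1 * φ p.2 + f p.1 * ξ),
            sq_nonneg (‖(v.1 : ℂ) * deriv f p.1 * φ p.2‖ - ‖f p.1 * ξ‖)]
      _ ≤ 2 * (v.1 ^ 2 * A ^ 2 * Φ ^ 2 + A ^ 2 * (C * s)) := by gcongr
      _ = 2 * A ^ 2 * (Φ ^ 2 * v.1 ^ 2 + C * s * ((r ^ 2)⁻¹ * r ^ 2)) := by rw [hr2]; ring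
      _ ≤ 2 * A ^ 2 * (Φ ^ 2 + C * (r ^ 2)⁻¹) * (v.1 * v.1 + r ^ 2 * s) := by
          have p1 : 0 ≤ Φ ^ 2 * (r ^ 2 * s) := by positivity
          have p2 : 0 ≤ C * (r ^ 2)⁻¹ * (v.1 * v.1) :=
            mul_nonneg (by positivity) (mul_self_nonneg _)
          rw [mul_assoc (2 * A ^ 2)]
          refine mul_le_mul_of_nonneg_left ?_ (by positivity : (0 : ℝ) ≤ 2 * A ^ 2)
          nlinarith

theorem riemannianVolume_cylinder_lt_top [T2Space M] [MeasurableSpace M] [BorelSpace M]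
    (r a c : ℝ) :
    riemannianVolume (prodModel d) (prodBasis d) (cylinderMetric d r σ.inner)
      (Ioo a c ×ˢ (univ : Set M)) < ⊤ := by
  have h1 : ∀ x₀ : M, ContinuousOn
      (fun y => (chartMetric (𝓡 d) (stdBasis d) σ.inner x₀ y).det) (extChartAt (𝓡 d) x₀).target :=
    fun x₀ => (contDiffOn_det fun i j =>
      contDiffOn_chartMetric σ (stdBasis d) x₀ i j).continuousOn
  have h2 : ∀ p₀ : ℝ × M, ContinuousOn (fun y => (chartMetric (prodModel d) (prodBasis d)
      (cylinderMetric d r σ.inner) p₀ y).det) (extChartAt (prodModel d) p₀).target := by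
    intro p₀
    have h3 : ContinuousOn (fun y : ℝ × EuclideanSpace ℝ (Fin d) =>
        (r ^ 2) ^ d * (chartMetric (𝓡 d) (stdBasis d) σ.inner p₀.2 y.2).det)
        (extChartAt (prodModel d) p₀).target :=
      continuousOn_const.mul ((h1 p₀.2).comp continuousOn_snd
        fun y hy => mem_extChartAt_cylinder_target.mp hy)
    exact h3.congr fun y hy =>
      det_chartMetric_cylinder σ r (mem_extChartAt_cylinder_target.mp hy)
  have h4 : IsCompact (Icc a c ×ˢ (univ : Set M)) := isCompact_Icc.prod isCompact_univ
  have h5 : IsOpen (Ioo a c ×ˢ (univ : Set M)) := isOpen_Ioo.prod isOpen_univ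
  exact riemannianVolume_lt_top (prodBasis d) (cylinderMetric d r σ.inner) h2 h4 h5
    (prod_mono Ioo_subset_Icc_self Subset.rfl)

end Cylinder

theorem exists_iteratedDeriv_oscillator_eq (r ν : ℝ) (k : ℕ) :
    ∃ A B : ℝ, iteratedDeriv k (oscillator r ν)
      = fun τ => A * Real.sin (r⁻¹ * ν * τ) + B * Real.cos (r⁻¹ * ν * τ) := by
  induction k with
  | zero =>
    rw [iteratedDeriv_zero]
    by_cases h : ν = 0
    · exact ⟨0, 1, funext fun τ => by simp [oscillator, h]⟩
    · exact ⟨√(2 * (r⁻¹ * ν) / Real.pi), 0, funext fun τ => by simp [oscillator, h]⟩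
  | succ k ih =>
    obtain ⟨A, B, h⟩ := ih
    refine ⟨-(B * (r⁻¹ * ν)), A * (r⁻¹ * ν), funext fun τ => ?_⟩
    rw [iteratedDeriv_succ, h]
    have h1 : HasDerivAt (fun τ => r⁻¹ * ν * τ) (r⁻¹ * ν) τ := by
      simpa using (hasDerivAt_id τ).const_mul (r⁻¹ * ν)
    rw [((h1.sin.const_mul A).fun_add (h1.cos.const_mul B)).deriv]
    ring

theorem exists_abs_iteratedDeriv_oscillator_le (r ν : ℝ) (k : ℕ) :
    ∃ C : ℝ, 0 ≤ C ∧ ∀ τ, |iteratedDeriv k (oscillator r ν) τ| ≤ C := by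
  obtain ⟨A, B, h⟩ := exists_iteratedDeriv_oscillator_eq r ν k
  refine ⟨|A| + |B|, by positivity, fun τ => ?_⟩
  rw [h]
  refine (abs_add_le _ _).trans ?_
  rw [abs_mul, abs_mul]
  have h1 := mul_le_mul_of_nonneg_left (Real.abs_sin_le_one (r⁻¹ * ν * τ)) (abs_nonneg A)
  have h2 := mul_le_mul_of_nonneg_left (Real.abs_cos_le_one (r⁻¹ * ν * τ)) (abs_nonneg B)
  linarith

section Wave

variable {n : ℕ} {Λ : ℝ}

theorem temporalEnergy_mul_const {lam : ℝ} {W D w : ℝ → ℂ} (hW : IsTemporalSolution n Λ lam W D)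
    (hWw : ∀ t > 0, W t = w t) (c : ℂ) :
    temporalEnergy n Λ (fun t => w t * c)
      = ENNReal.ofReal (‖c‖ ^ 2)
        * ∫⁻ t in Ioi (0 : ℝ), ENNReal.ofReal (temporalDensity n Λ t (W t) (D t)) := by
  unfold temporalEnergy
  rw [← lintegral_const_mul' _ _ ENNReal.ofReal_ne_top]
  refine setLIntegral_congr_fun measurableSet_Ioi fun t ht => ?_
  have h1 : HasDerivAt (fun t => w t * c) (D t * c) t := by
    refine ((hW.hasDerivAt t).mul_const c).congr_of_eventuallyEq ?_
    filter_upwards [Ioi_mem_nhds (mem_Ioi.mp ht)] with s hs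
    rw [hWw s hs]
  simp only
  rw [h1.deriv, ← hWw t ht, ← ENNReal.ofReal_mul (by positivity)]
  congr 1
  simp only [temporalDensity, norm_mul]
  ring

variable {M : Type*} [TopologicalSpace M] [ChartedSpace (EuclideanSpace ℝ (Fin (n - 1))) M]
  [CompactSpace M] [IsManifold (𝓡 (n - 1)) ∞ M] [T2Space M] [MeasurableSpace M] [BorelSpace M]
  (σ : Bundle.ContMDiffRiemannianMetric (𝓡 (n - 1)) ∞ (EuclideanSpace ℝ (Fin (n - 1)))
      (fun x : M => TangentSpace (𝓡 (n - 1)) x))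

/-- The temporal energy of `u(·, p)` is that of `w` times `|ζ φ|²`. For the spatial energy,
integrand and volume are bounded, the former uniformly in `t` because `w` is bounded. -/
theorem hasBoundedEnergies_productFunction (hn : 3 ≤ n) (hΛ : Λ < 0) {κ r : ℝ} (hr : 0 < r)
    (hσ : HasConstantCurvature (𝓡 (n - 1)) (stdBasis (n - 1)) σ.inner κ)
    {φ : M → ℂ} (hφ : ContMDiff (𝓡 (n - 1)) 𝓘(ℝ, ℂ) ∞ φ)
    {lam : ℝ} {W D w : ℝ → ℂ} (hW : IsTemporalSolution n Λ lam W D) (hWw : ∀ t > 0, W t = w t)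
    (ν : ℝ) :
    HasBoundedEnergies n Λ (cylinderMetric (n - 1) r σ.inner)
      (productFunction w (oscillator r ν) φ) := by
  have hn1 : (0 : ℝ) ≤ n - 1 := by
    have : (3 : ℝ) ≤ n := by exact_mod_cast hn
    linarith
  obtain ⟨Φ, hΦ0, hΦ⟩ := exists_norm_le_of_contMDiff hφ
  obtain ⟨Z₀, hZ₀, hζ₀⟩ := exists_abs_iteratedDeriv_oscillator_le r ν 0
  obtain ⟨Z₁, hZ₁, hζ₁⟩ := exists_abs_iteratedDeriv_oscillator_le r ν 1
  rw [iteratedDeriv_zero] at hζ₀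
  rw [iteratedDeriv_one] at hζ₁
  obtain ⟨Cw, hCw, hw⟩ := hW.exists_norm_le_exp hn hΛ
  constructor
  · set T := ∫⁻ t in Ioi (0 : ℝ), ENNReal.ofReal (temporalDensity n Λ t (W t) (D t)) with hT
    have hTlt : T < ⊤ := hW.mem.lintegral_lt_top hn
    have hfin : ENNReal.ofReal ((Z₀ * Φ) ^ 2) * T ≠ ⊤ :=
      (ENNReal.mul_lt_top ENNReal.ofReal_lt_top hTlt).ne
    refine ⟨(ENNReal.ofReal ((Z₀ * Φ) ^ 2) * T).toNNReal, fun p => ?_⟩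
    rw [ENNReal.coe_toNNReal hfin]
    have h1 : (fun t => productFunction w (oscillator r ν) φ t p)
        = fun t => w t * ((oscillator r ν p.1 : ℂ) * φ p.2) := funext fun t => mul_assoc _ _ _
    rw [h1, temporalEnergy_mul_const hW hWw]
    refine mul_le_mul_left (ENNReal.ofReal_le_ofReal (pow_le_pow_left₀ (norm_nonneg _) ?_ 2)) _
    rw [norm_mul, Complex.norm_real, Real.norm_eq_abs]
    exact mul_le_mul (hζ₀ _) (hΦ _) (norm_nonneg _) hZ₀
  · intro a c
    obtain ⟨C, hC, hgrad⟩ := exists_gradNormSq_cylinder_le σ hr hφ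
    set A := Cw * max Z₀ Z₁ with hA
    set R := |(r ^ 2)⁻¹ * (κ * ((n - 1 : ℕ) * ((n - 1 : ℕ) - 1)))| with hR
    set V := riemannianVolume (prodModel (n - 1)) (prodBasis (n - 1))
      (cylinderMetric (n - 1) r σ.inner) (Ioo a c ×ˢ (univ : Set M)) with hV
    have hVlt : V < ⊤ := riemannianVolume_cylinder_lt_top σ r a c
    set B := ENNReal.ofReal ((n - 1) * (A ^ 2 * C) + n / 2 * R * (A * Φ) ^ 2) with hB
    have hfin : B * V ≠ ⊤ := (ENNReal.mul_lt_top ENNReal.ofReal_lt_top hVlt).ne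
    refine ⟨(B * V).toNNReal, fun t ht => ?_⟩
    rw [ENNReal.coe_toNNReal hfin]
    have hwt : ‖w t‖ ≤ Cw := by
      rw [← hWw t ht]
      refine (hw t ht.le).1.trans (mul_le_of_le_one_right hCw (Real.exp_le_one_iff.mpr ?_))
      linarith
    set f : ℝ → ℂ := fun τ => w t * (oscillator r ν τ : ℂ) with hf
    have hosc : Differentiable ℝ (oscillator r ν) :=
      (contDiff_oscillator r ν).differentiable (by simp)
    have hfd : ∀ τ, HasDerivAt f (w t * ((deriv (oscillator r ν) τ : ℝ) : ℂ)) τ := fun τ => by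
      have h1 : HasDerivAt (fun τ => (oscillator r ν τ : ℂ))
          ((deriv (oscillator r ν) τ : ℝ) : ℂ) τ :=
        (hosc τ).hasDerivAt.ofReal_comp
      exact h1.const_mul (w t)
    have hfA : ∀ τ, ‖f τ‖ ≤ A := fun τ => by
      rw [hf, norm_mul, Complex.norm_real, Real.norm_eq_abs]
      exact mul_le_mul hwt ((hζ₀ τ).trans (le_max_left _ _)) (abs_nonneg _) hCw
    have hdfA : ∀ τ, ‖deriv f τ‖ ≤ A := fun τ => by
      rw [(hfd τ).deriv, norm_mul, Complex.norm_real, Real.norm_eq_abs]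
      exact mul_le_mul hwt ((hζ₁ τ).trans (le_max_right _ _)) (abs_nonneg _) hCw
    have hA0 : 0 ≤ A := (norm_nonneg _).trans (hfA 0)
    have hp : ∀ p : ℝ × M, ENNReal.ofReal (((n : ℝ) - 1) * gradNormSq (prodModel (n - 1))
        (prodBasis (n - 1)) (cylinderMetric (n - 1) r σ.inner) (fun p : ℝ × M => f p.1 * φ p.2) p
        + (n : ℝ) / 2 * |scalarCurvature (prodModel (n - 1)) (prodBasis (n - 1))
          (cylinderMetric (n - 1) r σ.inner) p| * ‖f p.1 * φ p.2‖ ^ 2) ≤ B := by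
      intro p
      have h1 := hgrad f A (fun τ => (hfd τ).differentiableAt) hfA hdfA p
      have h2 : ‖f p.1 * φ p.2‖ ≤ A * Φ := by
        rw [norm_mul]
        exact mul_le_mul (hfA _) (hΦ _) (norm_nonneg _) hA0
      have h3 : ‖f p.1 * φ p.2‖ ^ 2 ≤ (A * Φ) ^ 2 := pow_le_pow_left₀ (norm_nonneg _) h2 2
      have h4 : 0 ≤ (n : ℝ) / 2 * R := mul_nonneg (by positivity) (abs_nonneg _)
      rw [scalarCurvature_cylinder σ hr.ne' hσ p]
      exact ENNReal.ofReal_le_ofReal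
        (add_le_add (mul_le_mul_of_nonneg_left h1 hn1) (mul_le_mul_of_nonneg_left h3 h4))
    calc _ ≤ ∫⁻ _ in Ioo a c ×ˢ (univ : Set M), B ∂(riemannianVolume (prodModel (n - 1))
          (prodBasis (n - 1)) (cylinderMetric (n - 1) r σ.inner)) := lintegral_mono hp
      _ = B * V := by rw [lintegral_const, Measure.restrict_apply_univ]

end Wave

end Energies

/-! ### Regularity and uniform convergence of the products -/

section Regularity

theorem norm_iteratedFDeriv_mul_le_of_le {X : Type*} [NormedAddCommGroup X] [NormedSpace ℝ X]
    {f g : X → ℂ} {Ω : Set X} (hΩ : IsOpen Ω) (hf : ContDiffOn ℝ 3 f Ω) (hg : ContDiffOn ℝ 3 g Ω)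
    {z : X} (hz : z ∈ Ω) {A B : ℝ} (hA : ∀ k ≤ 3, ‖iteratedFDeriv ℝ k f z‖ ≤ A)
    (hB : ∀ k ≤ 3, ‖iteratedFDeriv ℝ k g z‖ ≤ B) :
    ∀ k ≤ 3, ‖iteratedFDeriv ℝ k (fun z => f z * g z) z‖ ≤ 8 * (A * B) := by
  intro k hk
  have hA0 : 0 ≤ A := (norm_nonneg _).trans (hA 0 (by norm_num))
  have hB0 : 0 ≤ B := (norm_nonneg _).trans (hB 0 (by norm_num))
  have h := norm_iteratedFDerivWithin_mul_le hf hg hΩ.uniqueDiffOn hz (n := k)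
    (by exact_mod_cast hk)
  simp only [iteratedFDerivWithin_of_isOpen _ hΩ hz] at h
  refine h.trans ?_
  calc _ ≤ ∑ i ∈ Finset.range (k + 1), (k.choose i : ℝ) * (A * B) := by
        refine Finset.sum_le_sum fun i hi => ?_
        have hi' : i ≤ k := Nat.lt_succ_iff.mp (Finset.mem_range.mp hi)
        rw [mul_assoc]
        have h1 := hA i (hi'.trans hk)
        have h2 := hB (k - i) ((Nat.sub_le _ _).trans hk)
        gcongr
    _ = 2 ^ k * (A * B) := by
        rw [← Finset.sum_mul]
        exact_mod_cast congrArg (fun m : ℕ => (m : ℝ) * (A * B)) (Nat.sum_range_choose k)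
    _ ≤ 8 * (A * B) := by
        have : (2 : ℝ) ^ k ≤ 2 ^ 3 := pow_le_pow_right₀ (by norm_num) hk
        have h8 : (2 : ℝ) ^ 3 = 8 := by norm_num
        rw [h8] at this
        gcongr

theorem norm_iteratedFDeriv_comp_le {X Y : Type*} [NormedAddCommGroup X] [NormedSpace ℝ X]
    [NormedAddCommGroup Y] [NormedSpace ℝ Y] {f : Y → ℂ} (g : X →L[ℝ] Y) (hg : ‖g‖ ≤ 1) {s : Set Y}
    (hs : IsOpen s) (hf : ContDiffOn ℝ 3 f s) {x : X} (hx : g x ∈ s) {k : ℕ} (hk : k ≤ 3) :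
    ‖iteratedFDeriv ℝ k (fun x => f (g x)) x‖ ≤ ‖iteratedFDeriv ℝ k f (g x)‖ := by
  have hs' : IsOpen (g ⁻¹' s) := hs.preimage g.continuous
  have h := g.iteratedFDerivWithin_comp_right hf hs.uniqueDiffOn hs'.uniqueDiffOn hx (i := k)
    (by exact_mod_cast hk)
  rw [iteratedFDerivWithin_of_isOpen _ hs' hx, iteratedFDerivWithin_of_isOpen _ hs hx] at h
  change ‖iteratedFDeriv ℝ k (f ∘ g) x‖ ≤ _
  rw [h]
  refine (ContinuousMultilinearMap.norm_compContinuousLinearMap_le _ _).trans ?_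
  rw [Finset.prod_const]
  exact mul_le_of_le_one_right (norm_nonneg _) (pow_le_one₀ (norm_nonneg _) hg)

section Strip

variable {E : Type*} [NormedAddCommGroup E] [NormedSpace ℝ E] [ProperSpace E] {T : Set E}
  {F : ℝ × (ℝ × E) → ℂ}

/-- A function on `ℝ × ℝ × T` with third derivatives bounded on `[0, ∞) × ℝ × S`, for every compact
`S ⊆ T`, has Hölder continuous second derivatives there: these are bounded, and Lipschitz because
points at distance less than that of `S` to the complement of `T` can be joined by a segment. -/
theorem contDiffOn_and_holderOnWith_of_bounded (hT : IsOpen T)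
    (hF : ContDiffOn ℝ 3 F (univ ×ˢ (univ ×ˢ T)))
    (hb : ∀ S ⊆ T, IsCompact S → ∃ C : ℝ, 0 ≤ C ∧
      ∀ k ≤ 3, ∀ z ∈ Ici (0 : ℝ) ×ˢ ((univ : Set ℝ) ×ˢ S), ‖iteratedFDeriv ℝ k F z‖ ≤ C)
    {α : ℝ≥0} (hα : α ≤ 1) :
    ContDiffOn ℝ 2 F (Ici 0 ×ˢ (univ ×ˢ T)) ∧
      ∀ S ⊆ T, IsCompact S →
        (∃ C : ℝ, ∀ k ≤ 2, ∀ z ∈ Ici (0 : ℝ) ×ˢ ((univ : Set ℝ) ×ˢ S),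
          ‖iteratedFDerivWithin ℝ k F (Ici 0 ×ˢ (univ ×ˢ T)) z‖ ≤ C) ∧
        ∃ C : ℝ≥0, HolderOnWith C α (iteratedFDerivWithin ℝ 2 F (Ici 0 ×ˢ (univ ×ˢ T)))
          (Ici (0 : ℝ) ×ˢ ((univ : Set ℝ) ×ˢ S)) := by
  set Ω : Set (ℝ × (ℝ × E)) := univ ×ˢ (univ ×ˢ T) with hΩ
  set D : Set (ℝ × (ℝ × E)) := Ici 0 ×ˢ (univ ×ˢ T) with hD
  have hΩo : IsOpen Ω := isOpen_univ.prod (isOpen_univ.prod hT)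
  have hDΩ : D ⊆ Ω := prod_mono (subset_univ _) Subset.rfl
  have hDu : UniqueDiffOn ℝ D := (uniqueDiffOn_Ici 0).prod (isOpen_univ.prod hT).uniqueDiffOn
  have hat : ∀ z ∈ Ω, ContDiffAt ℝ 3 F z := fun z hz => hF.contDiffAt (hΩo.mem_nhds hz)
  have heq : ∀ k ≤ 2, ∀ z ∈ D, iteratedFDerivWithin ℝ k F D z = iteratedFDeriv ℝ k F z := by
    intro k hk z hz
    refine iteratedFDerivWithin_eq_iteratedFDeriv hDu ((hat z (hDΩ hz)).of_le ?_) hz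
    exact_mod_cast hk.trans (by norm_num)
  refine ⟨(hF.mono hDΩ).of_le (by norm_num), fun S hST hS => ?_⟩
  have hSD : Ici (0 : ℝ) ×ˢ ((univ : Set ℝ) ×ˢ S) ⊆ D :=
    prod_mono Subset.rfl (prod_mono Subset.rfl hST)
  obtain ⟨δ, hδ, hδT⟩ := hS.exists_cthickening_subset_open hT hST
  obtain ⟨C, hC0, hC⟩ := hb _ hδT hS.cthickening
  have hCS : ∀ k ≤ 2, ∀ z ∈ Ici (0 : ℝ) ×ˢ ((univ : Set ℝ) ×ˢ S),
      ‖iteratedFDerivWithin ℝ k F D z‖ ≤ C := by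
    intro k hk z hz
    rw [heq k hk z (hSD hz)]
    exact hC k (hk.trans (by norm_num)) z
      ⟨hz.1, hz.2.1, Metric.self_subset_cthickening S hz.2.2⟩
  refine ⟨⟨C, hCS⟩, ?_⟩
  set L : ℝ≥0 := Real.toNNReal (max C (2 * C / δ)) with hL
  have hLv : (L : ℝ) = max C (2 * C / δ) := Real.coe_toNNReal _ (hC0.trans (le_max_left _ _))
  have hlip : LipschitzOnWith L (iteratedFDerivWithin ℝ 2 F D)
      (Ici (0 : ℝ) ×ˢ ((univ : Set ℝ) ×ˢ S)) := by
    refine LipschitzOnWith.of_dist_le_mul fun z hz z' hz' => ?_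
    rw [dist_eq_norm, dist_eq_norm, hLv]
    by_cases hclose : ‖z.2.2 - z'.2.2‖ ≤ δ
    · set Q : Set (ℝ × (ℝ × E)) := Ici 0 ×ˢ (univ ×ˢ Metric.closedBall z'.2.2 δ) with hQ
      have hQS : Q ⊆ Ici (0 : ℝ) ×ˢ ((univ : Set ℝ) ×ˢ Metric.cthickening δ S) :=
        prod_mono Subset.rfl (prod_mono Subset.rfl
          (Metric.closedBall_subset_cthickening hz'.2.2 δ))
      have hQΩ : ∀ x ∈ Q, x ∈ Ω := fun x hx => ⟨mem_univ _, mem_univ _, hδT (hQS hx).2.2⟩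
      have hQc : Convex ℝ Q :=
        (convex_Ici 0).prod (convex_univ.prod (convex_closedBall _ _))
      have hzQ : z ∈ Q := ⟨hz.1, mem_univ _, by rwa [Metric.mem_closedBall, dist_eq_norm]⟩
      have hzQ' : z' ∈ Q := ⟨hz'.1, mem_univ _, Metric.mem_closedBall_self hδ.le⟩
      rw [heq 2 le_rfl z (hSD hz), heq 2 le_rfl z' (hSD hz')]
      have hdiff : ∀ x ∈ Q, DifferentiableAt ℝ (iteratedFDeriv ℝ 2 F) x := fun x hx =>
        (hat x (hQΩ x hx)).differentiableAt_iteratedFDeriv (by norm_num)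
      have hder : ∀ x ∈ Q, ‖fderiv ℝ (iteratedFDeriv ℝ 2 F) x‖ ≤ C := fun x hx => by
        rw [norm_fderiv_iteratedFDeriv]
        exact hC 3 le_rfl x (hQS hx)
      exact (hQc.norm_image_sub_le_of_norm_fderiv_le hdiff hder hzQ' hzQ).trans
        (mul_le_mul_of_nonneg_right (le_max_left _ _) (norm_nonneg _))
    · have h1 : δ ≤ ‖z - z'‖ := (not_le.mp hclose).le.trans
        ((norm_snd_le (z - z').2).trans (norm_snd_le (z - z')))
      calc _ ≤ 2 * C := by
            refine (norm_sub_le _ _).trans ?_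
            have := hCS 2 le_rfl z hz
            have := hCS 2 le_rfl z' hz'
            linarith
        _ = 2 * C / δ * δ := by field_simp
        _ ≤ max C (2 * C / δ) * ‖z - z'‖ := by
            gcongr
            exact le_max_right _ _
  -- bounded functions are Hölder continuous with exponent `0`; interpolate with Lipschitz
  -- continuity
  have hbd : HolderOnWith (Real.toNNReal (2 * C)) 0 (iteratedFDerivWithin ℝ 2 F D)
      (Ici (0 : ℝ) ×ˢ ((univ : Set ℝ) ×ˢ S)) := by
    intro z hz z' hz'
    rw [NNReal.coe_zero, ENNReal.rpow_zero, mul_one, edist_dist, dist_eq_norm]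
    refine ENNReal.ofReal_le_ofReal ((norm_sub_le _ _).trans ?_)
    have := hCS 2 le_rfl z hz
    have := hCS 2 le_rfl z' hz'
    linarith
  exact ⟨_, hbd.of_le_of_le (holderOnWith_one.mpr hlip) zero_le hα⟩

end Strip

variable {n : ℕ} {Λ : ℝ}
  {M : Type*} [TopologicalSpace M] [ChartedSpace (EuclideanSpace ℝ (Fin (n - 1))) M]
  {φ : M → ℂ} {lam : ℝ} {W D w : ℝ → ℂ}

theorem isSmoothInterior_productFunction {d : ℕ} {M : Type*} [TopologicalSpace M]
    [ChartedSpace (EuclideanSpace ℝ (Fin d)) M] {φ : M → ℂ}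
    (hφ : ContMDiff (𝓡 d) 𝓘(ℝ, ℂ) ∞ φ) (hW : IsTemporalSolution n Λ lam W D)
    (hWw : ∀ t > 0, W t = w t) {ζ : ℝ → ℝ} (hζ : ContDiff ℝ ∞ ζ) :
    IsSmoothInterior d (productFunction w ζ φ) := by
  have hw : ContDiffOn ℝ ∞ w (Ioi 0) := hW.contDiffOn_Ioi.congr fun t ht => (hWw t ht).symm
  have h1 : ContMDiffOn (𝓘(ℝ, ℝ).prod (prodModel d)) 𝓘(ℝ, ℂ) ∞
      (fun z : ℝ × (ℝ × M) => w z.1) (Ioi 0 ×ˢ univ) :=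
    hw.contMDiffOn.comp contMDiffOn_fst fun z hz => hz.1
  have h2 : ContMDiffOn (𝓘(ℝ, ℝ).prod (prodModel d)) 𝓘(ℝ, ℂ) ∞
      (fun z : ℝ × (ℝ × M) => (ζ z.2.1 : ℂ)) (Ioi 0 ×ˢ univ) :=
    ((Complex.ofRealCLM.contDiff.comp hζ).contMDiff.comp
      (contMDiff_fst.comp contMDiff_snd)).contMDiffOn
  have h3 : ContMDiffOn (𝓘(ℝ, ℝ).prod (prodModel d)) 𝓘(ℝ, ℂ) ∞
      (fun z : ℝ × (ℝ × M) => φ z.2.2) (Ioi 0 ×ˢ univ) :=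
    (hφ.comp (contMDiff_snd.comp contMDiff_snd)).contMDiffOn
  have hmul : ContDiff ℝ ∞ fun z : ℂ × (ℂ × ℂ) => z.1 * z.2.1 * z.2.2 := by fun_prop
  exact hmul.contMDiff.comp_contMDiffOn (h1.prodMk_space (h2.prodMk_space h3))

/-- The extension to `t ≥ 0` uses the solution `W` in place of `w`. In a chart it is a product of
three functions of one variable each, with derivatives up to order three bounded on the sets in
question. -/
theorem isC2HolderUpToZero_productFunction {d : ℕ} {M : Type*} [TopologicalSpace M]
    [ChartedSpace (EuclideanSpace ℝ (Fin d)) M] [IsManifold (𝓡 d) ∞ M] {φ : M → ℂ}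
    (hn : 3 ≤ n) (hΛ : Λ < 0)
    (hφ : ContMDiff (𝓡 d) 𝓘(ℝ, ℂ) ∞ φ) (hW : IsTemporalSolution n Λ lam W D)
    (hWw : ∀ t > 0, W t = w t) (r ν : ℝ) {α : ℝ≥0} (hα : α ≤ 1) :
    IsC2HolderUpToZero d α (productFunction w (oscillator r ν) φ) := by
  refine ⟨productFunction W (oscillator r ν) φ, fun t ht => funext fun p => ?_, fun x₀ => ?_⟩
  · simp only [productFunction, hWw t ht]
  set T := (extChartAt (𝓡 d) x₀).target with hTdef
  have hT : IsOpen T := isOpen_extChartAt_target (I := 𝓡 d) x₀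
  set ζ : ℝ → ℂ := fun τ => (oscillator r ν τ : ℂ) with hζ
  set P : EuclideanSpace ℝ (Fin d) → ℂ := fun y => φ ((extChartAt (𝓡 d) x₀).symm y) with hP
  have hPs : ContDiffOn ℝ 3 P T :=
    (contDiffOn_comp_extChartAt_symm hφ x₀).of_le ENat.LEInfty.out
  have hζs : ContDiff ℝ 3 ζ := (Complex.ofRealCLM.contDiff.comp (contDiff_oscillator r ν)).of_le
    ENat.LEInfty.out
  have hWs : ContDiff ℝ 3 W := hW.contDiff_three hn hΛ
  let X := ℝ × (ℝ × EuclideanSpace ℝ (Fin d))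
  let pr₁ : X →L[ℝ] ℝ := ContinuousLinearMap.fst ℝ ℝ (ℝ × EuclideanSpace ℝ (Fin d))
  let pr₂ : X →L[ℝ] ℝ := (ContinuousLinearMap.fst ℝ ℝ (EuclideanSpace ℝ (Fin d))).comp
    (ContinuousLinearMap.snd ℝ ℝ (ℝ × EuclideanSpace ℝ (Fin d)))
  let pr₃ : X →L[ℝ] EuclideanSpace ℝ (Fin d) :=
    (ContinuousLinearMap.snd ℝ ℝ (EuclideanSpace ℝ (Fin d))).comp
    (ContinuousLinearMap.snd ℝ ℝ (ℝ × EuclideanSpace ℝ (Fin d)))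
  have hpr₁ : ‖pr₁‖ ≤ 1 := ContinuousLinearMap.norm_fst_le _ _ _
  have hpr₂ : ‖pr₂‖ ≤ 1 := pr₂.opNorm_le_bound zero_le_one fun z => by
    rw [one_mul]
    exact (norm_fst_le z.2).trans (norm_snd_le z)
  have hpr₃ : ‖pr₃‖ ≤ 1 := pr₃.opNorm_le_bound zero_le_one fun z => by
    rw [one_mul]
    exact (norm_snd_le z.2).trans (norm_snd_le z)
  set Ω : Set X := univ ×ˢ (univ ×ˢ T) with hΩ
  have hΩo : IsOpen Ω := isOpen_univ.prod (isOpen_univ.prod hT)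
  have h1 : ContDiffOn ℝ 3 (fun z : X => W (pr₁ z)) Ω := (hWs.comp pr₁.contDiff).contDiffOn
  have h2 : ContDiffOn ℝ 3 (fun z : X => ζ (pr₂ z)) Ω := (hζs.comp pr₂.contDiff).contDiffOn
  have h3 : ContDiffOn ℝ 3 (fun z : X => P (pr₃ z)) Ω :=
    hPs.comp pr₃.contDiff.contDiffOn fun z hz => hz.2.2
  refine contDiffOn_and_holderOnWith_of_bounded (T := T)
    (F := fun z : X => W (pr₁ z) * ζ (pr₂ z) * P (pr₃ z)) hT ((h1.mul h2).mul h3) ?_ hα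
  intro S hST hS
  obtain ⟨CW, hCW0, hCW⟩ := hW.exists_norm_iteratedDeriv_le hn hΛ
  have hζb : ∃ C : ℝ, 0 ≤ C ∧ ∀ k ≤ 3, ∀ τ, ‖iteratedFDeriv ℝ k ζ τ‖ ≤ C := by
    choose C hC0 hC using exists_abs_iteratedDeriv_oscillator_le r ν
    refine ⟨∑ k ∈ Finset.range 4, C k, Finset.sum_nonneg fun k _ => hC0 k, fun k hk τ => ?_⟩
    have e1 := Complex.ofRealLI.norm_iteratedFDeriv_comp_left (f := oscillator r ν) (x := τ)
      (i := k) (n := ∞) (contDiff_oscillator r ν).contDiffAt (by exact_mod_cast le_top)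
    refine (e1.trans norm_iteratedFDeriv_eq_norm_iteratedDeriv).le.trans ((hC k τ).trans ?_)
    exact Finset.single_le_sum (fun k _ => hC0 k) (Finset.mem_range.mpr (by omega))
  obtain ⟨Cζ, hCζ0, hCζ⟩ := hζb
  have hPb : ∃ C : ℝ, 0 ≤ C ∧ ∀ k ≤ 3, ∀ y ∈ S, ‖iteratedFDeriv ℝ k P y‖ ≤ C := by
    have hk : ∀ k, k ≤ 3 → ∃ C : ℝ, ∀ y ∈ S, ‖iteratedFDeriv ℝ k P y‖ ≤ C := by
      intro k hk
      have hc := (hPs.continuousOn_iteratedFDerivWithin (m := k) (by exact_mod_cast hk)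
        hT.uniqueDiffOn).congr fun y hy => (iteratedFDerivWithin_of_isOpen k hT hy).symm
      exact hS.exists_bound_of_continuousOn (hc.mono hST)
    choose! C hC using hk
    refine ⟨∑ k ∈ Finset.range 4, |C k|, Finset.sum_nonneg fun k _ => abs_nonneg _,
      fun k hk y hy => ((hC k hk y hy).trans (le_abs_self _)).trans ?_⟩
    exact Finset.single_le_sum (f := fun k => |C k|) (fun k _ => abs_nonneg _)
      (Finset.mem_range.mpr (by omega))
  obtain ⟨CP, hCP0, hCP⟩ := hPb
  refine ⟨8 * (8 * (CW * Cζ) * CP), by positivity, fun k hk z hz => ?_⟩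
  have hzΩ : z ∈ Ω := ⟨mem_univ _, mem_univ _, hST hz.2.2⟩
  refine norm_iteratedFDeriv_mul_le_of_le hΩo (h1.mul h2) h3 hzΩ
    (norm_iteratedFDeriv_mul_le_of_le hΩo h1 h2 hzΩ (fun k hk => ?_) fun k hk => ?_)
    (fun k hk => ?_) k hk
  · refine (norm_iteratedFDeriv_comp_le pr₁ hpr₁ isOpen_univ hWs.contDiffOn (mem_univ _)
      hk).trans ?_
    rw [norm_iteratedFDeriv_eq_norm_iteratedDeriv]
    exact hCW k hk _ hz.1
  · exact (norm_iteratedFDeriv_comp_le pr₂ hpr₂ isOpen_univ hζs.contDiffOn (mem_univ _) hk).trans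
      (hCζ k hk _)
  · exact (norm_iteratedFDeriv_comp_le pr₃ hpr₃ hT hPs (hST hz.2.2) hk).trans
      (hCP k hk _ hz.2.2)

theorem tendstoUniformly_productFunction {M : Type*} [TopologicalSpace M] [CompactSpace M]
    {w : ℝ → ℂ} {ζ : ℝ → ℝ} {C : ℝ} (hζ : ∀ τ, |ζ τ| ≤ C) {φ : M → ℂ} (hφ : Continuous φ)
    (l : Filter ℝ) (hw : Tendsto w l (𝓝 0)) : TendstoUniformly (productFunction w ζ φ) 0 l := by
  obtain ⟨Φ, hΦ⟩ := isCompact_univ.exists_bound_of_continuousOn hφ.continuousOn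
  rw [Metric.tendstoUniformly_iff]
  intro ε hε
  have h1 : Tendsto (fun t => ‖w t‖ * (C * |Φ|)) l (𝓝 0) := by
    simpa using hw.norm.mul_const (C * |Φ|)
  filter_upwards [h1.eventually_lt_const hε] with t ht p
  rw [Pi.zero_apply, dist_zero_left]
  refine lt_of_le_of_lt ?_ ht
  rw [productFunction, norm_mul, norm_mul, Complex.norm_real, Real.norm_eq_abs, mul_assoc]
  have h2 := hζ p.1
  have h3 : ‖φ p.2‖ ≤ |Φ| := (hΦ p.2 (mem_univ _)).trans (le_abs_self _)
  have hC : 0 ≤ C := (abs_nonneg _).trans h2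
  gcongr

end Regularity

end

end QuantumBlackHole

theorem theorem2p3
    (n : ℕ) (hn : 3 ≤ n)
    -- the black hole: mass, cosmological constant, curvature of the space form, horizon radius
    (m Λ κ r₀ : ℝ) (hm : 0 < m) (hΛ : Λ < 0) (hκ : κ = -1 ∨ κ = 0 ∨ κ = 1)
    (hr₀ : 0 < r₀) (hhorizon : QuantumBlackHole.horizonFunction n m Λ κ r₀ = 0)
    -- the compact space form `M` of dimension `n - 1` with metric `σ` and curvature `κ`
    {M : Type*} [TopologicalSpace M] [T2Space M] [CompactSpace M] [ConnectedSpace M]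
    [MeasurableSpace M] [BorelSpace M]
    [ChartedSpace (EuclideanSpace ℝ (Fin (n - 1))) M] [IsManifold (𝓡 (n - 1)) ∞ M]
    (σ : Bundle.ContMDiffRiemannianMetric (𝓡 (n - 1)) ∞ (EuclideanSpace ℝ (Fin (n - 1)))
      (fun x : M => TangentSpace (𝓡 (n - 1)) x))
    (hσ : QuantumBlackHole.HasConstantCurvature (𝓡 (n - 1)) (QuantumBlackHole.stdBasis (n - 1))
      σ.inner κ)
    -- the eigenfunctions of `-Δ_M` and the temporal eigenfunctions
    (φ : ℕ → M → ℂ) (μ : ℕ → ℝ)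
    (hφ : QuantumBlackHole.IsLaplaceSpectrum (𝓡 (n - 1)) (QuantumBlackHole.stdBasis (n - 1))
      σ.inner φ μ)
    (w : ℕ → ℝ → ℂ) (lam : ℕ → ℝ)
    (hw : QuantumBlackHole.IsTemporalSpectrum n Λ w lam) :
    ∃ α : ℝ≥0, 2 / 3 ≤ α ∧ α < 1 ∧
    ∃ (i₀ : ℕ → ℕ) (freq : ℕ → ℕ → ℝ),
      (∀ j, IsLeast {i | QuantumBlackHole.muHat n r₀ κ (μ j) ≤ lam i} (i₀ j)) ∧
      (∀ i, Tendsto (w i) (𝓝[>] 0) (𝓝 0) ∧ Tendsto (w i) atTop (𝓝 0)) ∧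
      (∀ j, ∀ i ≥ i₀ j,
        let ζ : ℝ → ℝ := QuantumBlackHole.oscillator r₀ (freq i j)
        let u : ℝ → ℝ × M → ℂ := QuantumBlackHole.productFunction (w i) ζ (φ j)
        0 ≤ freq i j ∧
        lam i = ((n : ℝ) - 1) * (r₀ ^ 2)⁻¹ * freq i j ^ 2
          + QuantumBlackHole.muHat n r₀ κ (μ j) ∧
        ContDiff ℝ ∞ ζ ∧
        (∀ τ, -iteratedDeriv 2 ζ τ = (r₀ ^ 2)⁻¹ * freq i j ^ 2 * ζ τ) ∧
        (0 < freq i j → ∫ τ in (0 : ℝ)..(Real.pi / (r₀⁻¹ * freq i j)), ζ τ ^ 2 = 1) ∧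
        QuantumBlackHole.SolvesWaveEquation n Λ
          (QuantumBlackHole.cylinderMetric (n - 1) r₀ σ.inner) u ∧
        QuantumBlackHole.HasBoundedEnergies n Λ
          (QuantumBlackHole.cylinderMetric (n - 1) r₀ σ.inner) u ∧
        TendstoUniformly u 0 (𝓝[>] 0) ∧
        TendstoUniformly u 0 atTop ∧
        QuantumBlackHole.IsSmoothInterior (n - 1) u ∧
        QuantumBlackHole.IsC2HolderUpToZero (n - 1) α u) ∧
      (∀ j, ∀ i > i₀ j, 0 < freq i j) ∧
      (∀ j, lam (i₀ j) = QuantumBlackHole.muHat n r₀ κ (μ j) →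
        QuantumBlackHole.oscillator r₀ (freq (i₀ j) j) = 1) ∧
      (κ ≠ -1 →
        QuantumBlackHole.muHat n r₀ κ (μ 0) ≤ 0 ∧
        (∃ c : ℂ, c ≠ 0 ∧ ∀ x, φ 0 x = c) ∧
        ∀ i, 0 < freq i 0) := by
  have hn' : (3 : ℝ) ≤ n := by exact_mod_cast hn
  set k : ℝ := ((n : ℝ) - 1) * (r₀ ^ 2)⁻¹ with hk
  have hk0 : 0 < k := mul_pos (by linarith) (by positivity)
  choose W D hW hWw using fun i => (hw.eigenpair i).exists_isTemporalSolution hn hΛ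
  have hne : ∀ i, ∃ t > 0, W i t ≠ 0 := fun i => by
    obtain ⟨t, ht, hwt⟩ := (hw.eigenpair i).2.1
    exact ⟨t, ht, by rwa [hWw i t ht]⟩
  have hex : ∀ j, ∃ i, QuantumBlackHole.muHat n r₀ κ (μ j) ≤ lam i := fun j =>
    QuantumBlackHole.exists_le_eigenvalue hn hΛ hw.strictMono.injective hW hne _
  classical
  set i₀ : ℕ → ℕ := fun j => Nat.find (hex j)
  have hi₀le : ∀ j, QuantumBlackHole.muHat n r₀ κ (μ j) ≤ lam (i₀ j) := fun j =>
    Nat.find_spec (hex j)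
  -- `ω_{ij}` solves `λ_i = k ω² + μ̂_j`; for `i < i₀ j` the root of the negative number is `0`
  set freq : ℕ → ℕ → ℝ := fun i j =>
    √((lam i - QuantumBlackHole.muHat n r₀ κ (μ j)) / k) with hfreq
  have hpos : ∀ i j, QuantumBlackHole.muHat n r₀ κ (μ j) < lam i → 0 < freq i j := fun i j h =>
    Real.sqrt_pos.mpr (div_pos (sub_pos.mpr h) hk0)
  have htendsto : ∀ i, Tendsto (w i) (𝓝[>] 0) (𝓝 0) ∧ Tendsto (w i) atTop (𝓝 0) := fun i =>
    ⟨(hW i).tendsto_zero.congr' (by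
      filter_upwards [self_mem_nhdsWithin] with t ht using hWw i t ht),
    ((hW i).tendsto_atTop hn hΛ).congr' (by
      filter_upwards [eventually_gt_atTop 0] with t ht using hWw i t ht)⟩
  -- the second derivatives are even Lipschitz continuous, so every exponent below `1` would do
  refine ⟨2 / 3, le_rfl, ?_, i₀, freq, fun j => ⟨hi₀le j, fun i hi => Nat.find_min' (hex j) hi⟩,
    htendsto, fun j i hi => ?_, fun j i hi => ?_, fun j hj => ?_, fun hκ1 => ?_⟩
  · rw [← NNReal.coe_lt_coe]
    push_cast
    norm_num
  · have hle : QuantumBlackHole.muHat n r₀ κ (μ j) ≤ lam i :=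
      (hi₀le j).trans (hw.strictMono.monotone hi)
    have hlam : lam i = k * freq i j ^ 2 + QuantumBlackHole.muHat n r₀ κ (μ j) := by
      rw [hfreq, Real.sq_sqrt (div_nonneg (sub_nonneg.mpr hle) hk0.le), mul_div_cancel₀ _ hk0.ne',
        sub_add_cancel]
    have hζ := QuantumBlackHole.contDiff_oscillator r₀ (freq i j)
    have hunif : ∀ l : Filter ℝ, Tendsto (w i) l (𝓝 0) → TendstoUniformly
        (QuantumBlackHole.productFunction (w i) (QuantumBlackHole.oscillator r₀ (freq i j)) (φ j))
        0 l := QuantumBlackHole.tendstoUniformly_productFunction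
          (QuantumBlackHole.abs_oscillator_le r₀ (freq i j)) (hφ.eigenpair j).1.continuous
    exact ⟨Real.sqrt_nonneg _, hlam, hζ,
      QuantumBlackHole.iteratedDeriv_two_oscillator r₀ (freq i j),
      QuantumBlackHole.integral_oscillator_sq hr₀,
      QuantumBlackHole.solvesWaveEquation_productFunction σ hn hΛ hr₀.ne' hσ (hφ.eigenpair j)
        (hW i) (hWw i) hζ (QuantumBlackHole.iteratedDeriv_two_oscillator r₀ (freq i j)) hlam,
      QuantumBlackHole.hasBoundedEnergies_productFunction σ hn hΛ hr₀ hσ (hφ.eigenpair j).1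
        (hW i) (hWw i) _,
      hunif _ (htendsto i).1, hunif _ (htendsto i).2,
      QuantumBlackHole.isSmoothInterior_productFunction (hφ.eigenpair j).1 (hW i) (hWw i) hζ,
      QuantumBlackHole.isC2HolderUpToZero_productFunction hn hΛ (hφ.eigenpair j).1 (hW i) (hWw i)
        r₀ _ (div_le_one_of_le₀ (by norm_num) zero_le)⟩
  · exact hpos i j ((hi₀le j).trans_lt (hw.strictMono hi))
  · -- here `ω = 0`, and `ζ_0 = 1` by definition
    funext τ
    simp [QuantumBlackHole.oscillator, hfreq, hj]
  · have hκ0 : 0 ≤ κ := by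
      rcases hκ with h | h | h
      · exact absurd h hκ1
      · exact h.ge
      · rw [h]
        exact zero_le_one
    -- `μ 0 = 0` leaves only the curvature term of `μ̂_0`, which has a sign; the `λ_i` are positive
    have hμ : QuantumBlackHole.muHat n r₀ κ (μ 0) ≤ 0 := by
      rw [hφ.eigenvalue_zero σ]
      exact QuantumBlackHole.muHat_zero_nonpos hn hκ0 r₀
    refine ⟨hμ, hφ.exists_eq_const σ, fun i => hpos i 0 ?_⟩
    obtain ⟨t, ht, hWt⟩ := hne i
    exact hμ.trans_lt ((hW i).eigenvalue_pos hn hΛ ht hWt)
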